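/- Let $\Bbbk$ be an algebraically closed field, let $n\ge 0$, and let $Q$ be a quiver of Dynkin type $\mathbb A_{n+2}$ with vertices labelled $1,\dots,n+2$ in linear order. Let $\mathrm{rep}\,Q$ be the category of finite dimensional representations of $Q$ over $\Bbbk$ and $\mathrm{ind}\,Q$ its full subcategory of indecomposable representations. For $1\le a\le b\le n+2$ let $M(a,b)$ be the representation with $\Bbbk$ at the vertices $\ell$ with $a\le \ell\le b$, $0$ at all other vertices, and identity maps wherever possible. Let $P(Q)$ be a convex $(n+3)$-gon with vertices $0,1,\dots,n+2$ placed from left to right, with $0$ and $n+2$ on a horizontal line $L$, and, for $1\le\ell\le n+1$, the vertex $\ell$ above $L$ if $\ell\to\ell+1$ in $Q$ and below $L$ if $\ell\leftarrow\ell+1$ in $Q$. Let $R$ send each vertex of $P(Q)$ to its clockwise neighbour on the boundary. Let $\Gamma_{P(Q)}$ be the quiver whose vertices are the line segments $\gamma(i,j)$, $0\le i<j\le n+2$, with one arrow $\gamma(i,j)\to\gamma(i',j')$ if $\gamma(i',j')$ is a pivot of $\gamma(i,j)$, that is, if $(i',j')=(R^{-1}(i),j)$ or $(i',j')=(i,R^{-1}(j))$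 (and $i'<j'$). Put $R(\gamma(i,j))=\gamma(R(i),R(j))$ if $R(i)<R(j)$, and let $R(\gamma(i,j))$ be undefined (written $0$) otherwise. Let $\mathcal C_{P(Q)}$ be the mesh category of $(\Gamma_{P(Q)},R)$: the $\Bbbk$-linear path category of $\Gamma_{P(Q)}$ modulo the ideal generated by the mesh relations $\sum_{y\to x}(Rx\to y\to x)$, one for each line segment $x$ with $R(x)$ defined. For each pivot $\gamma(i,j)\to\gamma(i',j')$, the map $M(i+1,j)\to M(i'+1,j')$ that is the identity of $\Bbbk$ on the common support and $0$ elsewhere is a morphism of representations: an inclusion (adding a hook) or a projection (removing a cohook). Consider the $\Bbbk$-linear functors $F\colon\mathcal C_{P(Q)}\to\mathrm{ind}\,Q$ with $F(\gamma(i,j))=M(i+1,j)$ that send each pivot to a nonzero scalar multiple of this morphism, that is, those given by any choice of nonzero scalars for which the mesh relations hold. Then such functors $F$ exist, the scalars can even be chosen in $\{1,-1\}$, and every such $F$ is an equivalence of categories. Moreover, for every such $F$: 1. $(\Gamma_{P(Q)},R)$ and $(\Gamma_{\mathrm{rep}\,Q},\tau)$ are translation quivers, and $\gamma\mapsto[F(\gamma)]$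 is the map on vertices of an isomorphism between them. Here $\Gamma_{\mathrm{rep}\,Q}$ is the Auslander--Reiten quiver, whose vertices are the isomorphism classes of indecomposable representations, with $\dim_\Bbbk \mathrm{rad}(M,N)/\mathrm{rad}^2(M,N)$ arrows from $[M]$ to $[N]$, and $\tau$ is the Auslander--Reiten translation, defined at the nonprojective indecomposables, with $\tau M$ the left end term of an almost split sequence $0\to\tau M\to E\to M\to 0$. On arrows, for all line segments $\gamma,\delta$, the classes of the morphisms $F(p)$, for $p\colon\gamma\to\delta$ a pivot, form a basis of $\mathrm{rad}(F\gamma,F\delta)/\mathrm{rad}^2(F\gamma,F\delta)$. 2. $F$ induces bijections from the set of line segments of $P(Q)$ to the set of isomorphism classes of indecomposable representations, and from the set of pivots to the set of isomorphism classes (in the category of morphisms of $\mathrm{rep}\,Q$) of irreducible morphisms between indecomposable representations. 3. $F\circ R=\tau\circ F$: for a line segment $\gamma$, $R(\gamma)=0$ if and only if $F(\gamma)$ is projective, and $R(\gamma)=\delta$ if and only if $F(\delta)\cong\tau F(\gamma)$. 4. The additive closure $\mathrm{add}\,\mathcal C_{P(Q)}$ (formal finite direct sums of line segments, with matrices of morphisms)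 is an abelian category, and the additive extension $\mathrm{add}\,\mathcal C_{P(Q)}\to\mathrm{rep}\,Q$ of $F$ is an equivalence and an exact functor. -/

import Mathlib

open CategoryTheory CategoryTheory.Limits

universe u v w v' w'

noncomputable section

/-! ## Translation quivers and mesh categories

A translation quiver is a quiver `V` together with a partially defined map `τ`;
`τ x = none` means that `τ` is not defined at `x`. -/

namespace TransQuiver

/-- The axioms of a translation quiver: there are no loops, `τ` is injective on its domain, and for
`x` in the domain the number of arrows `y ⟶ x` is the number of arrows `τ x ⟶ y`. -/
structure IsTranslationQuiver {V : Type u} [Quiver.{v} V] (τ : V → Option V) : Prop where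
  no_loops : ∀ x : V, IsEmpty (x ⟶ x)
  injective : ∀ x y z : V, τ x = some z → τ y = some z → x = y
  card_arrows : ∀ x z : V, τ x = some z → ∀ y : V, Nat.card (y ⟶ x) = Nat.card (z ⟶ y)

/-- Isomorphisms of translation quivers. -/
structure Iso {V : Type u} [Quiver.{v} V] {W : Type w} [Quiver.{v'} W]
    (τ : V → Option V) (σ : W → Option W) where
  vertex : V ≃ W
  arrow : ∀ x y : V, (x ⟶ y) ≃ (vertex x ⟶ vertex y)
  translation : ∀ x : V, (τ x).map vertex = σ (vertex x)

section PathCategory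

variable (k : Type u) [Field k] {V : Type w} [Quiver.{v} V]

/-- The path category of `V` over `k`: morphisms are formal `k`-linear combinations of paths. -/
abbrev PathCategory (V : Type w) [Quiver.{v} V] := Free k (Paths V)

/-- The vertex `x`, as an object of the path category. -/
def pathObj (x : V) : PathCategory k V := Free.of k ((Paths.of V).obj x)

/-- The vertex underlying an object of the path category. -/
def pathVertex (X : PathCategory k V) : V := X

/-- A path, as a morphism of the path category. -/
def ofPath {X Y : PathCategory k V} (p : Quiver.Path (pathVertex k X) (pathVertex k Y)) : X ⟶ Y :=
  (Free.embedding k (Paths V)).map p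

/-- An arrow, as a morphism of the path category. -/
def pathArrow {x y : V} (α : x ⟶ y) : pathObj k x ⟶ pathObj k y :=
  ofPath k (X := pathObj k x) (Y := pathObj k y) α.toPath

theorem ofPath_comp {X Y Z : PathCategory k V} (p : Quiver.Path (pathVertex k X) (pathVertex k Y))
    (q : Quiver.Path (pathVertex k Y) (pathVertex k Z)) :
    ofPath k p ≫ ofPath k q = ofPath k (p.comp q) :=
  ((Free.embedding k (Paths V)).map_comp p q).symm

theorem pathCategory_induction {X Y : PathCategory k V} {P : (X ⟶ Y) → Prop} (f : X ⟶ Y)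
    (h0 : P 0) (hadd : ∀ f g, P f → P g → P (f + g))
    (hsmul : ∀ (r : k) (p : Quiver.Path (pathVertex k X) (pathVertex k Y)),
      P (r • ofPath k p)) : P f := by
  refine Finsupp.induction_linear (motive := P) f h0 hadd fun p r => ?_
  have h := hsmul r p
  have e : r • ofPath k p = (Finsupp.single p r : X ⟶ Y) := by
    refine (Finsupp.smul_single r p (1 : k)).trans ?_
    rw [smul_eq_mul, mul_one]
  rwa [e] at h

variable {D : Type w'} [Category.{v'} D] [Preadditive D] [Linear k D]

/-- The `k`-linear map on combinations of paths that is given by its values on the arrows. -/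
def pathLiftMap (φ : V ⥤q D) (X Y : PathCategory k V) :
    (X ⟶ Y) →ₗ[k] (φ.obj (pathVertex k X) ⟶ φ.obj (pathVertex k Y)) :=
  Finsupp.linearCombination k
    (fun p : Quiver.Path (pathVertex k X) (pathVertex k Y) => (Paths.lift φ).map p)

theorem pathLiftMap_ofPath (φ : V ⥤q D) {X Y : PathCategory k V}
    (p : Quiver.Path (pathVertex k X) (pathVertex k Y)) :
    pathLiftMap k φ X Y (ofPath k p) = (Paths.lift φ).map p := by
  have := Finsupp.linearCombination_single k (v := fun
    p : Quiver.Path (pathVertex k X) (pathVertex k Y) => (Paths.lift φ).map p) 1 p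
  rw [one_smul] at this
  exact this

theorem pathLiftMap_comp (φ : V ⥤q D) {X Y Z : PathCategory k V} (f : X ⟶ Y) (g : Y ⟶ Z) :
    pathLiftMap k φ X Z (f ≫ g) = pathLiftMap k φ X Y f ≫ pathLiftMap k φ Y Z g := by
  refine pathCategory_induction k (P := fun f => pathLiftMap k φ X Z (f ≫ g) =
    pathLiftMap k φ X Y f ≫ pathLiftMap k φ Y Z g) f ?_ (fun f f' h h' => ?_) fun r p => ?_
  · rw [zero_comp, map_zero, map_zero, zero_comp]
  · rw [Preadditive.add_comp, map_add, map_add, h, h', Preadditive.add_comp]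
  refine pathCategory_induction k (P := fun g => pathLiftMap k φ X Z (_ ≫ g) =
    pathLiftMap k φ X Y _ ≫ pathLiftMap k φ Y Z g) g ?_ (fun f f' h h' => ?_) fun s q => ?_
  · rw [comp_zero, map_zero, map_zero, comp_zero]
  · rw [Preadditive.comp_add, map_add, map_add, h, h', Preadditive.comp_add]
  rw [Linear.smul_comp, Linear.comp_smul, map_smul, map_smul, map_smul, map_smul,
    Linear.smul_comp, Linear.comp_smul, ofPath_comp, pathLiftMap_ofPath, pathLiftMap_ofPath,
    pathLiftMap_ofPath]
  exact congrArg (fun t => r • s • t) ((Paths.lift φ).map_comp p q)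

/-- The `k`-linear functor on the path category that is given by its values on the arrows. -/
def pathLift (φ : V ⥤q D) : PathCategory k V ⥤ D where
  obj X := φ.obj (pathVertex k X)
  map {X Y} f := pathLiftMap k φ X Y f
  map_id X := (pathLiftMap_ofPath k φ (X := X) Quiver.Path.nil).trans
    ((Paths.lift φ).map_id X)
  map_comp f g := pathLiftMap_comp k φ f g

theorem pathLift_pathArrow (φ : V ⥤q D) {x y : V} (α : x ⟶ y) :
    (pathLift k φ).map (pathArrow k α) = φ.map α :=
  (pathLiftMap_ofPath k φ _).trans (Paths.lift_toPath φ α)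

instance pathLift_additive (φ : V ⥤q D) : (pathLift k φ).Additive where
  map_add {X Y} f g := (pathLiftMap k φ X Y).map_add f g

instance pathLift_linear (φ : V ⥤q D) : (pathLift k φ).Linear k where
  map_smul {X Y} f r := (pathLiftMap k φ X Y).map_smul r f

end PathCategory

section Mesh

variable (k : Type u) [Field k] {V : Type w} [Quiver.{v} V] [Fintype V]
  [∀ x y : V, Fintype (x ⟶ y)] (τ : V → Option V)

/-- The mesh relation at `x` with `z = τ x`. There being no multiple arrows, each arrow
`α : y ⟶ x` has exactly one partner `β = σ(α) : z ⟶ y`, so this is the sum of all `σ(α) α`. -/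
def meshRelator (z x : V) : pathObj k z ⟶ pathObj k x :=
  ∑ y : V, ∑ β : z ⟶ y, ∑ α : y ⟶ x, pathArrow k β ≫ pathArrow k α

/-- The mesh ideal: the two-sided ideal generated by the mesh relations. -/
def meshIdeal (X Y : PathCategory k V) : Submodule k (X ⟶ Y) :=
  Submodule.span k {f | ∃ (x z : V) (_ : τ x = some z) (p : X ⟶ pathObj k z)
    (q : pathObj k x ⟶ Y), f = p ≫ meshRelator k z x ≫ q}

/-- Congruence modulo the mesh ideal. -/
def meshRel : HomRel (PathCategory k V) := fun X Y f g => f - g ∈ meshIdeal k τ X Y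

theorem meshIdeal_comp_left {X Y Z : PathCategory k V} (f : X ⟶ Y) {g : Y ⟶ Z}
    (hg : g ∈ meshIdeal k τ Y Z) : f ≫ g ∈ meshIdeal k τ X Z := by
  have : meshIdeal k τ Y Z ≤ (meshIdeal k τ X Z).comap (Linear.leftComp k Z f) := by
    refine Submodule.span_le.2 ?_
    rintro _ ⟨x, z, h, p, q, rfl⟩
    exact Submodule.subset_span ⟨x, z, h, f ≫ p, q, by simp⟩
  exact this hg

theorem meshIdeal_comp_right {X Y Z : PathCategory k V} {f : X ⟶ Y} (g : Y ⟶ Z)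
    (hf : f ∈ meshIdeal k τ X Y) : f ≫ g ∈ meshIdeal k τ X Z := by
  have : meshIdeal k τ X Y ≤ (meshIdeal k τ X Z).comap (Linear.rightComp k X g) := by
    refine Submodule.span_le.2 ?_
    rintro _ ⟨x, z, h, p, q, rfl⟩
    exact Submodule.subset_span ⟨x, z, h, p, q ≫ g, by simp⟩
  exact this hf

instance meshRel_congruence : Congruence (meshRel k τ) where
  equivalence :=
    { refl := fun f => by simp [meshRel]
      symm := fun {f g} h => by
        have := (meshIdeal k τ _ _).neg_mem h
        simpa [meshRel] using this
      trans := fun {f g h} h₁ h₂ => by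
        have := (meshIdeal k τ _ _).add_mem h₁ h₂
        simpa [meshRel] using this }
  comp_left := fun f _ _ h => by
    have := meshIdeal_comp_left k τ f h
    simpa [meshRel, Preadditive.comp_sub] using this
  comp_right := fun g h => by
    have := meshIdeal_comp_right k τ g h
    simpa [meshRel, Preadditive.sub_comp] using this

/-- The mesh category: the path category modulo the mesh ideal. -/
abbrev MeshCategory := CategoryTheory.Quotient (meshRel k τ)

theorem meshRel_add ⦃X Y : PathCategory k V⦄ (f₁ f₂ g₁ g₂ : X ⟶ Y)
    (hf : meshRel k τ f₁ f₂) (hg : meshRel k τ g₁ g₂) :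
    meshRel k τ (f₁ + g₁) (f₂ + g₂) := by
  have := (meshIdeal k τ _ _).add_mem hf hg
  rwa [← add_sub_add_comm] at this

theorem meshRel_smul (a : k) ⦃X Y : PathCategory k V⦄ (f₁ f₂ : X ⟶ Y)
    (hf : meshRel k τ f₁ f₂) : meshRel k τ (a • f₁) (a • f₂) := by
  have := (meshIdeal k τ _ _).smul_mem a hf
  rwa [smul_sub] at this

instance meshPreadditive : Preadditive (MeshCategory k τ) :=
  CategoryTheory.Quotient.preadditive (meshRel k τ) (meshRel_add k τ)

instance meshFunctor_additive : (CategoryTheory.Quotient.functor (meshRel k τ)).Additive :=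
  CategoryTheory.Quotient.functor_additive (meshRel k τ) (meshRel_add k τ)

instance meshLinear : Linear k (MeshCategory k τ) :=
  CategoryTheory.Quotient.linear k (meshRel k τ) (meshRel_smul k τ)

instance meshFunctor_linear : (CategoryTheory.Quotient.functor (meshRel k τ)).Linear k :=
  CategoryTheory.Quotient.linear_functor k (meshRel k τ) (meshRel_smul k τ)

/-- The vertex `x`, as an object of the mesh category. -/
def meshObj (x : V) : MeshCategory k τ :=
  (CategoryTheory.Quotient.functor (meshRel k τ)).obj (pathObj k x)

/-- The morphism of the mesh category given by an arrow. -/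
def meshArrow {x y : V} (α : x ⟶ y) : meshObj k τ x ⟶ meshObj k τ y :=
  (CategoryTheory.Quotient.functor (meshRel k τ)).map (pathArrow k α)

variable {D : Type w'} [Category.{v'} D] [Preadditive D] [Linear k D]

theorem pathLift_meshRelator (φ : V ⥤q D) (z x : V) :
    (pathLift k φ).map (meshRelator k z x) =
      ∑ y : V, ∑ β : z ⟶ y, ∑ α : y ⟶ x, φ.map β ≫ φ.map α := by
  simp only [meshRelator, Functor.map_sum, Functor.map_comp, pathLift_pathArrow]
  rfl

/-- A family of values on arrows that satisfies the mesh relations gives a functor on the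
mesh category. -/
def meshLift (φ : V ⥤q D)
    (hφ : ∀ x z : V, τ x = some z →
      ∑ y : V, ∑ β : z ⟶ y, ∑ α : y ⟶ x, φ.map β ≫ φ.map α = 0) :
    MeshCategory k τ ⥤ D :=
  CategoryTheory.Quotient.lift (meshRel k τ) (pathLift k φ) (by
    intro X Y f g h
    have hle : meshIdeal k τ X Y ≤ LinearMap.ker ((pathLift k φ).mapLinearMap k) := by
      refine Submodule.span_le.2 ?_
      rintro _ ⟨x, z, hx, p, q, rfl⟩
      have h0 : (pathLift k φ).map (meshRelator k z x) = 0 :=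
        (pathLift_meshRelator k φ z x).trans (hφ x z hx)
      simp only [SetLike.mem_coe, LinearMap.mem_ker, Functor.coe_mapLinearMap, Functor.map_comp,
        h0, zero_comp, comp_zero]
    have := hle h
    rw [LinearMap.mem_ker, map_sub, sub_eq_zero] at this
    exact this)

theorem meshLift_map_functor (φ : V ⥤q D) (hφ) {X Y : PathCategory k V} (f : X ⟶ Y) :
    (meshLift k τ φ hφ).map ((CategoryTheory.Quotient.functor (meshRel k τ)).map f) =
      (pathLift k φ).map f := rfl

theorem meshLift_meshArrow (φ : V ⥤q D) (hφ) {x y : V} (α : x ⟶ y) :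
    (meshLift k τ φ hφ).map (meshArrow k τ α) = φ.map α :=
  pathLift_pathArrow k φ α

instance meshLift_additive (φ : V ⥤q D) (hφ) : (meshLift k τ φ hφ).Additive where
  map_add := by
    rintro ⟨X⟩ ⟨Y⟩ f g
    obtain ⟨f, rfl⟩ := (CategoryTheory.Quotient.functor (meshRel k τ)).map_surjective f
    obtain ⟨g, rfl⟩ := (CategoryTheory.Quotient.functor (meshRel k τ)).map_surjective g
    rw [← Functor.map_add, meshLift_map_functor, meshLift_map_functor, meshLift_map_functor,
      Functor.map_add]
    rfl

instance meshLift_linear (φ : V ⥤q D) (hφ) : (meshLift k τ φ hφ).Linear k where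
  map_smul := by
    rintro ⟨X⟩ ⟨Y⟩ f a
    obtain ⟨f, rfl⟩ := (CategoryTheory.Quotient.functor (meshRel k τ)).map_surjective f
    rw [← Functor.map_smul, meshLift_map_functor, meshLift_map_functor, Functor.map_smul]
    rfl

end Mesh

end TransQuiver

/-! ## The additive closure of a functor -/

/-- The extension of an additive functor `F : C ⥤ D` to the additive closure `Mat_ C` of `C`
(the category of formal finite direct sums of objects of `C`, with matrices as morphisms). -/
def additiveExtension {C : Type w} [Category.{v} C] [Preadditive C] {D : Type w'}
    [Category.{v'} D] [Preadditive D] [HasFiniteBiproducts D] (F : C ⥤ D) [F.Additive] :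
    Mat_ C ⥤ D where
  obj X := ⨁ fun i => F.obj (X.X i)
  map f := biproduct.matrix fun i j => F.map (f i j)
  map_id X := by
    ext i j
    by_cases h : j = i
    · subst h; simp
    · simp [Mat_.id_apply, h]
  map_comp f g := by
    ext i j
    simp [biproduct.lift_desc]

/-- A preadditive category is abelian. -/
def IsAbelianCategory (C : Type w) [Category.{v} C] [P : Preadditive C] : Prop :=
  ∃ A : Abelian C, A.toPreadditive = P

/-! ## Quivers of type `A_{n+2}` and the polygon -/

/-- A quiver of type `A_{n+2}` with vertices labelled `1, …, n+2` in linear order, given by the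
orientation of its `n+1` edges: if `right a` is true, then the `a`-th edge (counting from `0`) is
the arrow `a+1 → a+2`, otherwise it is the arrow `a+1 ← a+2`. -/
structure TypeA (n : ℕ) where
  right : Fin (n + 1) → Bool

namespace TypeA

variable {n : ℕ} (Q : TypeA n)

/-- The vertices of the quiver. -/
def Vertex (_ : TypeA n) : Type := Fin (n + 2)

/-- The label of a vertex, a number from `1` to `n+2`. -/
def label {Q : TypeA n} (l : Q.Vertex) : ℕ := Fin.val l + 1

/-- There is an arrow from `s` to `t`. -/
def IsArrow (s t : Q.Vertex) : Prop :=
  (∃ a : Fin (n + 1), Q.right a = true ∧ label s = a + 1 ∧ label t = a + 2) ∨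
  (∃ a : Fin (n + 1), Q.right a = false ∧ label s = a + 2 ∧ label t = a + 1)

instance : Quiver.{0} Q.Vertex where
  Hom s t := PLift (Q.IsArrow s t)

/-- The vertex `l` of the polygon is upper-barred: `l → l+1` is an arrow of `Q`. -/
def IsUpper (l : Fin (n + 3)) : Prop := ∃ a : Fin (n + 1), Q.right a = true ∧ (l : ℕ) = a + 1

/-- The vertex `l` of the polygon is lower-barred: `l ← l+1` is an arrow of `Q`. -/
def IsLower (l : Fin (n + 3)) : Prop := ∃ a : Fin (n + 1), Q.right a = false ∧ (l : ℕ) = a + 1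

/-- The vertices `0`, `n+2` and the upper-barred ones: the vertices on the upper part of
the boundary of the polygon, which runs through them from left to right in numerical order. -/
def OnUpper (l : Fin (n + 3)) : Prop := l = 0 ∨ l = Fin.last (n + 2) ∨ Q.IsUpper l

/-- The vertices on the lower part of the boundary of the polygon. -/
def OnLower (l : Fin (n + 3)) : Prop := l = 0 ∨ l = Fin.last (n + 2) ∨ Q.IsLower l

/-- `m` is the clockwise neighbour of `l` on the boundary of the polygon: either `m` comes
right after `l` on the upper part of the boundary (which is run through from left to right), or `m`
comes right before `l` on the lower part (which is run through from right to left). -/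
def ClockwiseNext (l m : Fin (n + 3)) : Prop :=
  (Q.OnUpper l ∧ Q.OnUpper m ∧ l < m ∧ ∀ r, Q.OnUpper r → ¬ (l < r ∧ r < m)) ∨
  (Q.OnLower l ∧ Q.OnLower m ∧ m < l ∧ ∀ r, Q.OnLower r → ¬ (m < r ∧ r < l))

theorem onUpper_or_onLower (l : Fin (n + 3)) : Q.OnUpper l ∨ Q.OnLower l := by
  by_cases h0 : l = 0
  · exact Or.inl (Or.inl h0)
  by_cases h1 : l = Fin.last (n + 2)
  · exact Or.inl (Or.inr (Or.inl h1))
  have h2 : (l : ℕ) ≠ 0 := fun h => h0 (Fin.ext h)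
  have h3 : (l : ℕ) ≠ n + 2 := fun h => h1 (Fin.ext h)
  have h4 := l.isLt
  rcases hb : Q.right ⟨l - 1, by omega⟩ with _ | _
  · exact Or.inr (Or.inr (Or.inr ⟨_, hb, by simp; omega⟩))
  · exact Or.inl (Or.inr (Or.inr ⟨_, hb, by simp; omega⟩))

theorem not_isUpper_and_isLower {l : Fin (n + 3)} (h : Q.IsUpper l) (h' : Q.IsLower l) :
    False := by
  obtain ⟨a, ha, hl⟩ := h
  obtain ⟨b, hb, hl'⟩ := h'
  have : a = b := Fin.ext (by omega)
  rw [this, hb] at ha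
  exact Bool.false_ne_true ha

theorem not_isUpper_zero : ¬ Q.IsUpper 0 := fun ⟨a, _, h⟩ => by simp at h
theorem not_isLower_zero : ¬ Q.IsLower 0 := fun ⟨a, _, h⟩ => by simp at h
theorem not_isUpper_last : ¬ Q.IsUpper (Fin.last (n + 2)) := fun ⟨a, _, h⟩ => by
  have := a.isLt; simp at h; omega
theorem not_isLower_last : ¬ Q.IsLower (Fin.last (n + 2)) := fun ⟨a, _, h⟩ => by
  have := a.isLt; simp at h; omega

theorem onUpper_and_onLower {l : Fin (n + 3)} (h : Q.OnUpper l) (h' : Q.OnLower l) :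
    l = 0 ∨ l = Fin.last (n + 2) := by
  rcases h with h | h | h
  · exact Or.inl h
  · exact Or.inr h
  · rcases h' with h' | h' | h'
    · exact Or.inl h'
    · exact Or.inr h'
    · exact (Q.not_isUpper_and_isLower h h').elim

theorem exists_next (S : Fin (n + 3) → Prop) (l t : Fin (n + 3)) (ht : S t) (hlt : l < t) :
    ∃ m, S m ∧ l < m ∧ ∀ r, S r → ¬ (l < r ∧ r < m) := by
  classical
  have hne : (Finset.univ.filter fun m => S m ∧ l < m).Nonempty := ⟨t, by simp [ht, hlt]⟩
  refine ⟨_, (by simpa using Finset.min'_mem _ hne :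
    S (Finset.min' _ hne) ∧ l < Finset.min' _ hne).1, (by simpa using Finset.min'_mem _ hne :
    S (Finset.min' _ hne) ∧ l < Finset.min' _ hne).2, fun r hr h => ?_⟩
  exact absurd h.2 (not_lt.2 (Finset.min'_le _ _ (by simp [hr, h.1])))

theorem exists_prev (S : Fin (n + 3) → Prop) (l t : Fin (n + 3)) (ht : S t) (hlt : t < l) :
    ∃ m, S m ∧ m < l ∧ ∀ r, S r → ¬ (m < r ∧ r < l) := by
  classical
  have hne : (Finset.univ.filter fun m => S m ∧ m < l).Nonempty := ⟨t, by simp [ht, hlt]⟩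
  refine ⟨_, (by simpa using Finset.max'_mem _ hne :
    S (Finset.max' _ hne) ∧ Finset.max' _ hne < l).1, (by simpa using Finset.max'_mem _ hne :
    S (Finset.max' _ hne) ∧ Finset.max' _ hne < l).2, fun r hr h => ?_⟩
  exact absurd h.1 (not_lt.2 (Finset.le_max' _ _ (by simp [hr, h.2])))

theorem exists_clockwiseNext (l : Fin (n + 3)) : ∃ m, Q.ClockwiseNext l m := by
  by_cases h : Q.OnUpper l ∧ l ≠ Fin.last (n + 2)
  · obtain ⟨m, h1, h2, h3⟩ := exists_next Q.OnUpper l (Fin.last (n + 2)) (Or.inr (Or.inl rfl))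
      (lt_of_le_of_ne (Fin.le_last l) h.2)
    exact ⟨m, Or.inl ⟨h.1, h1, h2, h3⟩⟩
  · have hl : Q.OnLower l := by
      rcases Q.onUpper_or_onLower l with h' | h'
      · exact Or.inr (Or.inl (by by_contra hne; exact h ⟨h', hne⟩))
      · exact h'
    have h0 : l ≠ 0 := by
      rintro rfl
      refine h ⟨Or.inl rfl, fun e => ?_⟩
      simpa using congrArg Fin.val e
    obtain ⟨m, h1, h2, h3⟩ := exists_prev Q.OnLower l 0 (Or.inl rfl)
      (lt_of_le_of_ne (Fin.zero_le l) h0.symm)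
    exact ⟨m, Or.inr ⟨hl, h1, h2, h3⟩⟩

theorem clockwiseNext_left_unique {l l' m : Fin (n + 3)} (h : Q.ClockwiseNext l m)
    (h' : Q.ClockwiseNext l' m) : l = l' := by
  rcases h with ⟨a1, a2, a3, a4⟩ | ⟨a1, a2, a3, a4⟩ <;>
    rcases h' with ⟨b1, b2, b3, b4⟩ | ⟨b1, b2, b3, b4⟩
  · rcases lt_trichotomy l l' with h | h | h
    · exact (a4 l' b1 ⟨h, b3⟩).elim
    · exact h
    · exact (b4 l a1 ⟨h, a3⟩).elim
  · rcases Q.onUpper_and_onLower a2 b2 with rfl | rfl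
    · exact absurd a3 (Fin.not_lt_zero l)
    · exact absurd b3 (not_lt.2 (Fin.le_last l'))
  · rcases Q.onUpper_and_onLower b2 a2 with rfl | rfl
    · exact absurd b3 (Fin.not_lt_zero l')
    · exact absurd a3 (not_lt.2 (Fin.le_last l))
  · rcases lt_trichotomy l l' with h | h | h
    · exact (b4 l a1 ⟨a3, h⟩).elim
    · exact h
    · exact (a4 l' b1 ⟨b3, h⟩).elim

/-- The rotation `R` of the vertices of the polygon, which sends each vertex to its clockwise
neighbour on the boundary; `(Q.R).symm` sends it to its counterclockwise neighbour. -/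
def R : Equiv.Perm (Fin (n + 3)) :=
  Equiv.ofBijective (fun l => (Q.exists_clockwiseNext l).choose)
    (Finite.injective_iff_bijective.1 fun l l' h => Q.clockwiseNext_left_unique
      (Q.exists_clockwiseNext l).choose_spec
      (by
        have := (Q.exists_clockwiseNext l').choose_spec
        exact h ▸ this))

theorem clockwiseNext_R (l : Fin (n + 3)) : Q.ClockwiseNext l (Q.R l) :=
  (Q.exists_clockwiseNext l).choose_spec

theorem clockwiseNext_R_symm (l : Fin (n + 3)) : Q.ClockwiseNext (Q.R.symm l) l := by
  have := Q.clockwiseNext_R (Q.R.symm l)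
  rwa [Equiv.apply_symm_apply] at this

theorem clockwiseNext_ne {l m : Fin (n + 3)} (h : Q.ClockwiseNext l m) : l ≠ m := by
  rcases h with h | h
  · exact ne_of_lt h.2.2.1
  · exact (ne_of_lt h.2.2.1).symm

theorem R_ne (l : Fin (n + 3)) : Q.R l ≠ l := (Q.clockwiseNext_ne (Q.clockwiseNext_R l)).symm

/-! ### Line segments, pivots and the rotation -/

/-- The line segments `γ(i, j)`, `0 ≤ i < j ≤ n+2`, of the polygon (boundary edges included). -/
def Segment (_ : TypeA n) : Type := {p : Fin (n + 3) × Fin (n + 3) // p.1 < p.2}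

instance : Fintype Q.Segment := inferInstanceAs (Fintype {p : Fin (n + 3) × Fin (n + 3) // p.1 < p.2})

instance : DecidableEq Q.Segment :=
  inferInstanceAs (DecidableEq {p : Fin (n + 3) × Fin (n + 3) // p.1 < p.2})

variable {Q} in
/-- The left end point `i` of `γ(i, j)`. -/
def Segment.i (γ : Q.Segment) : Fin (n + 3) := γ.1.1

variable {Q} in
/-- The right end point `j` of `γ(i, j)`. -/
def Segment.j (γ : Q.Segment) : Fin (n + 3) := γ.1.2

variable {Q} in
theorem Segment.i_lt_j (γ : Q.Segment) : γ.i < γ.j := γ.2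

variable {Q} in
theorem Segment.ext {γ δ : Q.Segment} (hi : γ.i = δ.i) (hj : γ.j = δ.j) : γ = δ :=
  Subtype.ext (Prod.ext hi hj)

/-- `δ` is a pivot of `γ`: one end point moves to its counterclockwise neighbour and the other one is
fixed. -/
def IsPivot (γ δ : Q.Segment) : Prop :=
  (δ.i = Q.R.symm γ.i ∧ δ.j = γ.j) ∨ (δ.i = γ.i ∧ δ.j = Q.R.symm γ.j)

/-- The quiver of line segments, with one arrow for each pivot. -/
instance : Quiver.{0} Q.Segment where
  Hom γ δ := PLift (Q.IsPivot γ δ)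

open Classical in
instance (γ δ : Q.Segment) : Fintype (γ ⟶ δ) := inferInstanceAs (Fintype (PLift (Q.IsPivot γ δ)))

/-- The translation of the quiver of line segments: `γ(i, j) ↦ γ(R i, R j)` if `R i < R j`,
and undefined otherwise. -/
def rotation (γ : Q.Segment) : Option Q.Segment :=
  if h : Q.R γ.i < Q.R γ.j then some ⟨(Q.R γ.i, Q.R γ.j), h⟩ else none

theorem rotation_eq_some {γ δ : Q.Segment} (h : Q.rotation γ = some δ) :
    δ.i = Q.R γ.i ∧ δ.j = Q.R γ.j := by
  unfold rotation at h
  split_ifs at h with h'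
  cases h
  exact ⟨rfl, rfl⟩

end TypeA

/-! ## Representations -/

/-- A natural transformation between functors on a path category, given by its components. -/
def pathNatTrans {V : Type w} [Quiver.{v} V] {C : Type w'} [Category.{v'} C] (φ ψ : V ⥤q C)
    (η : ∀ x, φ.obj x ⟶ ψ.obj x)
    (h : ∀ (x y : V) (α : x ⟶ y), φ.map α ≫ η y = η x ≫ ψ.map α) :
    Paths.lift φ ⟶ Paths.lift ψ where
  app x := η x
  naturality := by
    suffices key : ∀ (X Y : V) (p : Quiver.Path X Y),
        (Paths.lift φ).map p ≫ η Y = η X ≫ (Paths.lift ψ).map p from fun X Y p => key X Y p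
    intro X Y p
    induction p with
    | nil => exact (Category.id_comp _).trans (Category.comp_id _).symm
    | cons p α ih =>
      refine (Category.assoc _ _ _).trans ?_
      refine (congrArg (fun t => (Paths.lift φ).map p ≫ t) (h _ _ α)).trans ?_
      refine (Category.assoc _ _ _).symm.trans ?_
      exact (congrArg (fun t => t ≫ ψ.map α) ih).trans (Category.assoc _ _ _)

namespace TypeA

variable {n : ℕ} (Q : TypeA n) (k : Type u) [Field k]

/-- The category `rep Q` of finite dimensional representations of `Q` over `k`: functors from the
path category of `Q` to finite dimensional vector spaces. -/
abbrev Rep := Paths Q.Vertex ⥤ FGModuleCat.{u} k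

/-- The category `ind Q` of indecomposable finite dimensional representations: the full
subcategory of `rep Q` on the indecomposable objects. -/
abbrev Ind := ObjectProperty.FullSubcategory (fun M : Q.Rep k => Indecomposable M)

open Classical in
/-- The vector space `k` if `p` holds and `0` otherwise. -/
def line (p : Prop) : Submodule k k := if p then ⊤ else ⊥

open Classical in
/-- The identity of `k` if `p` and `q` hold, and `0` otherwise. -/
def lineMap (p q : Prop) : line k p →ₗ[k] line k q :=
  if h : q then (line k p).subtype.codRestrict (line k q) (fun _ => by simp [line, h]) else 0

theorem line_eq_zero {p : Prop} (hp : ¬ p) (x : line k p) : x = 0 := by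
  obtain ⟨x, hx⟩ := x
  simp only [line, if_neg hp, Submodule.mem_bot] at hx
  exact Subtype.ext hx

theorem lineMap_of {p q : Prop} (hq : q) (x : line k p) : (lineMap k p q x : k) = x := by
  simp only [lineMap, dif_pos hq]
  rfl

variable {Q} in
/-- The vertex `l` lies between the vertices `a` and `b`. -/
def Between (a b : ℕ) (l : Q.Vertex) : Prop := a ≤ label l ∧ label l ≤ b

/-- The values of `M(a, b)` at the vertices and the arrows. -/
def intervalPrefunctor (a b : ℕ) : Q.Vertex ⥤q FGModuleCat.{u} k where
  obj l := FGModuleCat.of k (line k (Between a b l))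
  map {s t} _ := FGModuleCat.ofHom (lineMap k (Between a b s) (Between a b t))

/-- The representation `M(a, b)` that is supported on the vertices between `a` and `b`. -/
def intervalRep (a b : ℕ) : Q.Rep k := Paths.lift (Q.intervalPrefunctor k a b)

/-- The condition for the identity of `k` on the common support to be a
morphism `M(a, b) ⟶ M(c, d)`. -/
def Compatible (a b c d : ℕ) : Prop :=
  ∀ s t : Q.Vertex, Q.IsArrow s t → Between a b s → Between c d t →
    (Between a b t ↔ Between c d s)

theorem lineMap_comp {p q r : Prop} (x : line k p) (h : r → p → q) :
    lineMap k q r (lineMap k p q x) = lineMap k p r x := by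
  apply Subtype.ext
  by_cases hr : r
  · by_cases hp : p
    · rw [lineMap_of k hr, lineMap_of k hr, lineMap_of k (h hr hp)]
    · rw [line_eq_zero k hp x]; simp
  · rw [line_eq_zero k hr (lineMap k q r _), line_eq_zero k hr (lineMap k p r _)]

theorem lineMap_comp_eq_zero {p q r : Prop} (x : line k p) (h : p → q → r → False) :
    lineMap k q r (lineMap k p q x) = 0 := by
  by_cases hp : p
  · by_cases hq : q
    · exact line_eq_zero k (h hp hq) _
    · rw [line_eq_zero k hq (lineMap k p q x), map_zero]
  · rw [line_eq_zero k hp x, map_zero, map_zero]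

/-- The canonical morphism `M(a, b) ⟶ M(c, d)`, which is the identity of `k` at each vertex of the
common support, and `0` at the other vertices. If `[a, b]` is contained in `[c, d]` it is the
inclusion of a subrepresentation; if `[c, d]` is contained in `[a, b]` it is the
projection onto a quotient. -/
def canonicalMap {a b c d : ℕ} (h : Q.Compatible a b c d) :
    Q.intervalRep k a b ⟶ Q.intervalRep k c d :=
  pathNatTrans (Q.intervalPrefunctor k a b) (Q.intervalPrefunctor k c d)
    (fun l => FGModuleCat.ofHom (lineMap k (Between a b l) (Between c d l)))
    (fun s t α => by
      have hc := h s t α.down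
      apply FGModuleCat.hom_ext
      apply LinearMap.ext
      intro x
      change lineMap k (Between a b t) (Between c d t) (lineMap k (Between a b s) (Between a b t) x)
        = lineMap k (Between c d s) (Between c d t) (lineMap k (Between a b s) (Between c d s) x)
      by_cases h1 : Between a b s
      · by_cases h2 : Between c d t
        · by_cases h3 : Between a b t
          · rw [lineMap_comp k x (fun _ _ => h3), lineMap_comp k x (fun _ _ => (hc h1 h2).1 h3)]
          · rw [lineMap_comp_eq_zero k x (fun _ h _ => h3 h),
              lineMap_comp_eq_zero k x (fun _ h _ => h3 ((hc h1 h2).2 h))]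
        · rw [lineMap_comp_eq_zero k x (fun _ _ h => h2 h),
              lineMap_comp_eq_zero k x (fun _ _ h => h2 h)]
      · rw [lineMap_comp_eq_zero k x (fun h _ _ => h1 h),
              lineMap_comp_eq_zero k x (fun h _ _ => h1 h)])

theorem canonicalMap_comp_apply {a b c d e f : ℕ} (h : Q.Compatible a b c d)
    (h' : Q.Compatible c d e f) (l : Q.Vertex) (x : line k (Between a b l)) :
    ((Q.canonicalMap k h ≫ Q.canonicalMap k h').app l).hom.hom x =
      lineMap k (Between c d l) (Between e f l) (lineMap k (Between a b l) (Between c d l) x) :=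
  rfl

/-- Two morphisms that agree at each vertex are equal. -/
theorem rep_hom_ext {M N : Q.Rep k} {f g : M ⟶ N}
    (h : ∀ (l : Q.Vertex) (x : M.obj l), (f.app l).hom.hom x = (g.app l).hom.hom x) : f = g := by
  apply NatTrans.ext
  funext l
  apply FGModuleCat.hom_ext
  exact LinearMap.ext (h l)

end TypeA

namespace TypeA

variable {n : ℕ} (Q : TypeA n) (k : Type u) [Field k]

/-- A pivot adds a hook to `M(i+1, j)` or removes a cohook from it, so that the
canonical map is a morphism. -/
theorem IsPivot.compatible {Q : TypeA n} {γ δ : Q.Segment} (h : Q.IsPivot γ δ) :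
    Q.Compatible (γ.i + 1) γ.j (δ.i + 1) δ.j := by
  have hγ := γ.i_lt_j
  have hδ := δ.i_lt_j
  have key : ∀ l : Fin (n + 3), 0 < (l : ℕ) → (l : ℕ) < n + 2 → ∀ s t : Q.Vertex, Q.IsArrow s t →
      (Q.OnUpper l → ¬ (label s = l + 1 ∧ label t = l)) ∧
      (Q.OnLower l → ¬ (label s = l ∧ label t = l + 1)) := by
    intro l h0 h1 s t hst
    have hn0 : l ≠ 0 := fun e => by simp [e] at h0
    have hn1 : l ≠ Fin.last (n + 2) := fun e => by simp [e] at h1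
    refine ⟨fun hl hs => ?_, fun hl hs => ?_⟩
    · rcases hl with hl | hl | ⟨a, ha, hl⟩
      · exact hn0 hl
      · exact hn1 hl
      · rcases hst with ⟨b, hb, hb1, hb2⟩ | ⟨b, hb, hb1, hb2⟩
        · omega
        · have : a = b := Fin.ext (by omega)
          rw [this, hb] at ha; exact Bool.false_ne_true ha
    · rcases hl with hl | hl | ⟨a, ha, hl⟩
      · exact hn0 hl
      · exact hn1 hl
      · rcases hst with ⟨b, hb, hb1, hb2⟩ | ⟨b, hb, hb1, hb2⟩
        · have : a = b := Fin.ext (by omega)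
          rw [this, hb] at ha; exact Bool.false_ne_true ha.symm
        · omega
  have adj : ∀ s t : Q.Vertex, Q.IsArrow s t → label t = label s + 1 ∨ label s = label t + 1 := by
    rintro s t (⟨a, _, h1, h2⟩ | ⟨a, _, h1, h2⟩)
    · left; omega
    · right; omega
  intro s t hst h1 h2
  have ha := adj s t hst
  have b1 := γ.j.isLt
  have b2 := δ.j.isLt
  unfold Between at *
  rw [Fin.lt_def] at hγ hδ
  rcases h with ⟨hi, hj⟩ | ⟨hi, hj⟩
  · have hc := Q.clockwiseNext_R_symm γ.i
    rw [← hi] at hc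
    rw [hj] at h2 ⊢
    rw [hj] at hδ
    rcases hc with ⟨_, hu, hlt, _⟩ | ⟨hl, _, hlt, _⟩
    · rw [Fin.lt_def] at hlt
      have := (key γ.i (by omega) (by omega) s t hst).1 hu
      omega
    · rw [Fin.lt_def] at hlt
      have := (key δ.i (by omega) (by omega) s t hst).2 hl
      omega
  · have hc := Q.clockwiseNext_R_symm γ.j
    rw [← hj] at hc
    rw [hi] at h2 ⊢
    rw [hi] at hδ
    rcases hc with ⟨hu, _, hlt, _⟩ | ⟨_, hl, hlt, _⟩
    · rw [Fin.lt_def] at hlt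
      have := (key δ.j (by omega) (by omega) s t hst).1 hu
      omega
    · rw [Fin.lt_def] at hlt
      have := (key γ.j (by omega) (by omega) s t hst).2 hl
      omega

/-- Every endomorphism of `M(a, b)` is a scalar. -/
theorem intervalRep_end {a b : ℕ} (ha : 1 ≤ a) (hab : a ≤ b) (hb : b ≤ n + 2)
    (f : Q.intervalRep k a b ⟶ Q.intervalRep k a b) : ∃ c : k, f = c • 𝟙 _ := by
  let vtx : ∀ m : ℕ, m < n + 2 → Q.Vertex := fun m hm => (⟨m, hm⟩ : Fin (n + 2))
  let F : ∀ l : Q.Vertex, line k (Between a b l) →ₗ[k] line k (Between a b l) :=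
    fun l => (f.app l).hom.hom
  have mem : ∀ l : Q.Vertex, Between a b l → (1 : k) ∈ line k (Between a b l) := by
    intro l hl; simp [line, hl]
  have nat : ∀ (s t : Q.Vertex), Q.IsArrow s t → ∀ x, F t (lineMap k _ _ x) =
      lineMap k (Between a b s) (Between a b t) (F s x) := by
    intro s t hst x
    have h := f.naturality ((Paths.of Q.Vertex).map (PLift.up hst : s ⟶ t))
    have h1 : (Q.intervalRep k a b).map ((Paths.of Q.Vertex).map (PLift.up hst : s ⟶ t)) =
      FGModuleCat.ofHom (lineMap k (Between a b s) (Between a b t)) := Paths.lift_toPath _ _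
    rw [h1] at h
    exact congrArg (fun g => g.hom.hom x) h
  have scal : ∀ l (hl : Between a b l) (x : line k (Between a b l)),
      F l x = (F l ⟨1, mem l hl⟩ : k) • x := by
    intro l hl x
    have hx : x = (x : k) • (⟨1, mem l hl⟩ : line k (Between a b l)) := Subtype.ext (by simp)
    conv_lhs => rw [hx]
    rw [map_smul]
    exact Subtype.ext (by simp [mul_comm])
  have step : ∀ s t, Q.IsArrow s t → ∀ (hs : Between a b s) (ht : Between a b t),
      (F s ⟨1, mem s hs⟩ : k) = F t ⟨1, mem t ht⟩ := by
    intro s t hst hs ht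
    have h := congrArg Subtype.val (nat s t hst ⟨1, mem s hs⟩)
    rw [lineMap_of k ht] at h
    rw [← h]
    congr 2
    exact Subtype.ext (lineMap_of k ht _)
  have h0 : Between a b (vtx (a - 1) (by omega)) := by
    constructor <;> simp [vtx, label] <;> omega
  have same : ∀ l l' (_ : l = l') (hl : Between a b l) (hl' : Between a b l'),
      (F l ⟨1, mem l hl⟩ : k) = F l' ⟨1, mem l' hl'⟩ := by
    rintro l _ rfl _ _; rfl
  have all : ∀ m (hm : m < n + 2) (hl : Between a b (vtx m hm)),
      (F (vtx m hm) ⟨1, mem _ hl⟩ : k) = F _ ⟨1, mem _ h0⟩ := by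
    intro m
    induction m with
    | zero =>
      intro hm hl
      have : a - 1 = 0 := by
        have := hl.1; simp [vtx, label] at this; omega
      exact same _ _ (Fin.ext this.symm) hl h0
    | succ m ih =>
      intro hm hl
      by_cases e : a - 1 = m + 1
      · exact same _ _ (Fin.ext e.symm) hl h0
      · have hl1 := hl.1
        have hl2 := hl.2
        simp only [vtx, label] at hl1 hl2
        have hl' : Between a b (vtx m (by omega)) := by
          constructor <;> simp only [vtx, label] <;> omega
        rw [← ih (by omega) hl']
        rcases hr : Q.right ⟨m, by omega⟩ with _ | _
        · exact step _ _ (Or.inr ⟨_, hr, rfl, rfl⟩) hl hl'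
        · exact (step _ _ (Or.inl ⟨_, hr, rfl, rfl⟩) hl' hl).symm
  refine ⟨(F _ ⟨1, mem _ h0⟩ : k), Q.rep_hom_ext k fun l x => ?_⟩
  change F l x = (F _ ⟨1, mem _ h0⟩ : k) • x
  by_cases hl : Between a b l
  · exact (scal l hl x).trans (congrArg (fun t : k => t • x) (all (Fin.val l) (Fin.isLt l) hl))
  · exact (line_eq_zero k hl _).trans (line_eq_zero k hl _).symm

/-- The representations `M(a, b)` are indecomposable. -/
theorem intervalRep_indecomposable {a b : ℕ} (ha : 1 ≤ a) (hab : a ≤ b) (hb : b ≤ n + 2) :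
    Indecomposable (Q.intervalRep k a b) := by
  have hne : ¬ IsZero (Q.intervalRep k a b) := by
    intro hz
    let l : Q.Vertex := (⟨a - 1, by omega⟩ : Fin (n + 2))
    have hl : Between a b l := by constructor <;> simp [l, label] <;> omega
    have h := hz.eq_of_src (𝟙 (Q.intervalRep k a b)) 0
    have h1 : (⟨1, by simp [line, hl]⟩ : line k (Between a b l)) = 0 :=
      congrArg (fun g => (NatTrans.app g l).hom.hom (⟨1, by simp [line, hl]⟩ :
        line k (Between a b l))) h
    exact one_ne_zero (congrArg Subtype.val h1)
  refine ⟨hne, fun Y Z e => ?_⟩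
  obtain ⟨c, hc⟩ := Q.intervalRep_end k ha hab hb (e.hom ≫ biprod.fst ≫ biprod.inl ≫ e.inv)
  have hp : (biprod.fst ≫ biprod.inl : Y ⊞ Z ⟶ Y ⊞ Z) = c • 𝟙 _ := by
    have := congrArg (fun g => e.inv ≫ g ≫ e.hom) hc
    simpa using this
  have h1 : (1 - c) • 𝟙 Y = 0 := by
    have := congrArg (fun g => biprod.inl ≫ g ≫ biprod.fst) hp
    simp at this
    rw [sub_smul, one_smul, sub_eq_zero]
    exact this
  have h2 : c • 𝟙 Z = 0 := by
    have := congrArg (fun g => biprod.inr ≫ g ≫ biprod.snd) hp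
    simpa using this.symm
  by_cases h : c = 0
  · left
    rw [h, sub_zero, one_smul] at h1
    exact (IsZero.iff_id_eq_zero Y).2 h1
  · right
    exact (IsZero.iff_id_eq_zero Z).2 ((smul_eq_zero.1 h2).resolve_left h)

/-- The representation `M(i+1, j)` that corresponds to the line segment `γ(i, j)`. -/
def segmentRep (γ : Q.Segment) : Q.Rep k := Q.intervalRep k (γ.i + 1) γ.j

theorem segmentRep_indecomposable (γ : Q.Segment) : Indecomposable (Q.segmentRep k γ) :=
  Q.intervalRep_indecomposable k (Nat.le_add_left _ _) γ.i_lt_j (Nat.lt_succ_iff.1 γ.j.isLt)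

/-- The morphism `M(i+1, j) ⟶ M(i'+1, j')` that corresponds to a pivot `γ(i, j) → γ(i', j')`,
up to a scalar: the inclusion if the pivot adds a hook, and the projection if it removes a cohook. -/
def pivotMap {γ δ : Q.Segment} (p : γ ⟶ δ) : Q.segmentRep k γ ⟶ Q.segmentRep k δ :=
  Q.canonicalMap k p.down.compatible

/-- The choice of a nonzero scalar for each pivot such that the mesh relations hold for the
scalar multiples of the inclusions and the projections. These commute in each mesh with two middle
terms, whereas the mesh relation is that the sum of the two compositions is zero. -/
structure PivotScalars where
  coeff : ∀ {γ δ : Q.Segment}, (γ ⟶ δ) → kˣ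
  mesh : ∀ {γ δ δ' ε : Q.Segment} (p : γ ⟶ δ) (q : δ ⟶ ε) (p' : γ ⟶ δ') (q' : δ' ⟶ ε),
    Q.rotation ε = some γ → δ ≠ δ' →
    (coeff p : k) * coeff q + (coeff p' : k) * coeff q' = 0

/-- The category of line segments of the polygon: the mesh category of
the translation quiver of line segments and pivots, with the rotation as translation. -/
abbrev SegmentCategory := TransQuiver.MeshCategory k Q.rotation

/-- The line segment `γ` as an object of the category of line segments. -/
abbrev seg (γ : Q.Segment) : Q.SegmentCategory k := TransQuiver.meshObj k Q.rotation γ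

/-- A pivot as a morphism of the category of line segments. -/
abbrev pivot {γ δ : Q.Segment} (p : γ ⟶ δ) : Q.seg k γ ⟶ Q.seg k δ :=
  TransQuiver.meshArrow k Q.rotation p

variable {Q k}

/-- The values of `F` at the line segments and the pivots. -/
def segmentPrefunctor (c : Q.PivotScalars k) : Q.Segment ⥤q Q.Ind k where
  obj γ := ⟨Q.segmentRep k γ, Q.segmentRep_indecomposable k γ⟩
  map p := ObjectProperty.homMk ((c.coeff p : k) • Q.pivotMap k p)

instance segmentHom_subsingleton (γ δ : Q.Segment) : Subsingleton (γ ⟶ δ) :=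
  inferInstanceAs (Subsingleton (PLift (Q.IsPivot γ δ)))

theorem segmentPrefunctor_comp (c : Q.PivotScalars k) {x y z : Q.Segment} (β : z ⟶ y) (α : y ⟶ x) :
    (segmentPrefunctor c).map β ≫ (segmentPrefunctor c).map α =
      ObjectProperty.homMk (((c.coeff β : k) * c.coeff α) • (Q.pivotMap k β ≫ Q.pivotMap k α)) := by
  apply ObjectProperty.hom_ext
  change ((c.coeff β : k) • Q.pivotMap k β) ≫ ((c.coeff α : k) • Q.pivotMap k α) = _
  rw [Linear.smul_comp, Linear.comp_smul, smul_smul]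
  rfl

theorem segmentPrefunctor_mesh (c : Q.PivotScalars k) (x z : Q.Segment)
    (h : Q.rotation x = some z) : ∑ y : Q.Segment, ∑ β : z ⟶ y, ∑ α : y ⟶ x,
      (segmentPrefunctor c).map β ≫ (segmentPrefunctor c).map α = 0 := by
  obtain ⟨hzi, hzj⟩ := Q.rotation_eq_some h
  have mid : ∀ y : Q.Segment, ∀ (_ : z ⟶ y) (_ : y ⟶ x),
      (y.i = x.i ∧ y.j = z.j) ∨ (y.i = z.i ∧ y.j = x.j) := by
    rintro y ⟨β⟩ ⟨α⟩
    rcases β with ⟨h1, h2⟩ | ⟨h1, h2⟩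
    · left; rw [h1, hzi, Equiv.symm_apply_apply]; exact ⟨rfl, h2⟩
    · right; rw [h2, hzj, Equiv.symm_apply_apply]; exact ⟨h1, rfl⟩
  by_cases hex : x.i < z.j ∧ z.i < x.j
  · let y₁ : Q.Segment := ⟨(x.i, z.j), hex.1⟩
    let y₂ : Q.Segment := ⟨(z.i, x.j), hex.2⟩
    have hi1 : y₁.i = x.i := rfl
    have hj1 : y₁.j = z.j := rfl
    have hi2 : y₂.i = z.i := rfl
    have hj2 : y₂.j = x.j := rfl
    have hne : y₁ ≠ y₂ := fun e => Q.R_ne x.i (by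
      rw [← hzi, ← hi2, ← e, hi1])
    let β₁ : z ⟶ y₁ := PLift.up (Or.inl ⟨by rw [hi1, hzi, Equiv.symm_apply_apply], hj1⟩)
    let α₁ : y₁ ⟶ x := PLift.up (Or.inr ⟨hi1.symm, by rw [hj1, hzj, Equiv.symm_apply_apply]⟩)
    let β₂ : z ⟶ y₂ := PLift.up (Or.inr ⟨hi2, by rw [hj2, hzj, Equiv.symm_apply_apply]⟩)
    let α₂ : y₂ ⟶ x := PLift.up (Or.inl ⟨by rw [hi2, hzi, Equiv.symm_apply_apply], hj2.symm⟩)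
    rw [Fintype.sum_eq_add y₁ y₂ hne]
    · rw [Fintype.sum_subsingleton _ β₁, Fintype.sum_subsingleton _ α₁,
        Fintype.sum_subsingleton _ β₂, Fintype.sum_subsingleton _ α₂,
        segmentPrefunctor_comp, segmentPrefunctor_comp]
      have hcomp : Q.pivotMap k β₁ ≫ Q.pivotMap k α₁ = Q.pivotMap k β₂ ≫ Q.pivotMap k α₂ := by
        refine Q.rep_hom_ext k fun l v => ?_
        refine (Q.canonicalMap_comp_apply k _ _ l v).trans
          (Eq.trans ?_ (Q.canonicalMap_comp_apply k _ _ l v).symm)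
        refine (lineMap_comp k _ ?_).trans (lineMap_comp k _ ?_).symm
        · rintro ⟨h1, h2⟩ ⟨h3, h4⟩
          exact ⟨by rw [hi1]; exact h1, by rw [hj1]; exact h4⟩
        · rintro ⟨h1, h2⟩ ⟨h3, h4⟩
          exact ⟨by rw [hi2]; exact h3, by rw [hj2]; exact h2⟩
      apply ObjectProperty.hom_ext
      change ((c.coeff β₁ : k) * c.coeff α₁) • (Q.pivotMap k β₁ ≫ Q.pivotMap k α₁) +
        ((c.coeff β₂ : k) * c.coeff α₂) • (Q.pivotMap k β₂ ≫ Q.pivotMap k α₂) = 0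
      rw [hcomp, ← add_smul, c.mesh β₁ α₁ β₂ α₂ h hne, zero_smul]
    · rintro y ⟨hy1, hy2⟩
      refine Finset.sum_eq_zero fun β _ => Finset.sum_eq_zero fun α _ => ?_
      rcases mid y β α with ⟨h1, h2⟩ | ⟨h1, h2⟩
      · exact (hy1 (Segment.ext h1 h2)).elim
      · exact (hy2 (Segment.ext h1 h2)).elim
  · refine Finset.sum_eq_zero fun y _ => Finset.sum_eq_zero fun β _ =>
      Finset.sum_eq_zero fun α _ => ?_
    have hcomp : Q.pivotMap k β ≫ Q.pivotMap k α = 0 := by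
      refine Q.rep_hom_ext k fun l v => ?_
      refine (Q.canonicalMap_comp_apply k _ _ l v).trans (lineMap_comp_eq_zero k _ ?_)
      rintro ⟨h1, h2⟩ - ⟨h3, h4⟩
      refine hex ⟨?_, ?_⟩ <;> rw [Fin.lt_def] <;> omega
    rw [segmentPrefunctor_comp, hcomp, smul_zero]
    rfl

/-- The functor `F` from the category of line segments to `ind Q` that sends `γ(i, j)` to
`M(i+1, j)` and each pivot to the corresponding morphism (with the scalars `c`). -/
def segmentFunctor (c : Q.PivotScalars k) : Q.SegmentCategory k ⥤ Q.Ind k :=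
  TransQuiver.meshLift k Q.rotation (segmentPrefunctor c) (segmentPrefunctor_mesh c)

instance (c : Q.PivotScalars k) : (segmentFunctor c).Additive := by
  unfold segmentFunctor; infer_instance

instance (c : Q.PivotScalars k) : (segmentFunctor c).Linear k := by
  unfold segmentFunctor; infer_instance

theorem segmentFunctor_obj (c : Q.PivotScalars k) (γ : Q.Segment) :
    ((segmentFunctor c).obj (Q.seg k γ)).obj = Q.segmentRep k γ := rfl

theorem segmentFunctor_map (c : Q.PivotScalars k) {γ δ : Q.Segment} (p : γ ⟶ δ) :
    ((segmentFunctor c).map (Q.pivot k p)).hom = (c.coeff p : k) • Q.pivotMap k p :=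
  congrArg InducedCategory.Hom.hom
    (TransQuiver.meshLift_meshArrow k Q.rotation (segmentPrefunctor c) _ p)

end TypeA

/-! ## Auslander–Reiten theory -/

namespace AuslanderReiten

section

variable {C : Type w} [Category.{v} C]

/-- Irreducible morphisms: neither sections nor retractions, and in each factorization
the first factor is a section or the second factor is a retraction. -/
structure IsIrreducible {X Y : C} (f : X ⟶ Y) : Prop where
  not_section : ¬ IsSplitMono f
  not_retraction : ¬ IsSplitEpi f
  factor : ∀ (Z : C) (g : X ⟶ Z) (h : Z ⟶ Y), g ≫ h = f → IsSplitMono g ∨ IsSplitEpi h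

variable [Preadditive C] (k : Type u) [Field k] [Linear k C]

/-- The radical `rad(X, Y)`. (The set on the right is a subspace, equal to its span.) -/
def radical (X Y : C) : Submodule k (X ⟶ Y) :=
  Submodule.span k {f | ∀ g : Y ⟶ X, IsIso (𝟙 X - f ≫ g)}

/-- The square of the radical. -/
def radicalSq (X Y : C) : Submodule k (X ⟶ Y) :=
  Submodule.span k {h | ∃ (Z : C) (f : X ⟶ Z) (g : Z ⟶ Y),
    f ∈ radical k X Z ∧ g ∈ radical k Z Y ∧ h = f ≫ g}

/-- The space `Irr(X, Y) = rad(X, Y) / rad²(X, Y)` of irreducible morphisms. -/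
abbrev Irr (X Y : C) := radical k X Y ⧸ (radicalSq k X Y).submoduleOf (radical k X Y)

end

section

variable {C : Type w} [Category.{v} C] [Abelian C]

/-- Almost split sequences (Auslander–Reiten sequences): short exact sequences with
indecomposable end terms whose first map is left almost split and whose second map is right
almost split. -/
structure IsAlmostSplit (S : ShortComplex C) : Prop where
  shortExact : S.ShortExact
  indecomposable_left : Indecomposable S.X₁
  indecomposable_right : Indecomposable S.X₃
  not_section : ¬ IsSplitMono S.f
  left : ∀ (U : C) (h : S.X₁ ⟶ U), ¬ IsSplitMono h → ∃ h' : S.X₂ ⟶ U, S.f ≫ h' = h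
  not_retraction : ¬ IsSplitEpi S.g
  right : ∀ (U : C) (h : U ⟶ S.X₃), ¬ IsSplitEpi h → ∃ h' : U ⟶ S.X₂, h' ≫ S.g = h

/-- `N` is isomorphic to the Auslander–Reiten translate `τ M`: there is an almost split sequence
`0 ⟶ N ⟶ E ⟶ M ⟶ 0`. -/
def IsTranslate (M N : C) : Prop :=
  ∃ S : ShortComplex C, IsAlmostSplit S ∧ Nonempty (S.X₃ ≅ M) ∧ Nonempty (S.X₁ ≅ N)

end

end AuslanderReiten

namespace TypeA

open AuslanderReiten

variable {n : ℕ} (Q : TypeA n) (k : Type u) [Field k]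

/-- The isomorphism classes of indecomposable representations. -/
def IndClass := _root_.Quotient (isIsomorphicSetoid (Q.Ind k))

variable {Q k} in
/-- The isomorphism class of an indecomposable representation. -/
def indClass (M : Q.Ind k) : Q.IndClass k := _root_.Quotient.mk (isIsomorphicSetoid (Q.Ind k)) M

variable {Q k} in
/-- A representation in the given isomorphism class. -/
def IndClass.rep (x : Q.IndClass k) : Q.Rep k := (_root_.Quotient.out x).obj

/-- The Auslander–Reiten quiver of `rep Q`: the vertices are the isomorphism classes of
indecomposable representations, and the number of arrows from `[M]` to `[N]` is
the dimension of `Irr(M, N)`. -/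
instance arQuiver : Quiver.{0} (Q.IndClass k) where
  Hom x y := Fin (Module.finrank k (Irr k x.rep y.rep))

open Classical in
/-- The Auslander–Reiten translation on isomorphism classes, which is defined at the
nonprojective indecomposable representations. -/
def arTranslation (x : Q.IndClass k) : Option (Q.IndClass k) :=
  if h : ¬ Projective x.rep ∧ ∃ y : Q.IndClass k, IsTranslate x.rep y.rep then some h.2.choose
  else none

instance : HasFiniteBiproducts (Q.Rep k) := Abelian.hasFiniteBiproducts

variable {Q k}

/-- The extension of `F` to the additive closure of the category of line segments, with
values in `rep Q`. -/
def segmentFunctorAdd (c : Q.PivotScalars k) : Mat_ (Q.SegmentCategory k) ⥤ Q.Rep k :=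
  additiveExtension (segmentFunctor c ⋙ ObjectProperty.ι _)

end TypeA

end

/-!
A pivot moves one end point of a line segment to the next point in counterclockwise order; here the
left end point starts right after `n + 2` and the right end point starts right after `0`. In terms
of the positions of the end points in these two orders, there is a nonzero morphism `M_γ ⟶ M_δ`
exactly if both end points of `δ` come weakly after those of `γ` and the supports overlap; it is
then unique up to scalars. On the side of the mesh category, the mesh relations identify all paths
of pivots from `γ` to `δ` up to scalars, and make them zero when the supports do not overlap. Hence
`F` is fully faithful, and it is dense because each representation of `Q` is a direct sum of the
`M_γ`: a nonzero vector that can be moved as far to the right as possible spans such a summand.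

The canonical maps along a mesh form a square in which, at each vertex of `Q`, two opposite sides
are isomorphisms. It is therefore both a pushout and a pullback, and gives an almost split sequence,
since each nonisomorphism between representations `M_γ` factors through a pivot at either end. If
`R γ` is undefined, then some vertex of the support of `M_γ` is missed by the images of all
nonisomorphisms `M_ε ⟶ M_γ`, so each epimorphism onto `M_γ` splits.
-/

noncomputable section

namespace TypeA

/-! ### The boundary of the polygon -/

section Boundary

variable {n : ℕ} (Q : TypeA n)

/-- The quiver whose polygon is the polygon of `Q` after a half turn, which sends the vertex `l` to
`n + 2 - l` and preserves the clockwise orientation. It exchanges the roles of the two end points of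
a line segment. -/
def halfTurn : TypeA n := ⟨fun a => !Q.right a.rev⟩

theorem halfTurn_isUpper_rev {l : Fin (n + 3)} : Q.halfTurn.IsUpper l.rev ↔ Q.IsLower l := by
  constructor <;> rintro ⟨a, ha, hl⟩ <;>
    refine ⟨a.rev, by simpa [halfTurn] using ha, ?_⟩ <;> simp only [Fin.val_rev] at hl ⊢ <;> omega

theorem halfTurn_isLower_rev {l : Fin (n + 3)} : Q.halfTurn.IsLower l.rev ↔ Q.IsUpper l := by
  constructor <;> rintro ⟨a, ha, hl⟩ <;>
    refine ⟨a.rev, by simpa [halfTurn] using ha, ?_⟩ <;> simp only [Fin.val_rev] at hl ⊢ <;> omega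

theorem halfTurn_onUpper_rev {l : Fin (n + 3)} : Q.halfTurn.OnUpper l.rev ↔ Q.OnLower l := by
  simp only [OnUpper, OnLower, halfTurn_isUpper_rev, Fin.rev_eq_iff, Fin.rev_zero, Fin.rev_last]
  tauto

theorem halfTurn_onLower_rev {l : Fin (n + 3)} : Q.halfTurn.OnLower l.rev ↔ Q.OnUpper l := by
  simp only [OnUpper, OnLower, halfTurn_isLower_rev, Fin.rev_eq_iff, Fin.rev_zero, Fin.rev_last]
  tauto

theorem halfTurn_clockwiseNext_rev {l m : Fin (n + 3)} (h : Q.ClockwiseNext l m) :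
    Q.halfTurn.ClockwiseNext l.rev m.rev := by
  have no_between {P P' : Fin (n + 3) → Prop} {a b : Fin (n + 3)} (hP : ∀ r, P' r.rev ↔ P r)
      (hno : ∀ r, P r → ¬ (a < r ∧ r < b)) (r : Fin (n + 3)) (hr : P' r) :
      ¬ (b.rev < r ∧ r < a.rev) := by
    obtain ⟨r, rfl⟩ := Fin.rev_surjective r
    simpa only [Fin.rev_lt_rev, and_comm] using hno r ((hP r).1 hr)
  rcases h with ⟨hl, hm, hlt, hno⟩ | ⟨hl, hm, hlt, hno⟩
  · exact Or.inr ⟨Q.halfTurn_onLower_rev.2 hl, Q.halfTurn_onLower_rev.2 hm, Fin.rev_lt_rev.2 hlt,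
      no_between (fun _ => Q.halfTurn_onLower_rev) hno⟩
  · exact Or.inl ⟨Q.halfTurn_onUpper_rev.2 hl, Q.halfTurn_onUpper_rev.2 hm, Fin.rev_lt_rev.2 hlt,
      no_between (fun _ => Q.halfTurn_onUpper_rev) hno⟩

variable {Q} in
theorem ClockwiseNext.eq_R {l m : Fin (n + 3)} (h : Q.ClockwiseNext l m) : m = Q.R l := by
  rw [Q.clockwiseNext_left_unique h (Q.clockwiseNext_R_symm m), Equiv.apply_symm_apply]

theorem halfTurn_R_rev (l : Fin (n + 3)) : Q.halfTurn.R l.rev = (Q.R l).rev :=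
  (Q.halfTurn_clockwiseNext_rev (Q.clockwiseNext_R l)).eq_R.symm

theorem halfTurn_R_symm_rev (l : Fin (n + 3)) : Q.halfTurn.R.symm l.rev = (Q.R.symm l).rev := by
  rw [Equiv.symm_apply_eq, halfTurn_R_rev, Equiv.apply_symm_apply]

theorem R_symm_ne (l : Fin (n + 3)) : Q.R.symm l ≠ l := fun h =>
  Q.R_ne l ((Q.R.symm_apply_eq.1 h).symm)

open Classical in
/-- The position of a boundary point in counterclockwise order, starting right after `n + 2`: first
come the upper points from right to left, then `0`, then the lower points from left to right.
This is the order in which the left end point of a line segment moves under pivots. -/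
def leftPos (l : Fin (n + 3)) : ℤ := if Q.OnLower l then l else -l

/-- The position of a boundary point in counterclockwise order, starting right after `0`.
This is the order in which the right end point of a line segment moves under pivots. -/
def rightPos (l : Fin (n + 3)) : ℤ := Q.halfTurn.leftPos l.rev

variable {Q} {a b x y : Fin (n + 3)}

theorem OnLower.leftPos_eq (h : Q.OnLower x) : Q.leftPos x = x := if_pos h

theorem leftPos_of_not_onLower (h : ¬ Q.OnLower x) :
    Q.leftPos x = -x ∧ 0 < (x : ℤ) ∧ (x : ℤ) < n + 2 := by
  have h0 : (x : ℕ) ≠ 0 := fun e => h (Or.inl (Fin.ext e))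
  have h1 : (x : ℕ) ≠ n + 2 := fun e => h (Or.inr (Or.inl (Fin.ext e)))
  have := x.isLt
  exact ⟨if_neg h, by omega, by omega⟩

theorem OnUpper.leftPos_eq (h : Q.OnUpper x) (hx : (x : ℕ) ≠ n + 2) : Q.leftPos x = -x := by
  by_cases hl : Q.OnLower x
  · rcases Q.onUpper_and_onLower h hl with rfl | rfl
    · simp [hl.leftPos_eq]
    · exact (hx rfl).elim
  · exact (leftPos_of_not_onLower hl).1

theorem leftPos_injective : Function.Injective Q.leftPos := fun x y h => by
  by_cases hx : Q.OnLower x <;> by_cases hy : Q.OnLower y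
  · exact Fin.ext (by have := hx.leftPos_eq; have := hy.leftPos_eq; omega)
  · have := hx.leftPos_eq; have := leftPos_of_not_onLower hy; omega
  · have := leftPos_of_not_onLower hx; have := hy.leftPos_eq; omega
  · exact Fin.ext (by
      have := leftPos_of_not_onLower hx; have := leftPos_of_not_onLower hy; omega)

theorem leftPos_le_iff_of_lt (h : x < y) : Q.leftPos x ≤ Q.leftPos y ↔ Q.OnLower y := by
  rw [Fin.lt_def] at h
  by_cases hx : Q.OnLower x <;> by_cases hy : Q.OnLower y <;> simp only [hy, iff_true, iff_false]
  · have := hx.leftPos_eq; have := hy.leftPos_eq; omega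
  · have := hx.leftPos_eq; have := leftPos_of_not_onLower hy; omega
  · have := leftPos_of_not_onLower hx; have := hy.leftPos_eq; omega
  · have := leftPos_of_not_onLower hx; have := leftPos_of_not_onLower hy; omega

theorem leftPos_le_iff_of_gt (h : y < x) : Q.leftPos x ≤ Q.leftPos y ↔ ¬ Q.OnLower x := by
  rw [← leftPos_le_iff_of_lt h, not_le]
  exact (leftPos_injective.ne h.ne').le_iff_lt

theorem le_or_le_of_leftPos (h : Q.leftPos a ≤ Q.leftPos x) (h' : Q.leftPos x ≤ Q.leftPos b) :
    x ≤ a ∨ x ≤ b := by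
  simp only [Fin.le_def]
  by_cases hx : Q.OnLower x
  · right
    by_cases hb : Q.OnLower b
    · have := hx.leftPos_eq; have := hb.leftPos_eq; omega
    · have := hx.leftPos_eq; have := leftPos_of_not_onLower hb; omega
  · left
    by_cases ha : Q.OnLower a
    · have := leftPos_of_not_onLower hx; have := ha.leftPos_eq; omega
    · have := leftPos_of_not_onLower hx; have := leftPos_of_not_onLower ha; omega

theorem ClockwiseNext.leftPos_lt (h : Q.ClockwiseNext y x) (hx : (x : ℕ) ≠ n + 2) :
    Q.leftPos x < Q.leftPos y := by
  rcases h with ⟨hy, hx', hlt, -⟩ | ⟨hy, hx', hlt, -⟩ <;> rw [Fin.lt_def] at hlt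
  · rw [hy.leftPos_eq (by have := x.isLt; omega), hx'.leftPos_eq hx]
    omega
  · rw [hy.leftPos_eq, hx'.leftPos_eq]
    omega

theorem ClockwiseNext.leftPos_le (h : Q.ClockwiseNext y x) (hlt : Q.leftPos x < Q.leftPos a) :
    Q.leftPos y ≤ Q.leftPos a := by
  have ha := a.isLt
  have hx : (x : ℕ) ≠ n + 2 := fun e => by
    rw [OnLower.leftPos_eq (Or.inr (Or.inl (Fin.ext e)))] at hlt
    by_cases ha : Q.OnLower a
    · have := ha.leftPos_eq; omega
    · have := leftPos_of_not_onLower ha; omega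
  rcases h with ⟨hy, hx', hyx, hno⟩ | ⟨hy, hx', hyx, hno⟩ <;> rw [Fin.lt_def] at hyx
  · by_cases hau : Q.OnUpper a ∧ (a : ℕ) ≠ n + 2
    · have := hno a hau.1
      simp only [Fin.lt_def] at this
      rw [hx'.leftPos_eq hx, hau.1.leftPos_eq hau.2] at hlt
      rw [hy.leftPos_eq (by omega), hau.1.leftPos_eq hau.2]
      omega
    · have hal : Q.OnLower a := (Q.onUpper_or_onLower a).elim
        (fun h => Or.inr (Or.inl (Fin.ext (by_contra fun e => hau ⟨h, e⟩)))) id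
      rw [hy.leftPos_eq (by omega), hal.leftPos_eq]
      omega
  · by_cases hal : Q.OnLower a
    · have := hno a hal
      simp only [Fin.lt_def] at this
      rw [hx'.leftPos_eq, hal.leftPos_eq] at hlt
      rw [hy.leftPos_eq, hal.leftPos_eq]
      omega
    · have := leftPos_of_not_onLower hal
      rw [hx'.leftPos_eq] at hlt
      omega

theorem leftPos_lt_R_symm (hx : x ≠ Fin.last (n + 2)) : Q.leftPos x < Q.leftPos (Q.R.symm x) :=
  (Q.clockwiseNext_R_symm x).leftPos_lt fun e => hx (Fin.ext e)

theorem leftPos_R_symm_le (h : Q.leftPos x < Q.leftPos a) : Q.leftPos (Q.R.symm x) ≤ Q.leftPos a :=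
  (Q.clockwiseNext_R_symm x).leftPos_le h

theorem ne_last_of_leftPos_lt (h : Q.leftPos x < Q.leftPos y) : x ≠ Fin.last (n + 2) := by
  rintro rfl
  have hy := y.isLt
  rw [OnLower.leftPos_eq (Or.inr (Or.inl rfl)), Fin.val_last] at h
  by_cases hl : Q.OnLower y
  · have := hl.leftPos_eq; omega
  · have := leftPos_of_not_onLower hl; omega

-- The largest point before `y` has a successor, and this successor can only be `y`.
theorem leftPos_le_R_and_R_lt (h : Q.leftPos x < Q.leftPos y) :
    Q.leftPos x ≤ Q.leftPos (Q.R y) ∧ Q.leftPos (Q.R y) < Q.leftPos y := by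
  classical
  obtain ⟨p, hp, hmax⟩ := Finset.exists_max_image
    (Finset.univ.filter fun z => Q.leftPos z < Q.leftPos y) Q.leftPos ⟨x, by simpa using h⟩
  simp only [Finset.mem_filter, Finset.mem_univ, true_and] at hp hmax
  have hsucc : Q.R.symm p = y := leftPos_injective <| (leftPos_R_symm_le hp).eq_of_not_lt fun hlt =>
    (leftPos_lt_R_symm (ne_last_of_leftPos_lt hp)).not_ge (hmax _ hlt)
  rw [← hsucc, Equiv.apply_symm_apply, hsucc]
  exact ⟨hmax x h, hp⟩

theorem leftPos_le_R (h : Q.leftPos x < Q.leftPos y) : Q.leftPos x ≤ Q.leftPos (Q.R y) :=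
  (leftPos_le_R_and_R_lt h).1

theorem leftPos_R_lt (h : Q.leftPos x < Q.leftPos y) : Q.leftPos (Q.R y) < Q.leftPos y :=
  (leftPos_le_R_and_R_lt h).2

theorem rightPos_injective : Function.Injective Q.rightPos :=
  leftPos_injective.comp Fin.rev_injective

theorem rightPos_le_iff_of_lt (h : x < y) : Q.rightPos x ≤ Q.rightPos y ↔ ¬ Q.OnUpper x :=
  (leftPos_le_iff_of_gt (Fin.rev_lt_rev.2 h)).trans (not_congr (halfTurn_onLower_rev Q))

theorem rightPos_le_iff_of_gt (h : y < x) : Q.rightPos x ≤ Q.rightPos y ↔ Q.OnUpper y :=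
  (leftPos_le_iff_of_lt (Fin.rev_lt_rev.2 h)).trans (halfTurn_onLower_rev Q)

theorem le_or_le_of_rightPos (h : Q.rightPos a ≤ Q.rightPos x)
    (h' : Q.rightPos x ≤ Q.rightPos b) : a ≤ x ∨ b ≤ x := by
  simpa only [Fin.rev_le_rev] using le_or_le_of_leftPos h h'

theorem rightPos_lt_R_symm (hx : x ≠ 0) : Q.rightPos x < Q.rightPos (Q.R.symm x) := by
  rw [rightPos, rightPos, ← halfTurn_R_symm_rev]
  exact leftPos_lt_R_symm fun e => hx (Fin.rev_injective (e.trans (Fin.rev_zero _).symm))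

theorem rightPos_R_symm_le (h : Q.rightPos x < Q.rightPos a) :
    Q.rightPos (Q.R.symm x) ≤ Q.rightPos a := by
  rw [rightPos, ← halfTurn_R_symm_rev]
  exact leftPos_R_symm_le h

theorem rightPos_le_R (h : Q.rightPos x < Q.rightPos y) : Q.rightPos x ≤ Q.rightPos (Q.R y) := by
  rw [rightPos, rightPos, ← halfTurn_R_rev]
  exact leftPos_le_R h

theorem rightPos_R_lt (h : Q.rightPos x < Q.rightPos y) : Q.rightPos (Q.R y) < Q.rightPos y := by
  rw [rightPos, rightPos, ← halfTurn_R_rev]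
  exact leftPos_R_lt h

end Boundary

end TypeA

namespace TypeA

/-! ### Pivots and the rotation -/

section Pivots

variable {n : ℕ} {Q : TypeA n} {γ δ ε δ₁ δ₂ : Q.Segment}

theorem Segment.leftPos_lt_R_symm (γ : Q.Segment) : Q.leftPos γ.i < Q.leftPos (Q.R.symm γ.i) :=
  TypeA.leftPos_lt_R_symm (γ.i_lt_j.trans_le (Fin.le_last _)).ne

theorem Segment.rightPos_lt_R_symm (γ : Q.Segment) :
    Q.rightPos γ.j < Q.rightPos (Q.R.symm γ.j) :=
  TypeA.rightPos_lt_R_symm ((Fin.zero_le _).trans_lt γ.i_lt_j).ne'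

theorem IsPivot.leftPos_le (p : Q.IsPivot γ δ) : Q.leftPos γ.i ≤ Q.leftPos δ.i := by
  rcases p with ⟨hi, -⟩ | ⟨hi, -⟩ <;> rw [hi]
  exact γ.leftPos_lt_R_symm.le

theorem IsPivot.rightPos_le (p : Q.IsPivot γ δ) : Q.rightPos γ.j ≤ Q.rightPos δ.j := by
  rcases p with ⟨-, hj⟩ | ⟨-, hj⟩ <;> rw [hj]
  exact γ.rightPos_lt_R_symm.le

/-- The total position of a line segment, which increases under pivots: the induction parameter for
arguments along paths of pivots. -/
def Segment.height (γ : Q.Segment) : ℤ := Q.leftPos γ.i + Q.rightPos γ.j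

theorem IsPivot.height_lt (p : Q.IsPivot γ δ) : γ.height < δ.height := by
  rcases p with ⟨hi, hj⟩ | ⟨hi, hj⟩ <;> rw [Segment.height, Segment.height, hi, hj]
  · exact Int.add_lt_add_right γ.leftPos_lt_R_symm _
  · exact Int.add_lt_add_left γ.rightPos_lt_R_symm _

theorem Segment.pivot_induction {motive : Q.Segment → Prop}
    (step : ∀ δ, (∀ ε, Q.IsPivot ε δ → motive ε) → motive δ) (γ : Q.Segment) : motive γ := by
  have : IsTrans Q.Segment (fun γ δ => γ.height < δ.height) := ⟨fun _ _ _ => lt_trans⟩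
  have : Std.Irrefl (fun γ δ : Q.Segment => γ.height < δ.height) := ⟨fun _ => lt_irrefl _⟩
  exact (Finite.wellFounded_of_trans_of_irrefl fun γ δ : Q.Segment => γ.height < δ.height).induction
    γ fun δ ih => step δ fun ε p => ih ε p.height_lt

theorem IsPivot.ne (p : Q.IsPivot γ δ) : γ ≠ δ := by
  rintro rfl
  exact lt_irrefl _ p.height_lt

theorem IsPivot.eq_or_eq_of_ne (h₁ : Q.IsPivot γ δ₁) (h₂ : Q.IsPivot γ δ₂) (hne : δ₁ ≠ δ₂)
    (h : Q.IsPivot γ δ) : δ = δ₁ ∨ δ = δ₂ := by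
  rcases h₁ with a | a <;> rcases h₂ with b | b <;> rcases h with c | c <;>
    first
    | exact (hne (Segment.ext (a.1.trans b.1.symm) (a.2.trans b.2.symm))).elim
    | exact Or.inl (Segment.ext (c.1.trans a.1.symm) (c.2.trans a.2.symm))
    | exact Or.inr (Segment.ext (c.1.trans b.1.symm) (c.2.trans b.2.symm))

theorem IsPivot.moves_both_of_ne (h₁ : Q.IsPivot δ₁ δ) (h₂ : Q.IsPivot δ₂ δ) (hne : δ₁ ≠ δ₂) :
    (δ.i = Q.R.symm δ₁.i ∧ δ.j = δ₁.j ∧ δ.i = δ₂.i ∧ δ.j = Q.R.symm δ₂.j) ∨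
      (δ.i = δ₁.i ∧ δ.j = Q.R.symm δ₁.j ∧ δ.i = Q.R.symm δ₂.i ∧ δ.j = δ₂.j) := by
  rcases h₁ with ⟨hi₁, hj₁⟩ | ⟨hi₁, hj₁⟩ <;> rcases h₂ with ⟨hi₂, hj₂⟩ | ⟨hi₂, hj₂⟩
  · exact (hne (Segment.ext (Q.R.symm.injective (hi₁.symm.trans hi₂)) (hj₁.symm.trans hj₂))).elim
  · exact Or.inl ⟨hi₁, hj₁, hi₂, hj₂⟩
  · exact Or.inr ⟨hi₁, hj₁, hi₂, hj₂⟩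
  · exact (hne (Segment.ext (hi₁.symm.trans hi₂) (Q.R.symm.injective (hj₁.symm.trans hj₂)))).elim

theorem rotation_of_eq (hi : δ.i = Q.R γ.i) (hj : δ.j = Q.R γ.j) : Q.rotation γ = some δ := by
  have h : Q.R γ.i < Q.R γ.j := by rw [← hi, ← hj]; exact δ.i_lt_j
  rw [rotation, dif_pos h]
  exact congrArg some (Segment.ext hi.symm hj.symm)

theorem isPivot_iff_of_rotation (h : Q.rotation γ = some δ) : Q.IsPivot ε γ ↔ Q.IsPivot δ ε := by
  obtain ⟨hi, hj⟩ := Q.rotation_eq_some h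
  rw [IsPivot, IsPivot, hi, hj, Equiv.symm_apply_apply, Equiv.symm_apply_apply,
    Equiv.eq_symm_apply, Equiv.eq_symm_apply, or_comm, eq_comm (a := γ.i), eq_comm (a := γ.j),
    eq_comm (a := Q.R γ.i), eq_comm (a := Q.R γ.j)]

theorem nonempty_hom_iff_of_rotation (h : Q.rotation γ = some δ) :
    Nonempty (ε ⟶ γ) ↔ Nonempty (δ ⟶ ε) :=
  ⟨fun ⟨p⟩ => ⟨⟨(isPivot_iff_of_rotation h).1 p.down⟩⟩,
    fun ⟨p⟩ => ⟨⟨(isPivot_iff_of_rotation h).2 p.down⟩⟩⟩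

theorem rotation_injective (hγ : Q.rotation γ = some ε) (hδ : Q.rotation δ = some ε) :
    γ = δ := by
  obtain ⟨hi, hj⟩ := Q.rotation_eq_some hγ
  obtain ⟨hi', hj'⟩ := Q.rotation_eq_some hδ
  exact Segment.ext (Q.R.injective (hi.symm.trans hi')) (Q.R.injective (hj.symm.trans hj'))

theorem isTranslationQuiver_rotation : TransQuiver.IsTranslationQuiver Q.rotation where
  no_loops _ := ⟨fun p => p.down.ne rfl⟩
  injective _ _ _ := rotation_injective
  card_arrows _ _ h _ := Nat.card_congr
    (Equiv.plift.trans ((Equiv.ofIff (isPivot_iff_of_rotation h)).trans Equiv.plift.symm))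

theorem R_lt_R_of_rotation_eq_none (h : Q.rotation γ = none) : Q.R γ.j < Q.R γ.i := by
  refine lt_of_not_ge fun hle => ?_
  rw [rotation, dif_pos (hle.lt_of_ne (Q.R.injective.ne γ.i_lt_j.ne))] at h
  exact Option.some_ne_none _ h

theorem i_lt_R_and_R_lt_j_of_rotation_eq_none (h : Q.rotation γ = none) :
    γ.i < Q.R γ.i ∧ Q.R γ.j < γ.j := by
  have hlt := R_lt_R_of_rotation_eq_none h
  have hij := γ.i_lt_j
  rcases Q.clockwiseNext_R γ.i with ⟨-, -, hi, hnoi⟩ | ⟨-, hRi, hi, -⟩ <;>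
    rcases Q.clockwiseNext_R γ.j with ⟨hj', -, hj, -⟩ | ⟨-, -, hj, hnoj⟩
  · exact (hnoi γ.j hj' ⟨hij, hj.trans hlt⟩).elim
  · exact ⟨hi, hj⟩
  · exact (hij.not_gt (hj.trans (hlt.trans hi))).elim
  · exact (hnoj (Q.R γ.i) hRi ⟨hlt, hi.trans hij⟩).elim

-- The vertex is `max i (R j) + 1`.
theorem exists_mem_support_of_rotation_eq_none (h : Q.rotation γ = none) :
    ∃ v : ℕ, (γ.i < v ∧ v ≤ γ.j) ∧ ∀ ε : Q.Segment, Q.IsPivot ε γ → ¬ (ε.i < v ∧ v ≤ ε.j) := by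
  have hlt := R_lt_R_of_rotation_eq_none h
  obtain ⟨hi, hj⟩ := i_lt_R_and_R_lt_j_of_rotation_eq_none h
  have hij := γ.i_lt_j
  rw [Fin.lt_def] at hlt hi hj hij
  refine ⟨max (γ.i : ℕ) (Q.R γ.j : ℕ) + 1, by omega, ?_⟩
  rintro ε (⟨hεi, -⟩ | ⟨-, hεj⟩)
  · rw [Equiv.eq_symm_apply] at hεi
    rw [hεi] at hlt hi
    omega
  · rw [Equiv.eq_symm_apply] at hεj
    rw [hεj] at hlt hj ⊢
    omega

end Pivots

/-! ### Hammocks -/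

section Hammock

variable {n : ℕ} {Q : TypeA n} {γ δ ε δ₁ δ₂ : Q.Segment}

/-- `δ` lies in the hammock of `γ`: both end points of `δ` come weakly after those of `γ` in
counterclockwise order, and the supports of the two representations overlap. This is the condition
for the existence of a nonzero morphism from the representation of `γ` to that of `δ`. -/
structure InHammock (γ δ : Q.Segment) : Prop where
  leftPos_le : Q.leftPos γ.i ≤ Q.leftPos δ.i
  rightPos_le : Q.rightPos γ.j ≤ Q.rightPos δ.j
  i_lt_j : γ.i < δ.j
  i_lt_j' : δ.i < γ.j

theorem InHammock.refl (γ : Q.Segment) : InHammock γ γ := ⟨le_rfl, le_rfl, γ.i_lt_j, γ.i_lt_j⟩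

theorem InHammock.antisymm (h : InHammock γ δ) (h' : InHammock δ γ) : γ = δ :=
  Segment.ext (leftPos_injective (h.leftPos_le.antisymm h'.leftPos_le))
    (rightPos_injective (h.rightPos_le.antisymm h'.rightPos_le))

theorem InHammock.exists_between (h : InHammock γ δ) {x y : Fin (n + 3)}
    (hx : Q.leftPos γ.i ≤ Q.leftPos x) (hx' : Q.leftPos x ≤ Q.leftPos δ.i)
    (hy : Q.rightPos γ.j ≤ Q.rightPos y) (hy' : Q.rightPos y ≤ Q.rightPos δ.j) :
    ∃ ε : Q.Segment, ε.i = x ∧ ε.j = y ∧ InHammock γ ε ∧ InHammock ε δ := by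
  have hxγδ := le_or_le_of_leftPos hx hx'
  have hyγδ := le_or_le_of_rightPos hy hy'
  have hγ := γ.i_lt_j
  have hδ := δ.i_lt_j
  have h₁ := h.i_lt_j
  have h₂ := h.i_lt_j'
  rw [Fin.lt_def] at hγ hδ h₁ h₂
  rw [Fin.le_def, Fin.le_def] at hxγδ hyγδ
  have hxy : x < y := Fin.lt_def.2 (by omega)
  exact ⟨⟨(x, y), hxy⟩, rfl, rfl, ⟨hx, hy, Fin.lt_def.2 (by omega : (γ.i : ℕ) < y),
      Fin.lt_def.2 (by omega : (x : ℕ) < γ.j)⟩,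
    ⟨hx', hy', Fin.lt_def.2 (by omega : (x : ℕ) < δ.j),
      Fin.lt_def.2 (by omega : (δ.i : ℕ) < y)⟩⟩

theorem InHammock.of_between (h : InHammock γ δ) (hi : Q.leftPos γ.i ≤ Q.leftPos ε.i)
    (hi' : Q.leftPos ε.i ≤ Q.leftPos δ.i) (hj : Q.rightPos γ.j ≤ Q.rightPos ε.j)
    (hj' : Q.rightPos ε.j ≤ Q.rightPos δ.j) : InHammock γ ε := by
  obtain ⟨ε', ei, ej, hε', -⟩ := h.exists_between hi hi' hj hj'
  rwa [← Segment.ext ei ej]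

theorem IsPivot.inHammock (p : Q.IsPivot γ δ) : InHammock γ δ := by
  have hlt : γ.i < δ.j ∧ δ.i < γ.j := by
    rcases p with ⟨-, hj⟩ | ⟨hi, -⟩
    · exact ⟨by rw [hj]; exact γ.i_lt_j, by rw [← hj]; exact δ.i_lt_j⟩
    · exact ⟨by rw [← hi]; exact δ.i_lt_j, by rw [hi]; exact γ.i_lt_j⟩
  exact ⟨p.leftPos_le, p.rightPos_le, hlt.1, hlt.2⟩

theorem IsPivot.eq_or_eq_of_inHammock (p : Q.IsPivot γ δ) (h : InHammock γ ε)
    (h' : InHammock ε δ) : ε = γ ∨ ε = δ := by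
  rcases p with ⟨hi, hj⟩ | ⟨hi, hj⟩
  · have hεj : ε.j = γ.j := rightPos_injective ((hj ▸ h'.rightPos_le).antisymm h.rightPos_le)
    refine h.leftPos_le.eq_or_lt.imp (fun e => Segment.ext (leftPos_injective e).symm hεj)
      fun hlt => Segment.ext (leftPos_injective (h'.leftPos_le.antisymm ?_)) (hεj.trans hj.symm)
    exact hi ▸ leftPos_R_symm_le hlt
  · have hεi : ε.i = γ.i := leftPos_injective ((hi ▸ h'.leftPos_le).antisymm h.leftPos_le)
    refine h.rightPos_le.eq_or_lt.imp (fun e => Segment.ext hεi (rightPos_injective e).symm)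
      fun hlt => Segment.ext (hεi.trans hi.symm) (rightPos_injective (h'.rightPos_le.antisymm ?_))
    exact hj ▸ rightPos_R_symm_le hlt

theorem InHammock.rightPos_lt_of_ne (h : InHammock γ δ) (hne : γ ≠ δ)
    (e : Q.leftPos γ.i = Q.leftPos δ.i) : Q.rightPos γ.j < Q.rightPos δ.j :=
  h.rightPos_le.lt_of_ne fun e' => hne (Segment.ext (leftPos_injective e) (rightPos_injective e'))

theorem InHammock.exists_pivot_from (h : InHammock γ δ) (hne : γ ≠ δ) :
    ∃ ε : Q.Segment, Nonempty (γ ⟶ ε) ∧ InHammock ε δ := by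
  rcases h.leftPos_le.eq_or_lt with e | hlt
  · obtain ⟨ε, hi, hj, -, hε⟩ := h.exists_between le_rfl h.leftPos_le γ.rightPos_lt_R_symm.le
      (rightPos_R_symm_le (h.rightPos_lt_of_ne hne e))
    exact ⟨ε, ⟨⟨Or.inr ⟨hi, hj⟩⟩⟩, hε⟩
  · obtain ⟨ε, hi, hj, -, hε⟩ := h.exists_between γ.leftPos_lt_R_symm.le (leftPos_R_symm_le hlt)
      le_rfl h.rightPos_le
    exact ⟨ε, ⟨⟨Or.inl ⟨hi, hj⟩⟩⟩, hε⟩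

theorem InHammock.exists_pivot_to (h : InHammock γ δ) (hne : γ ≠ δ) :
    ∃ ε : Q.Segment, Nonempty (ε ⟶ δ) ∧ InHammock γ ε := by
  rcases h.leftPos_le.eq_or_lt with e | hlt
  · have hlt := h.rightPos_lt_of_ne hne e
    obtain ⟨ε, hi, hj, hε, -⟩ := h.exists_between h.leftPos_le le_rfl (rightPos_le_R hlt)
      (rightPos_R_lt hlt).le
    exact ⟨ε, ⟨⟨Or.inr ⟨hi.symm, by rw [hj, Equiv.symm_apply_apply]⟩⟩⟩, hε⟩
  · obtain ⟨ε, hi, hj, hε, -⟩ := h.exists_between (leftPos_le_R hlt) (leftPos_R_lt hlt).le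
      h.rightPos_le le_rfl
    exact ⟨ε, ⟨⟨Or.inl ⟨by rw [hi, Equiv.symm_apply_apply], hj.symm⟩⟩⟩, hε⟩

theorem InHammock.exists_rotation (h : InHammock γ δ) (hi : Q.leftPos γ.i < Q.leftPos δ.i)
    (hj : Q.rightPos γ.j < Q.rightPos δ.j) :
    ∃ ε : Q.Segment, Q.rotation δ = some ε ∧ InHammock γ ε := by
  obtain ⟨ε, hεi, hεj, hε, -⟩ := h.exists_between (leftPos_le_R hi) (leftPos_R_lt hi).le
    (rightPos_le_R hj) (rightPos_R_lt hj).le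
  exact ⟨ε, rotation_of_eq hεi hεj, hε⟩

theorem InHammock.exists_rotation_of_ne (h₁ : InHammock γ δ₁) (h₂ : InHammock γ δ₂)
    (h : InHammock γ δ) (α : Q.IsPivot δ₁ δ) (β : Q.IsPivot δ₂ δ) (hne : δ₁ ≠ δ₂) :
    ∃ ε : Q.Segment, Q.rotation δ = some ε ∧ InHammock γ ε := by
  have hi₁ := δ₁.leftPos_lt_R_symm
  have hj₁ := δ₁.rightPos_lt_R_symm
  have hi₂ := δ₂.leftPos_lt_R_symm
  have hj₂ := δ₂.rightPos_lt_R_symm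
  rcases α.moves_both_of_ne β hne with ⟨ei, -, -, ej⟩ | ⟨-, ej, ei, -⟩ <;>
    refine h.exists_rotation (ei ▸ ?_) (ej ▸ ?_)
  · exact h₁.leftPos_le.trans_lt hi₁
  · exact h₂.rightPos_le.trans_lt hj₂
  · exact h₂.leftPos_le.trans_lt hi₂
  · exact h₁.rightPos_le.trans_lt hj₁

theorem InHammock.exists_rotation_of_not (h : InHammock γ δ₁) (α : Q.IsPivot δ₁ δ)
    (hn : ¬ InHammock γ δ) : ∃ ε : Q.Segment, Q.rotation δ = some ε ∧ InHammock γ ε := by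
  have hi := h.leftPos_le.trans α.leftPos_le
  have hj := h.rightPos_le.trans α.rightPos_le
  rcases α with ⟨ei, ej⟩ | ⟨ei, ej⟩
  · have hlt : Q.rightPos γ.j < Q.rightPos δ₁.j := h.rightPos_le.lt_of_ne fun e =>
      hn ⟨hi, hj, ej ▸ h.i_lt_j, by rw [rightPos_injective e, ← ej]; exact δ.i_lt_j⟩
    obtain ⟨ε, hεi, hεj, hε, -⟩ := h.exists_between h.leftPos_le le_rfl (rightPos_le_R hlt)
      (rightPos_R_lt hlt).le
    exact ⟨ε, rotation_of_eq (by rw [hεi, ei, Equiv.apply_symm_apply]) (by rw [hεj, ej]), hε⟩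
  · have hlt : Q.leftPos γ.i < Q.leftPos δ₁.i := h.leftPos_le.lt_of_ne fun e =>
      hn ⟨hi, hj, by rw [leftPos_injective e, ← ei]; exact δ.i_lt_j, ei ▸ h.i_lt_j'⟩
    obtain ⟨ε, hεi, hεj, hε, -⟩ := h.exists_between (leftPos_le_R hlt) (leftPos_R_lt hlt).le
      h.rightPos_le le_rfl
    exact ⟨ε, rotation_of_eq (by rw [hεi, ei]) (by rw [hεj, ej, Equiv.apply_symm_apply]), hε⟩

theorem InHammock.of_pivots (h₁ : InHammock γ δ₁) (h₂ : InHammock γ δ₂) (α : Q.IsPivot δ₁ δ)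
    (β : Q.IsPivot δ₂ δ) (hne : δ₁ ≠ δ₂) : InHammock γ δ := by
  refine ⟨h₁.leftPos_le.trans α.leftPos_le, h₁.rightPos_le.trans α.rightPos_le, ?_, ?_⟩ <;>
    rcases α.moves_both_of_ne β hne with ⟨-, ej, ei, -⟩ | ⟨ei, -, -, ej⟩
  · exact ej ▸ h₁.i_lt_j
  · exact ej ▸ h₂.i_lt_j
  · exact ei ▸ h₂.i_lt_j'
  · exact ei ▸ h₁.i_lt_j'

theorem InHammock.nonempty_path (h : InHammock γ δ) : Nonempty (Quiver.Path γ δ) := by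
  induction δ using Segment.pivot_induction with
  | step δ ih =>
    rcases eq_or_ne γ δ with rfl | hne
    · exact ⟨Quiver.Path.nil⟩
    · obtain ⟨ε, ⟨p⟩, hε⟩ := h.exists_pivot_to hne
      exact (ih ε p.down hε).map (·.cons p)

end Hammock

/-! ### Signs for the pivots -/

section Signs

variable {n : ℕ} {Q : TypeA n}

open Classical in
/-- The number of boundary points that come before `l` in counterclockwise order, starting right
after `n + 2`. -/
def leftRank (Q : TypeA n) (l : Fin (n + 3)) : ℕ :=
  (Finset.univ.filter fun x => Q.leftPos x < Q.leftPos l).card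

theorem leftRank_R_symm {x : Fin (n + 3)} (hx : x ≠ Fin.last (n + 2)) :
    Q.leftRank (Q.R.symm x) = Q.leftRank x + 1 := by
  classical
  have hlt := leftPos_lt_R_symm (Q := Q) hx
  have : (Finset.univ.filter fun y => Q.leftPos y < Q.leftPos (Q.R.symm x)) =
      insert x (Finset.univ.filter fun y => Q.leftPos y < Q.leftPos x) := by
    ext y
    simp only [Finset.mem_filter, Finset.mem_univ, true_and, Finset.mem_insert]
    refine ⟨fun hy => ?_, ?_⟩
    · rcases lt_trichotomy (Q.leftPos y) (Q.leftPos x) with h | h | h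
      · exact Or.inr h
      · exact Or.inl (leftPos_injective h)
      · exact ((leftPos_R_symm_le h).not_gt hy).elim
    · rintro (rfl | h)
      · exact hlt
      · exact h.trans hlt
  rw [leftRank, this, Finset.card_insert_of_notMem (by simp), leftRank]

open Classical in
/-- The sign of a pivot: `1` if it moves the left end point, and alternating with the position of
the left end point otherwise. -/
def pivotSign (γ δ : Q.Segment) : ℤˣ := if δ.i = γ.i then (-1) ^ Q.leftRank γ.i else 1

theorem pivotSign_eq_pow {γ δ : Q.Segment} (h : δ.i = γ.i) :
    pivotSign γ δ = (-1) ^ Q.leftRank γ.i := if_pos h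

theorem pivotSign_eq_one {γ δ : Q.Segment} (h : δ.i = Q.R.symm γ.i) : pivotSign γ δ = 1 :=
  if_neg (h ▸ R_symm_ne Q _)

theorem pivotSign_mul_of_right_left {γ δ ε : Q.Segment} (hδ : δ.i = γ.i)
    (hε : ε.i = Q.R.symm δ.i) : pivotSign γ δ * pivotSign δ ε = (-1) ^ Q.leftRank γ.i := by
  rw [pivotSign_eq_pow hδ, pivotSign_eq_one hε, mul_one]

theorem pivotSign_mul_of_left_right {γ δ ε : Q.Segment} (hδ : δ.i = Q.R.symm γ.i)
    (hε : ε.i = δ.i) : pivotSign γ δ * pivotSign δ ε = -(-1) ^ Q.leftRank γ.i := by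
  rw [pivotSign_eq_one hδ, pivotSign_eq_pow hε, hδ,
    leftRank_R_symm (γ.i_lt_j.trans_le (Fin.le_last _)).ne, pow_succ, mul_neg_one, one_mul]

theorem pivotSign_mul_pivotSign {γ δ δ' ε : Q.Segment} (p : Q.IsPivot γ δ)
    (p' : Q.IsPivot γ δ') (h : Q.rotation ε = some γ) (hne : δ ≠ δ') :
    pivotSign γ δ * pivotSign δ ε = -(pivotSign γ δ' * pivotSign δ' ε) := by
  have hεi : ε.i = Q.R.symm γ.i := by
    rw [(Q.rotation_eq_some h).1, Equiv.symm_apply_apply]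
  rcases p with ⟨hi, hj⟩ | ⟨hi, hj⟩ <;> rcases p' with ⟨hi', hj'⟩ | ⟨hi', hj'⟩
  · exact (hne (Segment.ext (hi.trans hi'.symm) (hj.trans hj'.symm))).elim
  · rw [pivotSign_mul_of_left_right hi (hεi.trans hi.symm),
      pivotSign_mul_of_right_left hi' (hi' ▸ hεi)]
  · rw [pivotSign_mul_of_right_left hi (hi ▸ hεi),
      pivotSign_mul_of_left_right hi' (hεi.trans hi'.symm), neg_neg]
  · exact (hne (Segment.ext (hi.trans hi'.symm) (hj.trans hj'.symm))).elim

/-- The choice of scalars given by the signs of the pivots. -/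
def signScalars (Q : TypeA n) (k : Type u) [Field k] : Q.PivotScalars k where
  coeff {γ δ} _ := Units.map (Int.castRingHom k : ℤ →* k) (pivotSign γ δ)
  mesh p _ p' _ hr hne := by
    rw [← Units.val_mul, ← Units.val_mul, ← map_mul, ← map_mul,
      pivotSign_mul_pivotSign p.down p'.down hr hne, add_eq_zero_iff_eq_neg]
    simp

theorem signScalars_coeff_eq (k : Type u) [Field k] {γ δ : Q.Segment} (p : γ ⟶ δ) :
    ((Q.signScalars k).coeff p : k) = 1 ∨ ((Q.signScalars k).coeff p : k) = -1 := by
  rcases Int.units_eq_one_or (pivotSign γ δ) with h | h <;> simp [signScalars, h]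

end Signs

end TypeA

namespace TypeA

/-! ### Morphisms between interval representations -/

section Compatible

variable {n : ℕ} {Q : TypeA n}

theorem label_injective : Function.Injective (label (Q := Q)) := fun _ _ h =>
  Fin.ext (Nat.succ_injective h)

theorem label_pos (s : Q.Vertex) : 0 < label s := Nat.succ_pos _

theorem label_le (s : Q.Vertex) : label s ≤ n + 2 := Fin.isLt s

theorem exists_label_eq {m : ℕ} (h : 0 < m) (h' : m ≤ n + 2) : ∃ s : Q.Vertex, label s = m :=
  ⟨(⟨m - 1, by omega⟩ : Fin (n + 2)), Nat.succ_pred_eq_of_pos h⟩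

theorem not_onLower_iff {l : Fin (n + 3)} : ¬ Q.OnLower l ↔ Q.IsUpper l := by
  refine ⟨fun h => ?_, ?_⟩
  · rcases (Q.onUpper_or_onLower l).resolve_right h with e | e | hl
    exacts [(h (Or.inl e)).elim, (h (Or.inr (Or.inl e))).elim, hl]
  · rintro h (rfl | rfl | hl)
    exacts [Q.not_isUpper_zero h, Q.not_isUpper_last h, Q.not_isUpper_and_isLower h hl]

theorem not_onUpper_iff {l : Fin (n + 3)} : ¬ Q.OnUpper l ↔ Q.IsLower l := by
  refine ⟨fun h => ?_, ?_⟩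
  · rcases (Q.onUpper_or_onLower l).resolve_left h with e | e | hl
    exacts [(h (Or.inl e)).elim, (h (Or.inr (Or.inl e))).elim, hl]
  · rintro h (rfl | rfl | hl)
    exacts [Q.not_isLower_zero h, Q.not_isLower_last h, Q.not_isUpper_and_isLower hl h]

theorem OnLower.not_onUpper {l : Fin (n + 3)} (h : Q.OnLower l) (h0 : 0 < l)
    (h1 : l < Fin.last (n + 2)) : ¬ Q.OnUpper l :=
  fun h' => (Q.onUpper_and_onLower h' h).elim h0.ne' h1.ne

theorem OnUpper.not_onLower {l : Fin (n + 3)} (h : Q.OnUpper l) (h0 : 0 < l)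
    (h1 : l < Fin.last (n + 2)) : ¬ Q.OnLower l :=
  fun h' => h'.not_onUpper h0 h1 h

theorem IsArrow.cases {s t : Q.Vertex} (h : Q.IsArrow s t) : ∃ l : Fin (n + 3),
    (¬ Q.OnLower l ∧ label s = l ∧ label t = l + 1) ∨
      (¬ Q.OnUpper l ∧ label s = l + 1 ∧ label t = l) := by
  rcases h with ⟨a, ha, hs, ht⟩ | ⟨a, ha, hs, ht⟩
  · exact ⟨a.succ.castSucc, Or.inl ⟨not_onLower_iff.2 ⟨a, ha, rfl⟩, hs, ht⟩⟩
  · exact ⟨a.succ.castSucc, Or.inr ⟨not_onUpper_iff.2 ⟨a, ha, rfl⟩, hs, ht⟩⟩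

theorem isArrow_of_not_onLower {s t : Q.Vertex} {l : Fin (n + 3)} (hl : ¬ Q.OnLower l)
    (hs : label s = l) (ht : label t = l + 1) : Q.IsArrow s t := by
  obtain ⟨a, ha, e⟩ := not_onLower_iff.1 hl
  exact Or.inl ⟨a, ha, by omega, by omega⟩

theorem isArrow_of_not_onUpper {s t : Q.Vertex} {l : Fin (n + 3)} (hl : ¬ Q.OnUpper l)
    (hs : label s = l + 1) (ht : label t = l) : Q.IsArrow s t := by
  obtain ⟨a, ha, e⟩ := not_onUpper_iff.1 hl
  exact Or.inr ⟨a, ha, by omega, by omega⟩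

theorem IsArrow.label_eq_or {s t : Q.Vertex} (h : Q.IsArrow s t) :
    label t = label s + 1 ∨ label s = label t + 1 := by
  obtain ⟨l, ⟨-, hs, ht⟩ | ⟨-, hs, ht⟩⟩ := h.cases <;> omega

theorem isArrow_or_isArrow {s t : Q.Vertex} (h : label t = label s + 1) :
    Q.IsArrow s t ∨ Q.IsArrow t s := by
  have hs := label_pos s
  have ht := label_le t
  have hl0 : (0 : Fin (n + 3)) < ⟨label s, by omega⟩ := Fin.lt_def.2 hs
  have hl1 : (⟨label s, by omega⟩ : Fin (n + 3)) < Fin.last (n + 2) :=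
    Fin.lt_def.2 (show label s < n + 2 by omega)
  by_cases hl : Q.OnLower ⟨label s, by omega⟩
  · exact Or.inr (isArrow_of_not_onUpper (hl.not_onUpper hl0 hl1) h rfl)
  · exact Or.inl (isArrow_of_not_onLower hl rfl h)

theorem IsArrow.asymm {s t : Q.Vertex} (h : Q.IsArrow s t) : ¬ Q.IsArrow t s := by
  intro h'
  obtain ⟨l, ⟨hl, hs, ht⟩ | ⟨hl, hs, ht⟩⟩ := h.cases <;>
    obtain ⟨m, ⟨hm, hs', ht'⟩ | ⟨hm, hs', ht'⟩⟩ := h'.cases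
  · omega
  · obtain rfl : l = m := Fin.ext (by omega)
    exact (Q.onUpper_or_onLower l).elim hm hl
  · obtain rfl : l = m := Fin.ext (by omega)
    exact (Q.onUpper_or_onLower l).elim hl hm
  · omega

variable {i j i' j' : Fin (n + 3)}

theorem compatible_of_pos (hL : Q.leftPos i ≤ Q.leftPos i') (hR : Q.rightPos j ≤ Q.rightPos j') :
    Q.Compatible (i + 1) j (i' + 1) j' := by
  intro s t hst hs ht
  unfold Between at hs ht ⊢
  obtain ⟨l, ⟨hl, es, et⟩ | ⟨hl, es, et⟩⟩ := hst.cases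
  · have hi : i < l → i' ≠ l := fun h e => hl ((leftPos_le_iff_of_lt h).1 (e ▸ hL))
    have hj : l < j' → j ≠ l := fun h e =>
      (Q.onUpper_or_onLower l).elim ((rightPos_le_iff_of_lt h).1 (e ▸ hR)) hl
    rw [Fin.lt_def, Ne, Fin.ext_iff] at hi hj
    omega
  · have hi : i' < l → i ≠ l := fun h e =>
      (Q.onUpper_or_onLower l).elim hl fun h' => (leftPos_le_iff_of_gt h).1 (e ▸ hL) h'
    have hj : l < j → j' ≠ l := fun h e => hl ((rightPos_le_iff_of_gt h).1 (e ▸ hR))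
    rw [Fin.lt_def, Ne, Fin.ext_iff] at hi hj
    omega

theorem Compatible.leftPos_le (h : Q.Compatible (i + 1) j (i' + 1) j') (hij : i < j)
    (hij' : i' < j') (h1 : i < j') (h2 : i' < j) : Q.leftPos i ≤ Q.leftPos i' := by
  have hj := j.isLt
  rw [Fin.lt_def] at hij hij' h1 h2
  rcases lt_trichotomy i i' with hlt | rfl | hlt
  · rw [leftPos_le_iff_of_lt hlt]
    rw [Fin.lt_def] at hlt
    by_contra hl
    obtain ⟨s, hs⟩ := exists_label_eq (Q := Q) (m := i') (by omega) (by omega)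
    obtain ⟨t, ht⟩ := exists_label_eq (Q := Q) (m := i' + 1) (by omega) (by omega)
    have := h s t (isArrow_of_not_onLower hl hs ht)
    unfold Between at this
    omega
  · exact le_rfl
  · rw [leftPos_le_iff_of_gt hlt]
    intro hl
    have hl' := hl.not_onUpper (Fin.lt_of_le_of_lt (Fin.zero_le _) hlt)
      (Fin.lt_def.2 (by rw [Fin.val_last]; omega))
    rw [Fin.lt_def] at hlt
    obtain ⟨s, hs⟩ := exists_label_eq (Q := Q) (m := i + 1) (by omega) (by omega)
    obtain ⟨t, ht⟩ := exists_label_eq (Q := Q) (m := i) (by omega) (by omega)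
    have := h s t (isArrow_of_not_onUpper hl' hs ht)
    unfold Between at this
    omega

theorem Compatible.rightPos_le (h : Q.Compatible (i + 1) j (i' + 1) j') (hij : i < j)
    (hij' : i' < j') (h1 : i < j') (h2 : i' < j) : Q.rightPos j ≤ Q.rightPos j' := by
  have hj := j.isLt
  have hj' := j'.isLt
  rw [Fin.lt_def] at hij hij' h1 h2
  rcases lt_trichotomy j j' with hlt | rfl | hlt
  · rw [rightPos_le_iff_of_lt hlt]
    intro hl
    have hl' := hl.not_onLower (Fin.lt_def.2 (by rw [Fin.val_zero]; omega))
      (Fin.lt_of_lt_of_le hlt (Fin.le_last _))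
    rw [Fin.lt_def] at hlt
    obtain ⟨s, hs⟩ := exists_label_eq (Q := Q) (m := j) (by omega) (by omega)
    obtain ⟨t, ht⟩ := exists_label_eq (Q := Q) (m := j + 1) (by omega) (by omega)
    have := h s t (isArrow_of_not_onLower hl' hs ht)
    unfold Between at this
    omega
  · exact le_rfl
  · rw [rightPos_le_iff_of_gt hlt]
    rw [Fin.lt_def] at hlt
    by_contra hl
    obtain ⟨s, hs⟩ := exists_label_eq (Q := Q) (m := j' + 1) (by omega) (by omega)
    obtain ⟨t, ht⟩ := exists_label_eq (Q := Q) (m := j') (by omega) (by omega)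
    have := h s t (isArrow_of_not_onUpper hl hs ht)
    unfold Between at this
    omega

end Compatible

section Fibers

variable {n : ℕ} {Q : TypeA n} {k : Type u} [Field k] {M N L : Q.Rep k}

/-- The vector space of a representation at a vertex. -/
abbrev fiber (M : Q.Rep k) (l : Q.Vertex) : Type u := M.obj l

/-- The linear map of a representation at an arrow. -/
def arrowMap (M : Q.Rep k) {s t : Q.Vertex} (h : Q.IsArrow s t) : fiber M s →ₗ[k] fiber M t :=
  (M.map ((Paths.of Q.Vertex).map (PLift.up h : s ⟶ t))).hom.hom

/-- The linear map of a morphism of representations at a vertex. -/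
def fiberMap (f : M ⟶ N) (l : Q.Vertex) : fiber M l →ₗ[k] fiber N l := (f.app l).hom.hom

theorem fiberMap_comp_apply (f : M ⟶ N) (g : N ⟶ L) (l : Q.Vertex) (x : fiber M l) :
    fiberMap (f ≫ g) l x = fiberMap g l (fiberMap f l x) := rfl

theorem fiberMap_arrowMap (f : M ⟶ N) {s t : Q.Vertex} (h : Q.IsArrow s t) (x : fiber M s) :
    fiberMap f t (arrowMap M h x) = arrowMap N h (fiberMap f s x) :=
  congrArg (fun g => g.hom.hom x) (f.naturality ((Paths.of Q.Vertex).map (PLift.up h : s ⟶ t)))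

theorem arrowMap_intervalRep {a b : ℕ} {s t : Q.Vertex} (h : Q.IsArrow s t) :
    arrowMap (Q.intervalRep k a b) h = lineMap k (Between a b s) (Between a b t) :=
  congrArg (fun g => g.hom.hom) (Paths.lift_toPath (Q.intervalPrefunctor k a b) (PLift.up h))

end Fibers

section Coeff

variable {n : ℕ} {Q : TypeA n} {k : Type u} [Field k] {a b c d : ℕ}

/-- The generator of `line k p` if `p` holds. -/
def lineOne (k : Type u) [Field k] {p : Prop} (hp : p) : line k p := ⟨1, by simp [line, hp]⟩

theorem eq_smul_lineOne {p : Prop} (hp : p) (x : line k p) : x = (x : k) • lineOne k hp :=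
  Subtype.ext (mul_one _).symm

/-- The linear map of a morphism between interval representations at a vertex. -/
def component (f : Q.intervalRep k a b ⟶ Q.intervalRep k c d) (l : Q.Vertex) :
    line k (Between a b l) →ₗ[k] line k (Between c d l) := fiberMap f l

open Classical in
/-- The scalar by which a morphism between interval representations acts at a vertex, with the
value `0` outside of the support. -/
def homCoeff (f : Q.intervalRep k a b ⟶ Q.intervalRep k c d) (l : Q.Vertex) : k :=
  if h : Between a b l then component f l (lineOne k h) else 0

variable {f g : Q.intervalRep k a b ⟶ Q.intervalRep k c d} {l s t : Q.Vertex}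

theorem homCoeff_of_between (h : Between a b l) :
    homCoeff f l = component f l (lineOne k h) := dif_pos h

theorem homCoeff_eq_zero_left (h : ¬ Between a b l) : homCoeff f l = 0 := dif_neg h

theorem homCoeff_eq_zero_right (h : ¬ Between c d l) : homCoeff f l = 0 := by
  by_cases h' : Between a b l
  · rw [homCoeff_of_between h', line_eq_zero k h (component f l _), ZeroMemClass.coe_zero]
  · exact homCoeff_eq_zero_left h'

theorem component_apply (f : Q.intervalRep k a b ⟶ Q.intervalRep k c d) (l : Q.Vertex)
    (x : line k (Between a b l)) : (component f l x : k) = homCoeff f l * x := by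
  by_cases h : Between a b l
  · rw [homCoeff_of_between h, mul_comm]
    conv_lhs => rw [eq_smul_lineOne h x, map_smul]
    rfl
  · rw [line_eq_zero k h x, map_zero, ZeroMemClass.coe_zero, ZeroMemClass.coe_zero, mul_zero]

theorem homCoeff_ext (h : ∀ l, homCoeff f l = homCoeff g l) : f = g := by
  have key : ∀ l (x : line k (Between a b l)), component f l x = component g l x :=
    fun l x => Subtype.ext (by rw [component_apply, component_apply, h])
  exact Q.rep_hom_ext k key

theorem homCoeff_smul (r : k) : homCoeff (r • f) l = r * homCoeff f l := by
  by_cases h : Between a b l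
  · rw [homCoeff_of_between h, homCoeff_of_between h]
    rfl
  · rw [homCoeff_eq_zero_left h, homCoeff_eq_zero_left h, mul_zero]

theorem homCoeff_zero : homCoeff (0 : Q.intervalRep k a b ⟶ Q.intervalRep k c d) l = 0 := by
  simpa using homCoeff_smul (f := (0 : Q.intervalRep k a b ⟶ Q.intervalRep k c d)) (l := l) 0

theorem homCoeff_canonicalMap (h : Q.Compatible a b c d) (h1 : Between a b l)
    (h2 : Between c d l) : homCoeff (Q.canonicalMap k h) l = 1 :=
  (homCoeff_of_between h1).trans (lineMap_of k h2 (lineOne k h1))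

theorem homCoeff_eq_of_isArrow (f : Q.intervalRep k a b ⟶ Q.intervalRep k c d)
    (hst : Q.IsArrow s t) (hs : Between a b s) (ht : Between c d t) :
    homCoeff f s = homCoeff f t := by
  have h := fiberMap_arrowMap f hst (lineOne k hs)
  rw [arrowMap_intervalRep, arrowMap_intervalRep] at h
  have h' : (component f t (lineMap k (Between a b s) (Between a b t) (lineOne k hs)) : k) =
      lineMap k (Between c d s) (Between c d t) (component f s (lineOne k hs)) :=
    congrArg Subtype.val h
  rw [lineMap_of k ht, ← homCoeff_of_between hs, component_apply] at h'
  rw [← h']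
  by_cases hta : Between a b t
  · rw [lineMap_of k hta]
    exact mul_one _
  · rw [homCoeff_eq_zero_left hta, zero_mul]

theorem homCoeff_eq_of_between (f : Q.intervalRep k a b ⟶ Q.intervalRep k c d)
    (h1 : Between a b s) (h2 : Between c d s) (h3 : Between a b t) (h4 : Between c d t) :
    homCoeff f s = homCoeff f t := by
  wlog hst : label s ≤ label t generalizing s t
  · exact (this h3 h4 h1 h2 (by omega)).symm
  obtain ⟨m, hm⟩ := Nat.exists_eq_add_of_le hst
  induction m generalizing t with
  | zero => rw [label_injective (by omega : label s = label t)]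
  | succ m ih =>
    have hs := label_pos s
    have ht := label_le t
    unfold Between at h1 h2 h3 h4
    obtain ⟨t', ht'⟩ := exists_label_eq (Q := Q) (m := label s + m) (by omega) (by omega)
    have h3' : Between a b t' := by unfold Between; omega
    have h4' : Between c d t' := by unfold Between; omega
    rw [ih h3' h4' (by omega) ht']
    rcases isArrow_or_isArrow (s := t') (t := t) (by omega) with h | h
    · exact homCoeff_eq_of_isArrow f h h3' h4
    · exact (homCoeff_eq_of_isArrow f h h3 h4').symm

theorem homCoeff_ne_zero_iff (hf : f ≠ 0) :
    homCoeff f l ≠ 0 ↔ Between a b l ∧ Between c d l := by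
  refine ⟨fun h => ⟨by_contra fun h' => h (homCoeff_eq_zero_left h'),
    by_contra fun h' => h (homCoeff_eq_zero_right h')⟩, fun ⟨h1, h2⟩ h => hf ?_⟩
  refine homCoeff_ext fun m => ?_
  rw [homCoeff_zero]
  by_cases h3 : Between a b m
  · by_cases h4 : Between c d m
    · exact (homCoeff_eq_of_between f h3 h4 h1 h2).trans h
    · exact homCoeff_eq_zero_right h4
  · exact homCoeff_eq_zero_left h3

theorem exists_between_of_ne_zero (hf : f ≠ 0) : ∃ l : Q.Vertex, Between a b l ∧ Between c d l := by
  by_contra! h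
  refine hf (homCoeff_ext fun l => ?_)
  by_contra hl
  rw [homCoeff_zero] at hl
  exact h l ((homCoeff_ne_zero_iff hf).1 hl).1 ((homCoeff_ne_zero_iff hf).1 hl).2

theorem compatible_of_ne_zero (hf : f ≠ 0) : Q.Compatible a b c d := by
  intro s t hst hs ht
  have h : homCoeff f s ≠ 0 ↔ homCoeff f t ≠ 0 := by rw [homCoeff_eq_of_isArrow f hst hs ht]
  rw [homCoeff_ne_zero_iff hf, homCoeff_ne_zero_iff hf] at h
  tauto

theorem eq_smul_canonicalMap (h : Q.Compatible a b c d)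
    (f : Q.intervalRep k a b ⟶ Q.intervalRep k c d) : ∃ r : k, f = r • Q.canonicalMap k h := by
  by_cases hf : f = 0
  · exact ⟨0, by rw [hf, zero_smul]⟩
  obtain ⟨s, h1, h2⟩ := exists_between_of_ne_zero hf
  refine ⟨homCoeff f s, homCoeff_ext fun l => ?_⟩
  rw [homCoeff_smul]
  by_cases h3 : Between a b l
  · by_cases h4 : Between c d l
    · rw [homCoeff_canonicalMap h h3 h4, mul_one, homCoeff_eq_of_between f h1 h2 h3 h4]
    · rw [homCoeff_eq_zero_right h4, homCoeff_eq_zero_right h4, mul_zero]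
  · rw [homCoeff_eq_zero_left h3, homCoeff_eq_zero_left h3, mul_zero]

end Coeff

section SegmentMap

variable {n : ℕ} {Q : TypeA n} (k : Type u) [Field k] {i j i' j' i'' j'' : Fin (n + 3)}

/-- The canonical map `M(i + 1, j) ⟶ M(i' + 1, j')` between the representations given by two pairs
of points, the second of which comes after the first one. It may be zero. -/
def arcMap (hL : Q.leftPos i ≤ Q.leftPos i') (hR : Q.rightPos j ≤ Q.rightPos j') :
    Q.intervalRep k (i + 1) j ⟶ Q.intervalRep k (i' + 1) j' :=
  Q.canonicalMap k (compatible_of_pos hL hR)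

theorem lineMap_self {k : Type u} [Field k] {p : Prop} (x : line k p) : lineMap k p p x = x := by
  by_cases h : p
  · exact Subtype.ext (lineMap_of k h x)
  · exact (line_eq_zero k h _).trans (line_eq_zero k h x).symm

theorem arcMap_refl :
    arcMap k (Q := Q) (i := i) (j := j) le_rfl le_rfl = 𝟙 (Q.intervalRep k (i + 1) j) :=
  Q.rep_hom_ext k fun _ x => lineMap_self x

theorem arcMap_comp (hL : Q.leftPos i ≤ Q.leftPos i') (hR : Q.rightPos j ≤ Q.rightPos j')
    (hL' : Q.leftPos i' ≤ Q.leftPos i'') (hR' : Q.rightPos j' ≤ Q.rightPos j'') :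
    arcMap k hL hR ≫ arcMap k hL' hR' = arcMap k (hL.trans hL') (hR.trans hR') := by
  refine Q.rep_hom_ext k fun l v => ?_
  refine (Q.canonicalMap_comp_apply k _ _ l v).trans (lineMap_comp k _ ?_)
  rintro ⟨h1, h2⟩ ⟨h3, h4⟩
  have hi := le_or_le_of_leftPos hL hL'
  have hj := le_or_le_of_rightPos hR hR'
  exact ⟨by omega, by omega⟩

variable {γ δ ε : Q.Segment}

/-- The canonical map `M_γ ⟶ M_δ` for `δ` in the hammock that starts at `γ`. -/
abbrev segmentMap (h : InHammock γ δ) : Q.segmentRep k γ ⟶ Q.segmentRep k δ :=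
  arcMap k h.leftPos_le h.rightPos_le

theorem segmentMap_refl : segmentMap k (InHammock.refl γ) = 𝟙 (Q.segmentRep k γ) := arcMap_refl k

theorem segmentMap_comp (h : InHammock γ δ) (h' : InHammock δ ε) (h'' : InHammock γ ε) :
    segmentMap k h ≫ segmentMap k h' = segmentMap k h'' := arcMap_comp k _ _ _ _

theorem segmentMap_ne_zero (h : InHammock γ δ) : segmentMap k h ≠ 0 := by
  have hγ := γ.i_lt_j
  have hδ := δ.i_lt_j
  have h1 := h.i_lt_j
  have h2 := h.i_lt_j'
  have hj := γ.j.isLt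
  rw [Fin.lt_def] at hγ hδ h1 h2
  obtain ⟨s, hs⟩ := exists_label_eq (Q := Q) (m := max (γ.i : ℕ) δ.i + 1) (by omega) (by omega)
  have hone : homCoeff (segmentMap k h) s = 1 :=
    homCoeff_canonicalMap (compatible_of_pos h.leftPos_le h.rightPos_le)
      (by unfold Between; omega) (by unfold Between; omega)
  intro h0
  rw [h0] at hone
  exact zero_ne_one (homCoeff_zero.symm.trans hone)

variable {k}

theorem eq_smul_segmentMap (h : InHammock γ δ) (f : Q.segmentRep k γ ⟶ Q.segmentRep k δ) :
    ∃ r : k, f = r • segmentMap k h :=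
  eq_smul_canonicalMap (compatible_of_pos h.leftPos_le h.rightPos_le) f

theorem inHammock_of_ne_zero {f : Q.segmentRep k γ ⟶ Q.segmentRep k δ} (hf : f ≠ 0) :
    InHammock γ δ := by
  have hc : Q.Compatible (γ.i + 1) γ.j (δ.i + 1) δ.j := compatible_of_ne_zero hf
  obtain ⟨l, hγ, hδ⟩ := exists_between_of_ne_zero hf
  unfold Between at hγ hδ
  have h1 : γ.i < δ.j := Fin.lt_def.2 (by omega)
  have h2 : δ.i < γ.j := Fin.lt_def.2 (by omega)
  exact ⟨hc.leftPos_le γ.i_lt_j δ.i_lt_j h1 h2, hc.rightPos_le γ.i_lt_j δ.i_lt_j h1 h2, h1, h2⟩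

theorem segmentRep_end (f : Q.segmentRep k γ ⟶ Q.segmentRep k γ) : ∃ r : k, f = r • 𝟙 _ := by
  rw [← segmentMap_refl]
  exact eq_smul_segmentMap _ f

theorem exists_smul_eq_id {f : Q.segmentRep k γ ⟶ Q.segmentRep k γ} (hf : f ≠ 0) :
    ∃ r : k, r • f = 𝟙 _ := by
  obtain ⟨r, rfl⟩ := segmentRep_end f
  have hr : r ≠ 0 := by
    rintro rfl
    exact hf (zero_smul k _)
  exact ⟨r⁻¹, by rw [smul_smul, inv_mul_cancel₀ hr, one_smul]⟩

theorem segmentRep_id_ne_zero : 𝟙 (Q.segmentRep k γ) ≠ 0 := by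
  rw [← segmentMap_refl]
  exact segmentMap_ne_zero k _

theorem comp_eq_zero_of_ne (hne : γ ≠ δ) (f : Q.segmentRep k γ ⟶ Q.segmentRep k δ)
    (g : Q.segmentRep k δ ⟶ Q.segmentRep k γ) : f ≫ g = 0 := by
  by_cases hf : f = 0
  · rw [hf, zero_comp]
  by_cases hg : g = 0
  · rw [hg, comp_zero]
  exact (hne ((inHammock_of_ne_zero hf).antisymm (inHammock_of_ne_zero hg))).elim

theorem eq_of_comp_ne_zero {f : Q.segmentRep k γ ⟶ Q.segmentRep k δ}
    {g : Q.segmentRep k δ ⟶ Q.segmentRep k γ} (h : f ≫ g ≠ 0) : γ = δ :=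
  by_contra fun hne => h (comp_eq_zero_of_ne hne f g)

theorem eq_of_iso (e : Q.segmentRep k γ ≅ Q.segmentRep k δ) : γ = δ :=
  eq_of_comp_ne_zero (f := e.hom) (g := e.inv) (by rw [e.hom_inv_id]; exact segmentRep_id_ne_zero)

end SegmentMap

end TypeA

/-! ### Decomposition of representations -/

namespace TypeA

instance {n : ℕ} (Q : TypeA n) : Fintype Q.Vertex := inferInstanceAs (Fintype (Fin (n + 2)))

section Zigzag

variable {n : ℕ} {Q : TypeA n} {X : Q.Vertex → Type w}

/-- A family is a zigzag between the vertices `a` and `b` if its members at the ends of each arrow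
between these vertices are in the given relation. -/
def IsZigzag (r : ∀ s t, Q.IsArrow s t → X s → X t → Prop) (a b : ℕ) (x : ∀ l, X l) : Prop :=
  ∀ s t (h : Q.IsArrow s t), Between a b s → Between a b t → r s t h (x s) (x t)

variable {r : ∀ s t, Q.IsArrow s t → X s → X t → Prop} {a b c : ℕ} {x : ∀ l, X l}

theorem isZigzag_self : IsZigzag r a a x := by
  intro s t h hs ht
  unfold Between at hs ht
  have := h.label_eq_or
  omega

theorem IsZigzag.mono (hx : IsZigzag r a c x) (hbc : b ≤ c) : IsZigzag r a b x :=
  fun s t h hs ht => hx s t h ⟨hs.1, hs.2.trans hbc⟩ ⟨ht.1, ht.2.trans hbc⟩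

open Classical in
theorem IsZigzag.update {v v' : Q.Vertex} (hx : IsZigzag r a (label v) x)
    (hv : label v' = label v + 1) {z : X v'} (h1 : ∀ h : Q.IsArrow v v', r v v' h (x v) z)
    (h2 : ∀ h : Q.IsArrow v' v, r v' v h z (x v)) :
    IsZigzag r a (label v') (Function.update x v' z) := by
  have eq_of_label : ∀ {s : Q.Vertex}, label s + 1 = label v' → s = v := fun e =>
    label_injective (by omega)
  have hne : v ≠ v' := by rintro rfl; omega
  have between : ∀ {s : Q.Vertex}, s ≠ v' → Between a (label v') s → Between a (label v) s := by
    intro s hs h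
    have : label s ≠ label v' := fun e => hs (label_injective e)
    unfold Between at h ⊢
    omega
  intro s t h hs ht
  have hst := h.label_eq_or
  by_cases es : s = v'
  · subst es
    obtain rfl := eq_of_label (s := t) (by unfold Between at ht; omega)
    rw [Function.update_self, Function.update_of_ne hne]
    exact h2 h
  by_cases et : t = v'
  · subst et
    obtain rfl := eq_of_label (s := s) (by unfold Between at hs; omega)
    rw [Function.update_self, Function.update_of_ne hne]
    exact h1 h
  rw [Function.update_of_ne es, Function.update_of_ne et]
  exact hx s t h (between es hs) (between et ht)

end Zigzag

section Transport

variable {n : ℕ} {Q : TypeA n} {k : Type u} [Field k]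

/-- A family of vectors that is compatible with the arrows between the vertices `a` and `b`. -/
abbrev IsVectorFamily (M : Q.Rep k) (a b : ℕ) (x : ∀ l, fiber M l) : Prop :=
  IsZigzag (fun _ _ h y z => arrowMap M h y = z) a b x

/-- A family of linear forms that is compatible with the arrows between the vertices `a` and
`b`. -/
abbrev IsFormFamily (M : Q.Rep k) (a b : ℕ) (φ : ∀ l, Module.Dual k (fiber M l)) : Prop :=
  IsZigzag (X := fun l => Module.Dual k (fiber M l)) (fun _ _ h φ ψ => ψ ∘ₗ arrowMap M h = φ) a b φ

/-- The vector `x` at the vertex `v` can be moved along the arrows into the subspace `U` at the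
vertex `v'`, where moving against an arrow means to choose a preimage. -/
def Transports (M : Q.Rep k) {v v' : Q.Vertex} (x : fiber M v) (U : Submodule k (fiber M v')) :
    Prop :=
  ∃ y, IsVectorFamily M (label v) (label v') y ∧ y v = x ∧ y v' ∈ U

variable {M : Q.Rep k} {v v₁ v₂ : Q.Vertex} {x : fiber M v}

open Classical in
theorem transports_self {U : Submodule k (fiber M v)} : Transports M x U ↔ x ∈ U :=
  ⟨fun ⟨_, _, hy, hU⟩ => hy ▸ hU, fun h =>
    ⟨Pi.single v x, isZigzag_self, Pi.single_eq_same _ _, by rwa [Pi.single_eq_same]⟩⟩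

open Classical in
theorem transports_iff_comap (h : Q.IsArrow v₁ v₂) (hv : label v₂ = label v₁ + 1)
    (hle : label v ≤ label v₁) {U : Submodule k (fiber M v₂)} :
    Transports M x U ↔ Transports M x (U.comap (arrowMap M h)) := by
  constructor
  · rintro ⟨y, hy, hx, hU⟩
    refine ⟨y, hy.mono (by omega), hx, Submodule.mem_comap.2 ?_⟩
    rwa [hy v₁ v₂ h ⟨hle, by omega⟩ ⟨by omega, le_rfl⟩]
  · rintro ⟨y, hy, hx, hU⟩
    have hne : v ≠ v₂ := by rintro rfl; omega
    refine ⟨Function.update y v₂ (arrowMap M h (y v₁)),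
      hy.update hv (fun _ => rfl) fun h' => (h.asymm h').elim, ?_, ?_⟩
    · rwa [Function.update_of_ne hne]
    · rwa [Function.update_self]

open Classical in
theorem transports_iff_map (h : Q.IsArrow v₂ v₁) (hv : label v₂ = label v₁ + 1)
    (hle : label v ≤ label v₁) {U : Submodule k (fiber M v₂)} :
    Transports M x U ↔ Transports M x (U.map (arrowMap M h)) := by
  constructor
  · rintro ⟨y, hy, hx, hU⟩
    exact ⟨y, hy.mono (by omega), hx, y v₂, hU, hy v₂ v₁ h ⟨by omega, le_rfl⟩ ⟨hle, by omega⟩⟩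
  · rintro ⟨y, hy, hx, z, hz, hzy⟩
    have hne : v ≠ v₂ := by rintro rfl; omega
    refine ⟨Function.update y v₂ z,
      hy.update hv (fun h' => (h.asymm h').elim) fun _ => hzy, ?_, ?_⟩
    · rwa [Function.update_of_ne hne]
    · rwa [Function.update_self]

theorem exists_dual_comp_eq {V W : Type*} [AddCommGroup V] [Module k V] [AddCommGroup W]
    [Module k W] (f : V →ₗ[k] W) (U : Submodule k W) (φ : Module.Dual k V)
    (hφ : U.comap f ≤ LinearMap.ker φ) :
    ∃ ψ : Module.Dual k W, ψ ∘ₗ f = φ ∧ U ≤ LinearMap.ker ψ := by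
  have hmem : φ ∈ LinearMap.range (U.mkQ ∘ₗ f).dualMap := by
    rw [LinearMap.range_dualMap_eq_dualAnnihilator_ker, Submodule.mem_dualAnnihilator]
    refine fun z hz => hφ ?_
    rwa [LinearMap.ker_comp, Submodule.ker_mkQ] at hz
  obtain ⟨ψ, rfl⟩ := hmem
  refine ⟨ψ ∘ₗ U.mkQ, rfl, fun z hz => ?_⟩
  rw [LinearMap.mem_ker, LinearMap.comp_apply, Submodule.mkQ_apply,
    (Submodule.Quotient.mk_eq_zero U).2 hz, map_zero]

open Classical in
theorem exists_isFormFamily (hle : label v ≤ label v₁) {U : Submodule k (fiber M v₁)}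
    (hx : ¬ Transports M x U) :
    ∃ φ, IsFormFamily M (label v) (label v₁) φ ∧ φ v x ≠ 0 ∧ U ≤ LinearMap.ker (φ v₁) := by
  obtain ⟨m, hm⟩ := Nat.exists_eq_add_of_le hle
  clear hle
  induction m generalizing v₁ with
  | zero =>
    obtain rfl : v₁ = v := label_injective hm
    obtain ⟨f, hf, hU⟩ := Submodule.exists_le_ker_of_notMem (mt transports_self.2 hx)
    refine ⟨Function.update 0 v₁ f, isZigzag_self, ?_, ?_⟩
    · rwa [Function.update_self]
    · rwa [Function.update_self]
  | succ m ih =>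
    obtain ⟨v₀, hv₀⟩ := exists_label_eq (Q := Q) (m := label v + m)
      (by have := label_pos v; omega) (by have := label_le v₁; omega)
    have hv : label v₁ = label v₀ + 1 := by omega
    have hne : v ≠ v₁ := by rintro rfl; omega
    rcases isArrow_or_isArrow hv with h | h
    · rw [transports_iff_comap h hv (by omega)] at hx
      obtain ⟨φ, hφ, hφx, hφU⟩ := ih hx hv₀
      obtain ⟨ψ, hψ, hψU⟩ := exists_dual_comp_eq _ _ _ hφU
      refine ⟨Function.update φ v₁ ψ,
        hφ.update hv (fun _ => hψ) fun h' => (h.asymm h').elim, ?_, ?_⟩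
      · rwa [Function.update_of_ne hne]
      · rwa [Function.update_self]
    · rw [transports_iff_map h hv (by omega)] at hx
      obtain ⟨φ, hφ, hφx, hφU⟩ := ih hx hv₀
      refine ⟨Function.update φ v₁ (φ v₀ ∘ₗ arrowMap M h),
        hφ.update hv (fun h' => (h.asymm h').elim) fun _ => rfl, ?_, ?_⟩
      · rwa [Function.update_of_ne hne]
      · rw [Function.update_self, LinearMap.ker_comp]
        exact Submodule.map_le_iff_le_comap.1 hφU

-- Take for `v'` the last vertex such that some vector can be moved to `v'` but not to zero at `v'`.
theorem exists_transports_and_not (M : Q.Rep k) (v : Q.Vertex) [Nontrivial (fiber M v)] :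
    ∃ (v' : Q.Vertex) (x : fiber M v) (U W : Submodule k (fiber M v')), label v ≤ label v' ∧
      Transports M x W ∧ ¬ Transports M x U ∧
      (∀ t (h : Q.IsArrow v' t), label t = label v' + 1 → W ≤ LinearMap.ker (arrowMap M h)) ∧
      ∀ t (h : Q.IsArrow t v'), label t = label v' + 1 → LinearMap.range (arrowMap M h) ≤ U := by
  obtain ⟨v', ⟨hle, x, hx, hx'⟩, hmax⟩ := Set.exists_max_image {v' : Q.Vertex | label v ≤ label v' ∧
    ∃ x : fiber M v, Transports M x (⊤ : Submodule k (fiber M v')) ∧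
      ¬ Transports M x (⊥ : Submodule k (fiber M v'))} label (Set.toFinite _) (by
    obtain ⟨x, hx⟩ := exists_ne (0 : fiber M v)
    exact ⟨v, le_rfl, x, transports_self.2 trivial, mt transports_self.1 hx⟩)
  by_cases hlast : label v' = n + 2
  · refine ⟨v', x, ⊥, ⊤, hle, hx, hx', fun t _ e => ?_, fun t _ e => ?_⟩ <;>
    · have := label_le t
      omega
  obtain ⟨t, ht⟩ := exists_label_eq (Q := Q) (m := label v' + 1) (Nat.succ_pos _)
    (by have := label_le v'; omega)
  have hzero : Transports M x (⊤ : Submodule k (fiber M t)) →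
      Transports M x (⊥ : Submodule k (fiber M t)) := fun h => by
    by_contra h'
    have := hmax t ⟨by omega, x, h, h'⟩
    omega
  have eq_of_label : ∀ {t'}, label t' = label v' + 1 → t' = t := fun e =>
    label_injective (e.trans ht.symm)
  rcases isArrow_or_isArrow ht with h | h
  · rw [transports_iff_comap h ht hle, transports_iff_comap h ht hle] at hzero
    refine ⟨v', x, ⊥, _, hle, hzero hx, hx', fun t' h' e => ?_, fun t' h' e => ?_⟩
    · obtain rfl := eq_of_label e
      exact le_rfl
    · obtain rfl := eq_of_label e
      exact (h.asymm h').elim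
  · rw [transports_iff_map h ht hle, transports_iff_map h ht hle, Submodule.map_bot,
      Submodule.map_top] at hzero
    refine ⟨v', x, _, ⊤, hle, hx, fun h' => hx' (hzero h'), fun t' h' e => ?_, fun t' h' e => ?_⟩
    · obtain rfl := eq_of_label e
      exact (h.asymm h').elim
    · obtain rfl := eq_of_label e
      exact le_rfl

end Transport

section Retract

variable {n : ℕ} {Q : TypeA n} {k : Type u} [Field k] (M : Q.Rep k) {a b : ℕ}

/-- The morphism from an interval representation given by a compatible family of vectors that are
sent to zero by the arrows out of the interval. -/
def homOfVectors (x : ∀ l, fiber M l) (hx : IsVectorFamily M a b x)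
    (h0 : ∀ s t (h : Q.IsArrow s t), Between a b s → ¬ Between a b t → arrowMap M h (x s) = 0) :
    Q.intervalRep k a b ⟶ M :=
  Paths.liftNatTrans (fun l => FGModuleCat.ofHom
      ((LinearMap.toSpanSingleton k (fiber M l) (x l)).comp (line k (Between a b l)).subtype))
    (by
      intro s t α
      rw [show (Q.intervalRep k a b).map α.toPath = _ from Paths.lift_toPath _ _]
      apply FGModuleCat.hom_ext
      apply LinearMap.ext
      intro (c : line k (Between a b s))
      change (lineMap k (Between a b s) (Between a b t) c : k) • x t =
        arrowMap M α.down ((c : k) • x s)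
      rw [map_smul]
      by_cases hs : Between a b s
      · by_cases ht : Between a b t
        · rw [hx s t α.down hs ht, lineMap_of k ht]
        · rw [h0 s t α.down hs ht, line_eq_zero k ht (lineMap k _ _ c), smul_zero]
          exact zero_smul k _
      · rw [line_eq_zero k hs c, map_zero]
        exact (zero_smul k _).trans (zero_smul k _).symm)

open Classical in
/-- The projection of `k` onto `k` or `0`. -/
def toLine (k : Type u) [Field k] (p : Prop) : k →ₗ[k] line k p :=
  if h : p then LinearMap.toSpanSingleton k _ (lineOne k h) else 0

theorem toLine_of {p : Prop} (h : p) (x : k) : (toLine k p x : k) = x := by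
  rw [toLine, dif_pos h]
  exact mul_one x

/-- The morphism to an interval representation given by a compatible family of linear forms that
vanish on the images of the arrows into the interval. -/
def homOfForms (φ : ∀ l, Module.Dual k (fiber M l)) (hφ : IsFormFamily M a b φ)
    (h0 : ∀ s t (h : Q.IsArrow s t), ¬ Between a b s → Between a b t → ∀ y,
      φ t (arrowMap M h y) = 0) : M ⟶ Q.intervalRep k a b :=
  Paths.liftNatTrans (fun l => FGModuleCat.ofHom ((toLine k (Between a b l)).comp (φ l)))
    (by
      intro s t α
      rw [show (Q.intervalRep k a b).map α.toPath = _ from Paths.lift_toPath _ _]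
      apply FGModuleCat.hom_ext
      apply LinearMap.ext
      intro (y : fiber M s)
      change toLine k (Between a b t) (φ t (arrowMap M α.down y)) =
        lineMap k (Between a b s) (Between a b t) (toLine k (Between a b s) (φ s y))
      by_cases ht : Between a b t
      · apply Subtype.ext
        rw [toLine_of ht, lineMap_of k ht]
        by_cases hs : Between a b s
        · rw [toLine_of hs, ← hφ s t α.down hs ht, LinearMap.comp_apply]
        · rw [h0 s t α.down hs ht, line_eq_zero k hs (toLine k _ _)]
          rfl
      · exact (line_eq_zero k ht _).trans (line_eq_zero k ht _).symm)

variable {M}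

theorem homCoeff_homOfVectors_comp_homOfForms {x : ∀ l, fiber M l} {hx : IsVectorFamily M a b x}
    {hx₀} {φ : ∀ l, Module.Dual k (fiber M l)} {hφ : IsFormFamily M a b φ} {hφ₀} {l : Q.Vertex}
    (hl : Between a b l) :
    homCoeff (homOfVectors M x hx hx₀ ≫ homOfForms M φ hφ hφ₀) l = φ l (x l) :=
  (homCoeff_of_between hl).trans ((toLine_of hl _).trans (congrArg (φ l) (one_smul k (x l))))

variable {γ : Q.Segment}

theorem exists_nontrivial_fiber (hM : ¬ IsZero M) : ∃ v, Nontrivial (fiber M v) := by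
  by_contra! hall
  refine hM ((Functor.isZero_iff M).2 fun v => ?_)
  rw [IsZero.iff_id_eq_zero]
  apply FGModuleCat.hom_ext
  exact LinearMap.ext fun y => (hall v).elim _ _

theorem exists_retract (hM : ¬ IsZero M) :
    ∃ (γ : Q.Segment) (f : Q.segmentRep k γ ⟶ M) (g : M ⟶ Q.segmentRep k γ), f ≫ g = 𝟙 _ := by
  obtain ⟨v, hv, hmin⟩ := Set.exists_min_image {v : Q.Vertex | Nontrivial (fiber M v)} label
    (Set.toFinite _) (exists_nontrivial_fiber hM)
  have hsub : ∀ t : Q.Vertex, label t < label v → Subsingleton (fiber M t) := fun t ht =>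
    not_nontrivial_iff_subsingleton.1 fun h => (hmin t h).not_gt ht
  have : Nontrivial (fiber M v) := hv
  obtain ⟨v', x, U, W, hle, ⟨y, hy, rfl, hyW⟩, hxU, hW, hU⟩ := exists_transports_and_not M v
  obtain ⟨φ, hφ, hφy, hφU⟩ := exists_isFormFamily hle hxU
  have hpos := label_pos v
  have hlast := label_le v'
  let γ : Q.Segment := ⟨(⟨label v - 1, by omega⟩, ⟨label v', by omega⟩),
    Fin.lt_def.2 (show label v - 1 < label v' by omega)⟩
  have hγ : (γ.i : ℕ) + 1 = label v := Nat.succ_pred_eq_of_pos hpos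
  have hγ' : (γ.j : ℕ) = label v' := rfl
  rw [← hγ] at hy hφ
  let f : Q.segmentRep k γ ⟶ M := homOfVectors M y hy fun s t h hs ht => by
    unfold Between at hs ht
    rcases h.label_eq_or with e | e
    · obtain rfl : s = v' := label_injective (by omega)
      exact hW t h e hyW
    · exact (hsub t (by omega)).elim _ _
  let g : M ⟶ Q.segmentRep k γ := homOfForms M φ hφ fun s t h hs ht z => by
    unfold Between at hs ht
    rcases h.label_eq_or with e | e
    · rw [(hsub s (by omega)).elim z 0, map_zero, map_zero]
    · obtain rfl : t = v' := label_injective (by omega)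
      exact hφU (hU s h e ⟨z, rfl⟩)
  have hfg : f ≫ g ≠ 0 := fun h0 => hφy <| by
    rw [← homCoeff_homOfVectors_comp_homOfForms (hx := hy) (hφ := hφ) ⟨hγ.le, hle⟩]
    exact (congrArg (homCoeff · v) h0).trans homCoeff_zero
  obtain ⟨r, hr⟩ := exists_smul_eq_id hfg
  exact ⟨γ, f, r • g, by rw [Linear.comp_smul, hr]⟩

theorem exists_iso_biprod (f : Q.segmentRep k γ ⟶ M) (g : M ⟶ Q.segmentRep k γ)
    (hfg : f ≫ g = 𝟙 _) : ∃ N : Q.Rep k, Nonempty (M ≅ Q.segmentRep k γ ⊞ N) := by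
  have : IsSplitMono f := ⟨⟨⟨g, hfg⟩⟩⟩
  exact ⟨_, ⟨(biprod.uniqueUpToIso _ _
    (isBilimitBinaryBiconeOfIsSplitMonoOfCokernel (cokernelIsCokernel f)))⟩⟩

theorem exists_iso_segmentRep (hM : Indecomposable M) :
    ∃ γ : Q.Segment, Nonempty (M ≅ Q.segmentRep k γ) := by
  obtain ⟨γ, f, g, hfg⟩ := exists_retract hM.1
  obtain ⟨N, ⟨e⟩⟩ := exists_iso_biprod f g hfg
  rcases hM.2 _ _ e with h | h
  · exact ((Q.segmentRep_indecomposable k γ).1 h).elim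
  · exact ⟨γ, ⟨e ≪≫ (isoBiprodZero h).symm⟩⟩

/-- The total dimension of a representation. -/
def totalDim (M : Q.Rep k) : ℕ := ∑ l, Module.finrank k (fiber M l)

theorem totalDim_lt_of_iso_biprod {N N' : Q.Rep k} (hN : ¬ IsZero N) (e : M ≅ N ⊞ N') :
    totalDim N' < totalDim M := by
  have hinj : ∀ l, Function.Injective (fiberMap (biprod.inr ≫ e.inv) l) := fun l =>
    Function.LeftInverse.injective (g := fiberMap (e.hom ≫ biprod.snd) l) fun x => by
      rw [← fiberMap_comp_apply, Category.assoc, e.inv_hom_id_assoc, biprod.inr_snd]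
      rfl
  refine Finset.sum_lt_sum
    (fun l _ => LinearMap.finrank_le_finrank_of_injective (hinj l)) ?_
  obtain ⟨v, hv⟩ := exists_nontrivial_fiber hN
  obtain ⟨x, hx⟩ := exists_ne (0 : fiber N v)
  refine ⟨v, Finset.mem_univ v, ?_⟩
  rw [← LinearMap.finrank_range_of_inj (hinj v)]
  refine Submodule.finrank_lt fun h => hx ?_
  obtain ⟨y, hy⟩ : fiberMap (biprod.inl ≫ e.inv) v x ∈ LinearMap.range
    (fiberMap (biprod.inr ≫ e.inv) v) := h ▸ Submodule.mem_top
  have := congrArg (fiberMap (e.hom ≫ biprod.fst) v) hy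
  rw [← fiberMap_comp_apply, ← fiberMap_comp_apply, Category.assoc, Category.assoc,
    e.inv_hom_id_assoc, biprod.inr_fst, biprod.inl_fst] at this
  exact this.symm

theorem rep_induction {P : Q.Rep k → Prop} (iso : ∀ {M N : Q.Rep k}, (M ≅ N) → P M → P N)
    (zero : ∀ M : Q.Rep k, IsZero M → P M)
    (summand : ∀ (γ : Q.Segment) (M : Q.Rep k), P M → P (Q.segmentRep k γ ⊞ M))
    (M : Q.Rep k) : P M := by
  induction hd : totalDim M using Nat.strong_induction_on generalizing M with
  | _ d ih =>
    by_cases hM : IsZero M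
    · exact zero M hM
    obtain ⟨γ, f, g, hfg⟩ := exists_retract hM
    obtain ⟨N, ⟨e⟩⟩ := exists_iso_biprod f g hfg
    exact iso e.symm (summand γ N (ih _
      (hd ▸ totalDim_lt_of_iso_biprod (Q.segmentRep_indecomposable k γ).1 e) N rfl))

theorem hom_induction {M N : Q.Rep k} {P : (M ⟶ N) → Prop} (zero : P 0)
    (add : ∀ f g, P f → P g → P (f + g))
    (comp : ∀ γ (p : M ⟶ Q.segmentRep k γ) (q : Q.segmentRep k γ ⟶ N), P (p ≫ q))
    (f : M ⟶ N) : P f := by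
  induction M using rep_induction with
  | iso e ih =>
    have := ih (P := fun f => P (e.inv ≫ f)) (by rwa [comp_zero])
      (fun f g hf hg => by rw [Preadditive.comp_add]; exact add _ _ hf hg)
      (fun γ p q => by rw [← Category.assoc]; exact comp _ _ _) (e.hom ≫ f)
    rwa [e.inv_hom_id_assoc] at this
  | zero M hM => rwa [hM.eq_of_src f 0]
  | summand γ M ih =>
    have := ih (P := fun f => P (biprod.snd ≫ f)) (by rwa [comp_zero])
      (fun f g hf hg => by rw [Preadditive.comp_add]; exact add _ _ hf hg)
      (fun γ p q => by rw [← Category.assoc]; exact comp _ _ _) (biprod.inr ≫ f)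
    rw [← Category.id_comp f, ← biprod.total, Preadditive.add_comp, Category.assoc,
      Category.assoc]
    exact add _ _ (comp _ _ _) this

end Retract

end TypeA

/-! ### The category of line segments -/

namespace TransQuiver

section

variable (k : Type u) [Field k] {V : Type w} [Quiver.{v} V] [Fintype V]
  [∀ x y : V, Fintype (x ⟶ y)] (τ : V → Option V)

/-- A path, as a morphism of the mesh category. -/
def meshPath {x y : V} (p : Quiver.Path x y) : meshObj k τ x ⟶ meshObj k τ y :=
  (CategoryTheory.Quotient.functor (meshRel k τ)).map
    (ofPath k (X := pathObj k x) (Y := pathObj k y) p)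

theorem meshPath_nil (x : V) : meshPath k τ (Quiver.Path.nil : Quiver.Path x x) = 𝟙 _ :=
  (CategoryTheory.Quotient.functor (meshRel k τ)).map_id (pathObj k x)

theorem meshPath_cons {x y z : V} (p : Quiver.Path x y) (α : y ⟶ z) :
    meshPath k τ (p.cons α) = meshPath k τ p ≫ meshArrow k τ α := by
  refine Eq.trans ?_ ((CategoryTheory.Quotient.functor (meshRel k τ)).map_comp _ _)
  exact congrArg (CategoryTheory.Quotient.functor (meshRel k τ)).map
    (ofPath_comp k (X := pathObj k x) (Y := pathObj k y) (Z := pathObj k z) p α.toPath).symm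

theorem mesh_induction {x y : V} {P : (meshObj k τ x ⟶ meshObj k τ y) → Prop}
    (f : meshObj k τ x ⟶ meshObj k τ y) (zero : P 0) (add : ∀ f g, P f → P g → P (f + g))
    (smul : ∀ (r : k) (p : Quiver.Path x y), P (r • meshPath k τ p)) : P f := by
  obtain ⟨f, rfl⟩ := (CategoryTheory.Quotient.functor (meshRel k τ)).map_surjective f
  refine pathCategory_induction k
    (P := fun f => P ((CategoryTheory.Quotient.functor (meshRel k τ)).map f)) f ?_ ?_ ?_
  · rwa [Functor.map_zero]
  · intro f g hf hg
    rw [Functor.map_add]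
    exact add _ _ hf hg
  · intro r p
    rw [Functor.map_smul]
    exact smul r p

theorem mesh_relation {x z : V} (h : τ x = some z) :
    ∑ y : V, ∑ β : z ⟶ y, ∑ α : y ⟶ x, meshArrow k τ β ≫ meshArrow k τ α = 0 := by
  have hmem : (CategoryTheory.Quotient.functor (meshRel k τ)).map (meshRelator k z x) = 0 := by
    rw [← (CategoryTheory.Quotient.functor (meshRel k τ)).map_zero]
    apply CategoryTheory.Quotient.sound
    refine Submodule.subset_span ⟨x, z, h, 𝟙 _, 𝟙 _, ?_⟩
    rw [Category.id_comp, Category.comp_id, sub_zero]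
  refine Eq.trans ?_ hmem
  simp only [meshRelator, Functor.map_sum, Functor.map_comp]
  rfl

end

end TransQuiver

namespace TypeA

open TransQuiver

section SegmentCategory

variable {n : ℕ} {Q : TypeA n} {k : Type u} [Field k] {γ δ δ₁ δ₂ ε : Q.Segment}

theorem pivot_comp_pivot_eq_neg (h : Q.rotation δ = some ε) (β₁ : ε ⟶ δ₁) (α₁ : δ₁ ⟶ δ)
    (β₂ : ε ⟶ δ₂) (α₂ : δ₂ ⟶ δ) (hne : δ₁ ≠ δ₂) :
    Q.pivot k β₁ ≫ Q.pivot k α₁ = -(Q.pivot k β₂ ≫ Q.pivot k α₂) := by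
  have hm := mesh_relation k Q.rotation h
  rw [Fintype.sum_eq_add δ₁ δ₂ hne fun y hy => Finset.sum_eq_zero fun β _ =>
      ((β₁.down.eq_or_eq_of_ne β₂.down hne β.down).elim hy.1 hy.2).elim,
    Fintype.sum_subsingleton _ β₁, Fintype.sum_subsingleton _ α₁,
    Fintype.sum_subsingleton _ β₂, Fintype.sum_subsingleton _ α₂] at hm
  exact eq_neg_of_add_eq_zero_left hm

theorem pivot_comp_pivot_eq_zero (h : Q.rotation δ = some ε) (β : ε ⟶ δ₁) (α : δ₁ ⟶ δ)
    (huniq : ∀ y, (ε ⟶ y) → y = δ₁) : Q.pivot k β ≫ Q.pivot k α = 0 := by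
  have hm := mesh_relation k Q.rotation h
  rwa [Fintype.sum_eq_single δ₁ fun y hy => Finset.sum_eq_zero fun β' _ =>
      (hy (huniq y β')).elim,
    Fintype.sum_subsingleton _ β, Fintype.sum_subsingleton _ α] at hm

theorem leftPos_le_of_path (p : Quiver.Path γ δ) : Q.leftPos γ.i ≤ Q.leftPos δ.i := by
  induction p with
  | nil => exact le_rfl
  | cons _ α ih => exact ih.trans α.down.leftPos_le

theorem rightPos_le_of_path (p : Quiver.Path γ δ) : Q.rightPos γ.j ≤ Q.rightPos δ.j := by
  induction p with
  | nil => exact le_rfl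
  | cons _ α ih => exact ih.trans α.down.rightPos_le

theorem not_isPivot_of_path (p : Quiver.Path γ δ) : ¬ Q.IsPivot δ γ := fun h =>
  h.height_lt.not_ge (add_le_add (leftPos_le_of_path p) (rightPos_le_of_path p))

theorem InHammock.of_path (h : InHammock γ δ) (p : Quiver.Path γ ε) (q : Quiver.Path ε δ) :
    InHammock γ ε :=
  h.of_between (leftPos_le_of_path p) (leftPos_le_of_path q) (rightPos_le_of_path p)
    (rightPos_le_of_path q)

-- If the last pivots of two paths differ, then the mesh ending at `δ` exchanges them.
theorem meshPath_eq_smul (h : InHammock γ δ) (p q : Quiver.Path γ δ) :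
    ∃ r : k, meshPath k Q.rotation p = r • meshPath k Q.rotation q := by
  induction δ using Segment.pivot_induction with
  | step δ ih =>
    cases p with
    | nil =>
      cases q with
      | nil => exact ⟨1, (one_smul k _).symm⟩
      | cons q β => exact (not_isPivot_of_path q β.down).elim
    | @cons δ₁ _ p α =>
      cases q with
      | nil => exact (not_isPivot_of_path p α.down).elim
      | @cons δ₂ _ q β =>
        have h₁ := h.of_path p α.toPath
        have h₂ := h.of_path q β.toPath
        rcases eq_or_ne δ₁ δ₂ with rfl | hne
        · obtain ⟨r, hr⟩ := ih _ α.down h₁ p q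
          exact ⟨r, by rw [meshPath_cons, meshPath_cons, hr, Subsingleton.elim α β,
            Linear.smul_comp]⟩
        · obtain ⟨ε, hε, hγε⟩ := h₁.exists_rotation_of_ne h₂ h α.down β.down hne
          obtain ⟨α'⟩ := (nonempty_hom_iff_of_rotation hε).1 ⟨α⟩
          obtain ⟨β'⟩ := (nonempty_hom_iff_of_rotation hε).1 ⟨β⟩
          obtain ⟨s⟩ := hγε.nonempty_path
          obtain ⟨r, hp⟩ := ih _ α.down h₁ p (s.cons α')
          obtain ⟨r', hq⟩ := ih _ β.down h₂ (s.cons β') q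
          refine ⟨-(r * r'), ?_⟩
          rw [meshPath_cons, hp, meshPath_cons, Linear.smul_comp, Category.assoc,
            pivot_comp_pivot_eq_neg hε α' α β' β hne, Preadditive.comp_neg, ← Category.assoc,
            ← meshPath_cons, hq, meshPath_cons, Linear.smul_comp, smul_neg, smul_smul, neg_smul]

theorem meshPath_eq_zero (hn : ¬ InHammock γ δ) (p : Quiver.Path γ δ) :
    meshPath k Q.rotation p = 0 := by
  induction δ using Segment.pivot_induction with
  | step δ ih =>
    cases p with
    | nil => exact (hn (.refl _)).elim
    | @cons δ₁ _ p α =>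
      rw [meshPath_cons]
      by_cases h₁ : InHammock γ δ₁
      · obtain ⟨ε, hε, hγε⟩ := h₁.exists_rotation_of_not α.down hn
        obtain ⟨β⟩ := (nonempty_hom_iff_of_rotation hε).1 ⟨α⟩
        obtain ⟨q⟩ := hγε.nonempty_path
        obtain ⟨r, hp⟩ := meshPath_eq_smul (k := k) h₁ p (q.cons β)
        rw [hp, meshPath_cons, Linear.smul_comp, Category.assoc]
        by_cases huniq : ∀ y, (ε ⟶ y) → y = δ₁
        · rw [pivot_comp_pivot_eq_zero hε β α huniq, comp_zero, smul_zero]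
        · push Not at huniq
          obtain ⟨δ₂, β', hne⟩ := huniq
          obtain ⟨α'⟩ := (nonempty_hom_iff_of_rotation hε).2 ⟨β'⟩
          have hn₂ : ¬ InHammock γ δ₂ := fun h₂ =>
            hn (h₁.of_pivots h₂ α.down α'.down hne.symm)
          rw [pivot_comp_pivot_eq_neg hε β α β' α' hne.symm, Preadditive.comp_neg,
            ← Category.assoc, ← meshPath_cons, ih _ α'.down hn₂, zero_comp, neg_zero, smul_zero]
      · rw [ih _ α.down h₁, zero_comp]

theorem eq_smul_meshPath (h : InHammock γ δ) (q : Quiver.Path γ δ)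
    (f : Q.seg k γ ⟶ Q.seg k δ) : ∃ r : k, f = r • meshPath k Q.rotation q := by
  refine mesh_induction k Q.rotation (P := fun f => ∃ r : k, f = r • meshPath k Q.rotation q) f
    ⟨0, (zero_smul k _).symm⟩ ?_ fun r p => ?_
  · rintro f g ⟨r, rfl⟩ ⟨s, rfl⟩
    exact ⟨r + s, (add_smul r s _).symm⟩
  · obtain ⟨s, hs⟩ := meshPath_eq_smul (k := k) h p q
    exact ⟨r * s, by rw [hs, smul_smul]⟩

theorem eq_zero_of_not_inHammock (h : ¬ InHammock γ δ) (f : Q.seg k γ ⟶ Q.seg k δ) : f = 0 := by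
  refine mesh_induction k Q.rotation (P := fun f => f = 0) f rfl ?_ fun r p => ?_
  · rintro f g rfl rfl
    exact add_zero 0
  · rw [meshPath_eq_zero h p, smul_zero]

/-- The map that `F` induces on the morphisms between two line segments. -/
def segmentHom (c : Q.PivotScalars k) (γ δ : Q.Segment) :
    (Q.seg k γ ⟶ Q.seg k δ) →ₗ[k] (Q.segmentRep k γ ⟶ Q.segmentRep k δ) where
  toFun f := ((segmentFunctor c).map f).hom
  map_add' f g := congrArg InducedCategory.Hom.hom ((segmentFunctor c).map_add (f := f) (g := g))
  map_smul' r f := congrArg InducedCategory.Hom.hom ((segmentFunctor c).map_smul r f)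

variable (c : Q.PivotScalars k)

theorem segmentHom_id : segmentHom c γ γ (𝟙 _) = 𝟙 _ :=
  congrArg (fun f => f.hom) ((segmentFunctor c).map_id (Q.seg k γ))

theorem segmentHom_comp (f : Q.seg k γ ⟶ Q.seg k δ) (g : Q.seg k δ ⟶ Q.seg k ε) :
    segmentHom c γ ε (f ≫ g) = segmentHom c γ δ f ≫ segmentHom c δ ε g :=
  congrArg (fun f => f.hom) ((segmentFunctor c).map_comp f g)

theorem segmentHom_pivot (p : γ ⟶ δ) :
    segmentHom c γ δ (Q.pivot k p) = (c.coeff p : k) • segmentMap k p.down.inHammock :=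
  segmentFunctor_map c p

theorem segmentHom_meshPath (h : InHammock γ δ) (p : Quiver.Path γ δ) : ∃ r : k, r ≠ 0 ∧
    segmentHom c γ δ (meshPath k Q.rotation p) = r • segmentMap k h := by
  induction p with
  | nil => exact ⟨1, one_ne_zero, by rw [meshPath_nil, segmentHom_id, segmentMap_refl, one_smul]⟩
  | cons p α ih =>
    obtain ⟨r, hr, hp⟩ := ih (h.of_path p α.toPath)
    refine ⟨r * c.coeff α, mul_ne_zero hr (c.coeff α).ne_zero, ?_⟩
    rw [meshPath_cons, segmentHom_comp, hp, segmentHom_pivot, Linear.smul_comp, Linear.comp_smul,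
      smul_smul, segmentMap_comp]

theorem segmentHom_injective : Function.Injective (segmentHom c γ δ) := by
  refine (injective_iff_map_eq_zero _).2 fun f hf => ?_
  by_cases h : InHammock γ δ
  · obtain ⟨q⟩ := h.nonempty_path
    obtain ⟨r, rfl⟩ := eq_smul_meshPath h q f
    obtain ⟨s, hs, hq⟩ := segmentHom_meshPath c h q
    rw [map_smul, hq, smul_smul, smul_eq_zero, or_iff_left (segmentMap_ne_zero k h), mul_eq_zero,
      or_iff_left hs] at hf
    rw [hf, zero_smul]
  · exact eq_zero_of_not_inHammock h f

theorem segmentHom_surjective : Function.Surjective (segmentHom c γ δ) := by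
  intro f
  by_cases hf : f = 0
  · exact ⟨0, by rw [map_zero, hf]⟩
  · have h := inHammock_of_ne_zero hf
    obtain ⟨q⟩ := h.nonempty_path
    obtain ⟨s, hs, hq⟩ := segmentHom_meshPath c h q
    obtain ⟨r, rfl⟩ := eq_smul_segmentMap h f
    refine ⟨(r * s⁻¹) • meshPath k Q.rotation q, ?_⟩
    rw [map_smul, hq, smul_smul, mul_assoc, inv_mul_cancel₀ hs, mul_one]

instance segmentFunctor_faithful : (segmentFunctor c).Faithful where
  map_injective {X Y} _ _ h :=
    segmentHom_injective c (γ := pathVertex k X.as) (δ := pathVertex k Y.as)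
      (congrArg (fun f => f.hom) h)

instance segmentFunctor_full : (segmentFunctor c).Full where
  map_surjective {X Y} f := by
    obtain ⟨g, hg⟩ := segmentHom_surjective c (γ := pathVertex k X.as)
      (δ := pathVertex k Y.as) f.hom
    exact ⟨g, ObjectProperty.hom_ext _ hg⟩

instance segmentFunctor_essSurj : (segmentFunctor c).EssSurj where
  mem_essImage M := by
    obtain ⟨γ, ⟨e⟩⟩ := exists_iso_segmentRep M.property
    exact ⟨Q.seg k γ, ⟨ObjectProperty.isoMk _ e.symm⟩⟩

instance segmentFunctor_isEquivalence : (segmentFunctor c).IsEquivalence where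

end SegmentCategory

end TypeA

/-! ### Irreducible morphisms and the radical -/

namespace AuslanderReiten

section

variable {C : Type w} [Category.{v} C] {X Y Z X' Y' : C}

theorem isSplitMono_of_comp (f : X ⟶ Y) (g : Y ⟶ Z) [IsSplitMono (f ≫ g)] : IsSplitMono f :=
  .mk' ⟨g ≫ retraction (f ≫ g), by rw [← Category.assoc, IsSplitMono.id]⟩

theorem isSplitEpi_of_comp (f : X ⟶ Y) (g : Y ⟶ Z) [IsSplitEpi (f ≫ g)] : IsSplitEpi g :=
  .mk' ⟨section_ (f ≫ g) ≫ f, by rw [Category.assoc, IsSplitEpi.id]⟩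

theorem IsIrreducible.conj {f : X ⟶ Y} (hf : IsIrreducible f) (e : X' ≅ X) (e' : Y ≅ Y') :
    IsIrreducible (e.hom ≫ f ≫ e'.hom) where
  not_section _ := by
    have : IsSplitMono (f ≫ e'.hom) := by
      rw [← e.inv_hom_id_assoc (f ≫ e'.hom)]
      infer_instance
    exact hf.not_section (isSplitMono_of_comp f e'.hom)
  not_retraction _ := by
    have : IsSplitEpi (e.hom ≫ f) := by
      rw [← Category.comp_id f, ← e'.hom_inv_id, ← Category.assoc f, ← Category.assoc e.hom]
      infer_instance
    exact hf.not_retraction (isSplitEpi_of_comp e.hom f)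
  factor Z g h hgh := by
    have hf' : (e.inv ≫ g) ≫ h ≫ e'.inv = f := by
      rw [Category.assoc, reassoc_of% hgh, e.inv_hom_id_assoc, e'.hom_inv_id, Category.comp_id]
    rcases hf.factor Z _ _ hf' with hg | hh
    · left
      rw [← e.hom_inv_id_assoc g]
      infer_instance
    · right
      rw [← Category.comp_id h, ← e'.inv_hom_id, ← Category.assoc]
      infer_instance

theorem IsIrreducible.ne_zero [HasZeroMorphisms C] {f : X ⟶ Y} (hf : IsIrreducible f) : f ≠ 0 := by
  rintro rfl
  obtain h | h := hf.factor Y 0 0 zero_comp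
  · exact hf.not_section h
  · have hY : 𝟙 Y = 0 := by rw [← IsSplitEpi.id (0 : Y ⟶ Y), comp_zero]
    exact hf.not_retraction (.mk' ⟨0, by rw [hY, comp_zero]⟩)

variable [Preadditive C]

theorem isIso_one_sub_comp_comm (f : X ⟶ Y) (g : Y ⟶ X) (h : IsIso (𝟙 X - f ≫ g)) :
    IsIso (𝟙 Y - g ≫ f) := by
  obtain ⟨r, hr, hr'⟩ := h
  have hfg : f ≫ g ≫ r = r - 𝟙 X := by
    rw [Preadditive.sub_comp, Category.id_comp, Category.assoc] at hr
    rw [← hr, sub_sub_cancel]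
  have hfg' : r ≫ f ≫ g = r - 𝟙 X := by
    rw [Preadditive.comp_sub, Category.comp_id] at hr'
    rw [← hr', sub_sub_cancel]
  -- the inverse is the geometric series `1 + g (1 + fg + …) f`
  refine ⟨𝟙 Y + g ≫ r ≫ f, ?_, ?_⟩
  · have h : g ≫ f ≫ g ≫ r ≫ f = g ≫ (r - 𝟙 X) ≫ f := by simp only [← hfg, Category.assoc]
    simp only [Preadditive.sub_comp, Preadditive.comp_sub, Preadditive.comp_add, Category.id_comp,
      Category.comp_id, Category.assoc, h]
    abel
  · have h : g ≫ r ≫ f ≫ g ≫ f = g ≫ (r - 𝟙 X) ≫ f := by simp only [← hfg', Category.assoc]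
    simp only [Preadditive.add_comp, Preadditive.sub_comp, Preadditive.comp_sub, Category.id_comp,
      Category.comp_id, Category.assoc, h]
    abel

variable (k : Type u) [Field k] [Linear k C]

theorem comp_mem_radical {f : X ⟶ Y} (hf : f ∈ radical k X Y) (g : Y ⟶ Z) :
    f ≫ g ∈ radical k X Z := by
  suffices h : radical k X Y ≤ (radical k X Z).comap (Linear.rightComp k X g) from h hf
  refine Submodule.span_le.2 fun f hf => Submodule.subset_span fun h => ?_
  have := hf (g ≫ h)
  rwa [← Category.assoc] at this

theorem comp_mem_radical' (f : X ⟶ Y) {g : Y ⟶ Z} (hg : g ∈ radical k Y Z) :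
    f ≫ g ∈ radical k X Z := by
  suffices h : radical k Y Z ≤ (radical k X Z).comap (Linear.leftComp k Z f) from h hg
  refine Submodule.span_le.2 fun g hg => Submodule.subset_span fun h => ?_
  have := hg (h ≫ f)
  have := isIso_one_sub_comp_comm _ _ ((Category.assoc g h f).symm ▸ this)
  rwa [← Category.assoc] at this

theorem conj_mem_radical (a : X' ⟶ X) (b : Y ⟶ Y') {f : X ⟶ Y} (hf : f ∈ radical k X Y) :
    a ≫ f ≫ b ∈ radical k X' Y' :=
  comp_mem_radical' k a (comp_mem_radical k hf b)

theorem conj_mem_radicalSq (a : X' ⟶ X) (b : Y ⟶ Y') {f : X ⟶ Y} (hf : f ∈ radicalSq k X Y) :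
    a ≫ f ≫ b ∈ radicalSq k X' Y' := by
  suffices h : radicalSq k X Y ≤
      (radicalSq k X' Y').comap ((Linear.leftComp k Y' a).comp (Linear.rightComp k X b)) from h hf
  refine Submodule.span_le.2 ?_
  rintro _ ⟨Z, f, g, hf, hg, rfl⟩
  refine Submodule.subset_span ⟨Z, a ≫ f, g ≫ b, comp_mem_radical' k a hf,
    comp_mem_radical k hg b, ?_⟩
  change a ≫ (f ≫ g) ≫ b = _
  simp only [Category.assoc]

/-- An isomorphism between Hom spaces given by isomorphisms of the objects restricts to the
radicals. -/
def radicalCongr (e : X ≅ X') (e' : Y ≅ Y') : radical k X Y ≃ₗ[k] radical k X' Y' :=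
  (Linear.homCongr k e e').ofSubmodules _ _ <| le_antisymm
    (Submodule.map_le_iff_le_comap.2 fun f hf => by
      change (e.inv ≫ f) ≫ e'.hom ∈ radical k X' Y'
      exact (Category.assoc e.inv f e'.hom).symm ▸ conj_mem_radical k e.inv e'.hom hf)
    fun f hf => ⟨e.hom ≫ f ≫ e'.inv, conj_mem_radical k _ _ hf,
      (Linear.homCongr k e e').apply_symm_apply f⟩

/-- The space `Irr` depends on its arguments only up to isomorphism. -/
def irrCongr (e : X ≅ X') (e' : Y ≅ Y') : Irr k X Y ≃ₗ[k] Irr k X' Y' :=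
  Submodule.Quotient.equiv _ _ (radicalCongr k e e') <| le_antisymm
    (Submodule.map_le_iff_le_comap.2 fun f hf => by
      change (e.inv ≫ f.1) ≫ e'.hom ∈ radicalSq k X' Y'
      exact (Category.assoc e.inv f.1 e'.hom).symm ▸ conj_mem_radicalSq k e.inv e'.hom hf)
    fun f hf => ⟨(radicalCongr k e e').symm f, conj_mem_radicalSq k e.hom e'.inv hf,
      (radicalCongr k e e').apply_symm_apply f⟩

variable {k} in
theorem mk_irr_eq_zero_iff {f : radical k X Y} :
    (Submodule.Quotient.mk f : Irr k X Y) = 0 ↔ f.1 ∈ radicalSq k X Y :=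
  Submodule.Quotient.mk_eq_zero _

/-- Multiplication by a nonzero scalar, as an automorphism. -/
def smulIso (X : C) {r : k} (hr : r ≠ 0) : X ≅ X where
  hom := r • 𝟙 X
  inv := r⁻¹ • 𝟙 X
  hom_inv_id := by simp [smul_smul, hr]
  inv_hom_id := by simp [smul_smul, hr]

end

end AuslanderReiten

namespace TypeA

open AuslanderReiten TransQuiver

section Radical

variable {n : ℕ} {Q : TypeA n} {k : Type u} [Field k] {γ δ : Q.Segment}

theorem comp_eq_zero_of_not_isSplitMono {M : Q.Rep k} {f : Q.segmentRep k γ ⟶ M}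
    (hf : ¬ IsSplitMono f) (g : M ⟶ Q.segmentRep k γ) : f ≫ g = 0 := by
  by_contra h
  obtain ⟨r, hr⟩ := exists_smul_eq_id h
  exact hf ⟨⟨⟨r • g, by rw [Linear.comp_smul, hr]⟩⟩⟩

theorem comp_eq_zero_of_not_isSplitEpi {M : Q.Rep k} {g : M ⟶ Q.segmentRep k γ}
    (hg : ¬ IsSplitEpi g) (f : Q.segmentRep k γ ⟶ M) : f ≫ g = 0 := by
  by_contra h
  obtain ⟨r, hr⟩ := exists_smul_eq_id h
  exact hg ⟨⟨⟨r • f, by rw [Linear.smul_comp, hr]⟩⟩⟩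

theorem mem_radical_of_not_isSplitMono {M : Q.Rep k} {f : Q.segmentRep k γ ⟶ M}
    (hf : ¬ IsSplitMono f) : f ∈ radical k (Q.segmentRep k γ) M := by
  refine Submodule.subset_span fun g => ?_
  rw [comp_eq_zero_of_not_isSplitMono hf, sub_zero]
  infer_instance

theorem mem_radical_of_not_isSplitEpi {M : Q.Rep k} {g : M ⟶ Q.segmentRep k γ}
    (hg : ¬ IsSplitEpi g) : g ∈ radical k M (Q.segmentRep k γ) := by
  refine Submodule.subset_span fun f => isIso_one_sub_comp_comm _ _ ?_
  rw [comp_eq_zero_of_not_isSplitEpi hg, sub_zero]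
  infer_instance

theorem not_isSplitMono_of_ne (hne : γ ≠ δ) (f : Q.segmentRep k γ ⟶ Q.segmentRep k δ) :
    ¬ IsSplitMono f := fun _ => by
  have h := IsSplitMono.id f
  rw [comp_eq_zero_of_ne hne] at h
  exact segmentRep_id_ne_zero h.symm

theorem not_isSplitEpi_of_ne (hne : γ ≠ δ) (f : Q.segmentRep k γ ⟶ Q.segmentRep k δ) :
    ¬ IsSplitEpi f := fun _ => by
  have h := IsSplitEpi.id f
  rw [comp_eq_zero_of_ne hne.symm] at h
  exact segmentRep_id_ne_zero h.symm

theorem mem_radical_of_ne (hne : γ ≠ δ) (f : Q.segmentRep k γ ⟶ Q.segmentRep k δ) :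
    f ∈ radical k (Q.segmentRep k γ) (Q.segmentRep k δ) :=
  mem_radical_of_not_isSplitMono (not_isSplitMono_of_ne hne f)

theorem radical_self : radical k (Q.segmentRep k γ) (Q.segmentRep k γ) = ⊥ := by
  refine le_bot_iff.1 (Submodule.span_le.2 fun f hf => ?_)
  by_contra hf0
  obtain ⟨r, hr⟩ := exists_smul_eq_id hf0
  have := hf (r • 𝟙 _)
  rw [Linear.comp_smul, Category.comp_id, hr, sub_self] at this
  have h := IsIso.hom_inv_id (0 : Q.segmentRep k γ ⟶ Q.segmentRep k γ)
  rw [zero_comp] at h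
  exact segmentRep_id_ne_zero h.symm

theorem ne_of_mem_radical {f : Q.segmentRep k γ ⟶ Q.segmentRep k δ}
    (hf : f ∈ radical k (Q.segmentRep k γ) (Q.segmentRep k δ)) (hf0 : f ≠ 0) : γ ≠ δ := by
  rintro rfl
  rw [radical_self] at hf
  exact hf0 ((Submodule.mem_bot k).1 hf)

theorem comp_eq_zero_of_mem_radical (p : γ ⟶ δ) {M : Q.Rep k} {f : Q.segmentRep k γ ⟶ M}
    {g : M ⟶ Q.segmentRep k δ} (hf : f ∈ radical k _ _) (hg : g ∈ radical k _ _) :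
    f ≫ g = 0 := by
  rw [← Category.id_comp g]
  induction 𝟙 M using hom_induction with
  | zero => rw [zero_comp, comp_zero]
  | add s t hs ht => rw [Preadditive.add_comp, Preadditive.comp_add, hs, ht, add_zero]
  | comp ε s t =>
    by_contra hne
    rw [Category.assoc, ← Category.assoc f] at hne
    have hfs : f ≫ s ≠ 0 := fun e => hne (by rw [e, zero_comp])
    have htg : t ≫ g ≠ 0 := fun e => hne (by rw [e, comp_zero])
    rcases p.down.eq_or_eq_of_inHammock (inHammock_of_ne_zero hfs) (inHammock_of_ne_zero htg)
      with e | e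
    · exact ne_of_mem_radical (comp_mem_radical k hf s) hfs e.symm
    · exact ne_of_mem_radical (comp_mem_radical' k t hg) htg e

theorem radicalSq_eq_bot (p : γ ⟶ δ) :
    radicalSq k (Q.segmentRep k γ) (Q.segmentRep k δ) = ⊥ := by
  refine le_bot_iff.1 (Submodule.span_le.2 ?_)
  rintro _ ⟨M, f, g, hf, hg, rfl⟩
  exact comp_eq_zero_of_mem_radical p hf hg

theorem exists_factorization (h : IsEmpty (γ ⟶ δ)) (hne : γ ≠ δ)
    {f : Q.segmentRep k γ ⟶ Q.segmentRep k δ} (hf : f ≠ 0) :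
    ∃ (ε : Q.Segment) (g : Q.segmentRep k γ ⟶ Q.segmentRep k ε)
      (g' : Q.segmentRep k ε ⟶ Q.segmentRep k δ), γ ≠ ε ∧ ε ≠ δ ∧ g ≫ g' = f := by
  have hγδ := inHammock_of_ne_zero hf
  obtain ⟨r, rfl⟩ := eq_smul_segmentMap hγδ f
  obtain ⟨ε, ⟨p⟩, hεδ⟩ := hγδ.exists_pivot_from hne
  refine ⟨ε, segmentMap k p.down.inHammock, r • segmentMap k hεδ, p.down.ne, ?_, ?_⟩
  · rintro rfl
    exact h.false p
  · rw [Linear.comp_smul, segmentMap_comp k p.down.inHammock hεδ hγδ]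

theorem radical_le_radicalSq (h : IsEmpty (γ ⟶ δ)) :
    radical k (Q.segmentRep k γ) (Q.segmentRep k δ) ≤ radicalSq k _ _ := by
  intro f hf
  by_cases hf0 : f = 0
  · exact hf0 ▸ Submodule.zero_mem _
  · obtain ⟨ε, g, g', hγε, hεδ, rfl⟩ := exists_factorization h (ne_of_mem_radical hf hf0) hf0
    exact Submodule.subset_span ⟨_, g, g', mem_radical_of_ne hγε g, mem_radical_of_ne hεδ g', rfl⟩

end Radical

section Irreducible

variable {n : ℕ} {Q : TypeA n} {k : Type u} [Field k] (c : Q.PivotScalars k) {γ δ : Q.Segment}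

theorem segmentHom_pivot_ne_zero (p : γ ⟶ δ) : segmentHom c γ δ (Q.pivot k p) ≠ 0 := by
  rw [segmentHom_pivot]
  exact smul_ne_zero (c.coeff p).ne_zero (segmentMap_ne_zero k _)

theorem eq_smul_segmentHom_pivot (p : γ ⟶ δ) (f : Q.segmentRep k γ ⟶ Q.segmentRep k δ) :
    ∃ r : k, f = r • segmentHom c γ δ (Q.pivot k p) := by
  obtain ⟨r, rfl⟩ := eq_smul_segmentMap p.down.inHammock f
  refine ⟨r * (c.coeff p : k)⁻¹, ?_⟩
  rw [segmentHom_pivot, smul_smul, mul_assoc, inv_mul_cancel₀ (c.coeff p).ne_zero, mul_one]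

/-- The class in `rad / rad²` of the morphism to which a pivot is sent. -/
def pivotClass (p : γ ⟶ δ) : Irr k (Q.segmentRep k γ) (Q.segmentRep k δ) :=
  Submodule.Quotient.mk ⟨segmentHom c γ δ (Q.pivot k p), mem_radical_of_ne p.down.ne _⟩

theorem pivotClass_ne_zero (p : γ ⟶ δ) : pivotClass c p ≠ 0 := by
  intro h
  have h' : segmentHom c γ δ (Q.pivot k p) ∈ radicalSq k _ _ := mk_irr_eq_zero_iff.1 h
  rw [radicalSq_eq_bot p] at h'
  exact segmentHom_pivot_ne_zero c p ((Submodule.mem_bot k).1 h')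

theorem linearIndependent_pivotClass :
    LinearIndependent k (pivotClass c : (γ ⟶ δ) → Irr k _ _) := by
  rcases isEmpty_or_nonempty (γ ⟶ δ) with h | ⟨⟨p⟩⟩
  · exact linearIndependent_empty_type
  · exact .of_subsingleton p (pivotClass_ne_zero c p)

theorem span_range_pivotClass :
    Submodule.span k (Set.range (pivotClass c : (γ ⟶ δ) → Irr k _ _)) = ⊤ := by
  refine eq_top_iff.2 fun x _ => ?_
  obtain ⟨⟨f, hf⟩, rfl⟩ := Submodule.Quotient.mk_surjective _ x
  rcases isEmpty_or_nonempty (γ ⟶ δ) with h | ⟨⟨p⟩⟩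
  · rw [mk_irr_eq_zero_iff.2 (radical_le_radicalSq h hf)]
    exact Submodule.zero_mem _
  · obtain ⟨r, rfl⟩ := eq_smul_segmentHom_pivot c p f
    exact Submodule.smul_mem _ r (Submodule.subset_span (Set.mem_range_self p))

/-- The classes of the pivots from `γ` to `δ`, as a basis of `rad / rad²`. -/
def pivotBasis (γ δ : Q.Segment) :
    Module.Basis (γ ⟶ δ) k (Irr k (Q.segmentRep k γ) (Q.segmentRep k δ)) :=
  .mk (linearIndependent_pivotClass c) (span_range_pivotClass c).ge

theorem pivotBasis_apply (p : γ ⟶ δ) : pivotBasis c γ δ p = pivotClass c p :=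
  Module.Basis.mk_apply _ _ p

theorem finrank_irr {M N : Q.Rep k} (e : M ≅ Q.segmentRep k γ) (e' : N ≅ Q.segmentRep k δ) :
    Module.finrank k (Irr k M N) = Fintype.card (γ ⟶ δ) := by
  rw [(irrCongr k e e').finrank_eq,
    Module.finrank_eq_card_basis (pivotBasis (Q.signScalars k) γ δ)]

theorem isIrreducible_segmentHom_pivot (p : γ ⟶ δ) :
    IsIrreducible (segmentHom c γ δ (Q.pivot k p)) where
  not_section := not_isSplitMono_of_ne p.down.ne _
  not_retraction := not_isSplitEpi_of_ne p.down.ne _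
  factor M f g hfg := by
    by_contra! h
    refine segmentHom_pivot_ne_zero c p ?_
    rw [← hfg]
    exact comp_eq_zero_of_mem_radical p (mem_radical_of_not_isSplitMono h.1)
      (mem_radical_of_not_isSplitEpi h.2)

theorem nonempty_pivot_of_isIrreducible {f : Q.segmentRep k γ ⟶ Q.segmentRep k δ}
    (hf : IsIrreducible f) : Nonempty (γ ⟶ δ) := by
  by_contra! h
  have hne : γ ≠ δ := by
    rintro rfl
    obtain ⟨r, hr⟩ := exists_smul_eq_id hf.ne_zero
    exact hf.not_section ⟨⟨⟨r • 𝟙 _, by rw [Linear.comp_smul, Category.comp_id, hr]⟩⟩⟩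
  obtain ⟨ε, g, g', hγε, hεδ, hgg'⟩ := exists_factorization h hne hf.ne_zero
  rcases hf.factor _ g g' hgg' with h | h
  · exact not_isSplitMono_of_ne hγε g h
  · exact not_isSplitEpi_of_ne hεδ g' h

theorem nonempty_arrow_iso_pivot {M N : Q.Rep k} {f : M ⟶ N} (e : M ≅ Q.segmentRep k γ)
    (e' : N ≅ Q.segmentRep k δ) (p : γ ⟶ δ) (hf : f ≠ 0) :
    Nonempty (Arrow.mk f ≅ Arrow.mk (segmentHom c γ δ (Q.pivot k p))) := by
  obtain ⟨r, hr⟩ := eq_smul_segmentHom_pivot c p (e.inv ≫ f ≫ e'.hom)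
  have hr0 : r ≠ 0 := by
    rintro rfl
    rw [zero_smul, Preadditive.IsIso.comp_left_eq_zero, Preadditive.IsIso.comp_right_eq_zero] at hr
    exact hf hr
  refine ⟨Arrow.isoMk (e ≪≫ smulIso k _ hr0) e' ?_⟩
  change (e.hom ≫ (r • 𝟙 _)) ≫ segmentHom c γ δ (Q.pivot k p) = f ≫ e'.hom
  rw [Category.assoc, Linear.smul_comp, Category.id_comp, ← hr, e.hom_inv_id_assoc]

theorem existsUnique_pivot {M N : Q.Rep k} (f : M ⟶ N) (hM : Indecomposable M)
    (hN : Indecomposable N) (hf : IsIrreducible f) :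
    ∃! p : (γ : Q.Segment) × (δ : Q.Segment) × (γ ⟶ δ),
      Nonempty (Arrow.mk f ≅ Arrow.mk (segmentHom c p.1 p.2.1 (Q.pivot k p.2.2))) := by
  obtain ⟨γ, ⟨e⟩⟩ := exists_iso_segmentRep hM
  obtain ⟨δ, ⟨e'⟩⟩ := exists_iso_segmentRep hN
  obtain ⟨p⟩ := nonempty_pivot_of_isIrreducible (hf.conj e.symm e')
  refine ⟨⟨γ, δ, p⟩, nonempty_arrow_iso_pivot c e e' p hf.ne_zero, ?_⟩
  rintro ⟨γ', δ', p'⟩ ⟨i⟩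
  obtain rfl : γ = γ' := eq_of_iso (e.symm ≪≫ Arrow.leftFunc.mapIso i)
  obtain rfl : δ = δ' := eq_of_iso (e'.symm ≪≫ Arrow.rightFunc.mapIso i)
  rw [Subsingleton.elim p' p]

end Irreducible

end TypeA

/-! ### Almost split sequences -/

section

variable {C : Type w} [Category.{v} C] [Preadditive C] {W X Y Z : C} [HasBinaryBiproduct X Y]

theorem biprod_lift_comp_eq_zero {f : W ⟶ X} {g : W ⟶ Y} (hf : ∀ u : X ⟶ Z, f ≫ u = 0)
    (hg : ∀ u : Y ⟶ Z, g ≫ u = 0) (r : X ⊞ Y ⟶ Z) : biprod.lift f g ≫ r = 0 := by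
  rw [biprod.lift_eq, Preadditive.add_comp, Category.assoc, Category.assoc, hf, hg, add_zero]

theorem comp_biprod_desc_eq_zero {f : X ⟶ Z} {g : Y ⟶ Z} (hf : ∀ u : W ⟶ X, u ≫ f = 0)
    (hg : ∀ u : W ⟶ Y, u ≫ g = 0) (s : W ⟶ X ⊞ Y) : s ≫ biprod.desc f g = 0 := by
  rw [biprod.desc_eq, Preadditive.comp_add, ← Category.assoc, ← Category.assoc, hf, hg, add_zero]

end

theorem mono_biprod_lift_neg {C : Type w} [Category.{v} C] [Preadditive C] {X₁ X₂ X₃ X₄ : C}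
    [HasBinaryBiproduct X₂ X₃] {f : X₁ ⟶ X₂} {g : X₁ ⟶ X₃} {f' : X₂ ⟶ X₄} {g' : X₃ ⟶ X₄}
    (h : IsPullback f g f' g') : Mono (biprod.lift f (-g)) :=
  Preadditive.mono_of_cancel_zero _ fun u hu => by
    have hf := hu =≫ biprod.fst
    have hg := hu =≫ biprod.snd
    rw [Category.assoc, biprod.lift_fst, zero_comp] at hf
    rw [Category.assoc, biprod.lift_snd, zero_comp, Preadditive.comp_neg, neg_eq_zero] at hg
    exact h.hom_ext (by rw [hf, zero_comp]) (by rw [hg, zero_comp])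

section

variable {C : Type w} [Category.{v} C] [Abelian C]

theorem shortExact_of_isPushout_of_isPullback {X₁ X₂ X₃ X₄ : C} {f : X₁ ⟶ X₂} {g : X₁ ⟶ X₃}
    {f' : X₂ ⟶ X₄} {g' : X₃ ⟶ X₄} (h : IsPushout f g f' g') (h' : IsPullback f g f' g') :
    h.shortComplex.ShortExact where
  exact := h.exact_shortComplex
  mono_f := mono_biprod_lift_neg h'
  epi_g := h.epi_shortComplex_g

theorem projective_of_isSplitEpi {P : C} (h : ∀ (U : C) (g : U ⟶ P), Epi g → IsSplitEpi g) :
    Projective P where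
  factors f e _ := by
    obtain ⟨⟨s, hs⟩⟩ := h _ (pullback.fst f e) inferInstance
    refine ⟨s ≫ pullback.snd f e, ?_⟩
    rw [Category.assoc, ← pullback.condition, ← Category.assoc, hs, Category.id_comp]

end

namespace AuslanderReiten

section

variable {C : Type w} [Category.{v} C] [Abelian C] {S S' : ShortComplex C} {M N M' N' : C}

theorem IsAlmostSplit.exists_lift (hS : IsAlmostSplit S) (hS' : IsAlmostSplit S')
    (e : S.X₃ ≅ S'.X₃) : ∃ φ : S.X₂ ⟶ S'.X₂, φ ≫ S'.g = S.g ≫ e.hom := by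
  refine hS'.right _ _ fun h => hS.not_retraction ?_
  rw [← Category.comp_id S.g, ← e.hom_inv_id, ← Category.assoc]
  infer_instance

/-- The two sequences map to each other over `e`, and if the composition at the left end term were
zero, then `S'` would split. -/
theorem IsAlmostSplit.exists_comp_ne_zero (hS : IsAlmostSplit S) (hS' : IsAlmostSplit S')
    (e : S.X₃ ≅ S'.X₃) : ∃ (α : S.X₁ ⟶ S'.X₁) (β : S'.X₁ ⟶ S.X₁), β ≫ α ≠ 0 := by
  have := hS.shortExact.mono_f
  have := hS'.shortExact.mono_f
  have := hS'.shortExact.epi_g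
  obtain ⟨φ, hφ⟩ := hS.exists_lift hS' e
  obtain ⟨ψ, hψ⟩ := hS'.exists_lift hS e.symm
  have hα : (S.f ≫ φ) ≫ S'.g = 0 := by rw [Category.assoc, hφ, S.zero_assoc, zero_comp]
  have hβ : (S'.f ≫ ψ) ≫ S.g = 0 := by rw [Category.assoc, hψ, S'.zero_assoc, zero_comp]
  refine ⟨hS'.shortExact.exact.lift _ hα, hS.shortExact.exact.lift _ hβ, fun h0 => ?_⟩
  have hψφ : S'.f ≫ ψ ≫ φ = 0 := by
    rw [← Category.assoc, ← hS.shortExact.exact.lift_f _ hβ, Category.assoc,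
      ← hS'.shortExact.exact.lift_f _ hα, ← Category.assoc, h0, zero_comp]
  refine hS'.not_retraction (.mk' ⟨hS'.shortExact.exact.desc _ hψφ, ?_⟩)
  rw [← cancel_epi S'.g, ← Category.assoc, ShortComplex.Exact.g_desc, Category.assoc, hφ,
    ← Category.assoc, hψ, Category.assoc, e.symm_hom, e.inv_hom_id]

theorem IsAlmostSplit.not_projective (hS : IsAlmostSplit S) : ¬ Projective S.X₃ := fun _ => by
  have := hS.shortExact.epi_g
  exact hS.not_retraction (.mk' ⟨Projective.factorThru (𝟙 _) S.g, Projective.factorThru_comp _ _⟩)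

theorem IsTranslate.of_iso (h : IsTranslate M N) (e : M ≅ M') (e' : N ≅ N') :
    IsTranslate M' N' := by
  obtain ⟨S, hS, ⟨i⟩, ⟨j⟩⟩ := h
  exact ⟨S, hS, ⟨i ≪≫ e⟩, ⟨j ≪≫ e'⟩⟩

theorem IsTranslate.not_projective (h : IsTranslate M N) : ¬ Projective M := fun hM => by
  obtain ⟨S, hS, ⟨e⟩, -⟩ := h
  exact hS.not_projective (.of_iso e.symm hM)

end

end AuslanderReiten

namespace TypeA

open AuslanderReiten

section Factorization

variable {n : ℕ} {Q : TypeA n} {k : Type u} [Field k] {X Y U : Q.Rep k} {f : X ⟶ Y}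

theorem exists_comp_eq_of_not_isSplitMono
    (hf : ∀ {ε : Q.Segment} (u : X ⟶ Q.segmentRep k ε), ¬ IsSplitMono u → ∃ v, f ≫ v = u)
    {u : X ⟶ U} (hu : ¬ IsSplitMono u) : ∃ v, f ≫ v = u := by
  rw [← Category.comp_id u]
  induction 𝟙 U using hom_induction with
  | zero => exact ⟨0, by rw [comp_zero, comp_zero]⟩
  | add s t hs ht =>
    obtain ⟨a, ha⟩ := hs
    obtain ⟨b, hb⟩ := ht
    exact ⟨a + b, by rw [Preadditive.comp_add, Preadditive.comp_add, ha, hb]⟩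
  | comp ε p q =>
    obtain ⟨v, hv⟩ := hf (u ≫ p) fun _ => hu (isSplitMono_of_comp u p)
    exact ⟨v ≫ q, by rw [← Category.assoc, hv, Category.assoc]⟩

theorem exists_comp_eq_of_not_isSplitEpi
    (hf : ∀ {ε : Q.Segment} (u : Q.segmentRep k ε ⟶ Y), ¬ IsSplitEpi u → ∃ v, v ≫ f = u)
    {u : U ⟶ Y} (hu : ¬ IsSplitEpi u) : ∃ v, v ≫ f = u := by
  rw [← Category.id_comp u]
  induction 𝟙 U using hom_induction with
  | zero => exact ⟨0, by rw [zero_comp, zero_comp]⟩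
  | add s t hs ht =>
    obtain ⟨a, ha⟩ := hs
    obtain ⟨b, hb⟩ := ht
    exact ⟨a + b, by rw [Preadditive.add_comp, Preadditive.add_comp, ha, hb]⟩
  | comp ε p q =>
    obtain ⟨v, hv⟩ := hf (q ≫ u) fun _ => hu (isSplitEpi_of_comp q u)
    exact ⟨p ≫ v, by rw [Category.assoc, hv, Category.assoc]⟩

end Factorization

section ArcSquare

variable {n : ℕ} {Q : TypeA n} {k : Type u} [Field k] {i j i' j' : Fin (n + 3)}

theorem isIso_arcMap_app (hL : Q.leftPos i ≤ Q.leftPos i') (hR : Q.rightPos j ≤ Q.rightPos j')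
    {l : Q.Vertex} (h : Between (i + 1) j l ↔ Between (i' + 1) j' l) :
    IsIso ((arcMap k hL hR).app l) := by
  refine ⟨FGModuleCat.ofHom (lineMap k _ _), ?_, ?_⟩ <;> apply FGModuleCat.hom_ext <;>
    refine LinearMap.ext fun x => ?_
  · exact (lineMap_comp k x fun hl _ => h.1 hl).trans (lineMap_self x)
  · exact (lineMap_comp k x fun hl _ => h.2 hl).trans (lineMap_self x)

theorem commSq_arcMap (hL : Q.leftPos i ≤ Q.leftPos i') (hR : Q.rightPos j ≤ Q.rightPos j') :
    CommSq (arcMap k hL (le_refl (Q.rightPos j))) (arcMap k (le_refl (Q.leftPos i)) hR)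
      (arcMap k (le_refl (Q.leftPos i')) hR) (arcMap k hL (le_refl (Q.rightPos j'))) :=
  ⟨(arcMap_comp k _ _ _ _).trans (arcMap_comp k _ _ _ _).symm⟩

variable (hL : Q.leftPos i ≤ Q.leftPos i') (hR : Q.rightPos j ≤ Q.rightPos j')
  (h : ∀ v : ℕ, ((i : ℕ) < v ↔ (i' : ℕ) < v) ∨ (v ≤ (j : ℕ) ↔ v ≤ (j' : ℕ)))

include h

theorem isIso_arcMap_app_or (l : Q.Vertex) :
    (IsIso ((arcMap k hL (le_refl (Q.rightPos j))).app l) ∧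
        IsIso ((arcMap k hL (le_refl (Q.rightPos j'))).app l)) ∨
      (IsIso ((arcMap k (le_refl (Q.leftPos i)) hR).app l) ∧
        IsIso ((arcMap k (le_refl (Q.leftPos i')) hR).app l)) := by
  refine (h (label l)).imp (fun h => ?_) fun h => ?_ <;>
    constructor <;> refine isIso_arcMap_app _ _ ?_ <;> unfold Between <;> omega

theorem isPushout_arcMap :
    IsPushout (arcMap k hL (le_refl (Q.rightPos j))) (arcMap k (le_refl (Q.leftPos i)) hR)
      (arcMap k (le_refl (Q.leftPos i')) hR) (arcMap k hL (le_refl (Q.rightPos j'))) := by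
  refine .of_forall_isPushout_app fun l => ?_
  have hsq := (commSq_arcMap (k := k) hL hR).map ((evaluation _ _).obj l)
  obtain ⟨_, _⟩ | ⟨_, _⟩ := isIso_arcMap_app_or (k := k) hL hR h l
  · exact .of_horiz_isIso hsq
  · exact .of_vert_isIso hsq

theorem isPullback_arcMap :
    IsPullback (arcMap k hL (le_refl (Q.rightPos j))) (arcMap k (le_refl (Q.leftPos i)) hR)
      (arcMap k (le_refl (Q.leftPos i')) hR) (arcMap k hL (le_refl (Q.rightPos j'))) := by
  refine .of_forall_isPullback_app fun l => ?_
  have hsq := (commSq_arcMap (k := k) hL hR).map ((evaluation _ _).obj l)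
  obtain ⟨_, _⟩ | ⟨_, _⟩ := isIso_arcMap_app_or (k := k) hL hR h l
  · exact .of_horiz_isIso hsq
  · exact .of_vert_isIso hsq

end ArcSquare

section MeshSequence

variable {n : ℕ} {Q : TypeA n} {γ δ ε : Q.Segment}

theorem leftPos_lt_of_rotation (h : Q.rotation γ = some δ) : Q.leftPos δ.i < Q.leftPos γ.i := by
  rw [← Q.R.symm_apply_apply γ.i, ← (Q.rotation_eq_some h).1]
  exact δ.leftPos_lt_R_symm

theorem rightPos_lt_of_rotation (h : Q.rotation γ = some δ) :
    Q.rightPos δ.j < Q.rightPos γ.j := by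
  rw [← Q.R.symm_apply_apply γ.j, ← (Q.rotation_eq_some h).2]
  exact δ.rightPos_lt_R_symm

theorem lt_iff_or_le_iff_of_rotation (h : Q.rotation γ = some δ) (v : ℕ) :
    ((δ.i : ℕ) < v ↔ (γ.i : ℕ) < v) ∨ (v ≤ (δ.j : ℕ) ↔ v ≤ (γ.j : ℕ)) := by
  obtain ⟨hi, hj⟩ := Q.rotation_eq_some h
  have hγ := γ.i_lt_j
  have hδ := δ.i_lt_j
  rw [hi, hj] at hδ ⊢
  by_contra hno
  rw [Fin.lt_def] at hγ hδ
  rcases Q.clockwiseNext_R γ.i with ⟨-, -, hi₃, hi₄⟩ | ⟨-, -, hi₃, hi₄⟩ <;>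
    rcases Q.clockwiseNext_R γ.j with ⟨hj₁, -, hj₃, -⟩ | ⟨-, hj₂, hj₃, -⟩ <;>
    rw [Fin.lt_def] at hi₃ hj₃
  · exact hi₄ γ.j hj₁ (by simp only [Fin.lt_def]; omega)
  · omega
  · omega
  · exact hi₄ (Q.R γ.j) hj₂ (by simp only [Fin.lt_def]; omega)

theorem IsPivot.middle_of_rotation (p : Q.IsPivot δ ε) (h : Q.rotation γ = some δ) :
    (ε.i = γ.i ∧ ε.j = δ.j) ∨ (ε.i = δ.i ∧ ε.j = γ.j) := by
  obtain ⟨hi, hj⟩ := Q.rotation_eq_some h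
  rcases p with ⟨pi, pj⟩ | ⟨pi, pj⟩
  · exact Or.inl ⟨by rw [pi, hi, Equiv.symm_apply_apply], pj⟩
  · exact Or.inr ⟨pi, by rw [pj, hj, Equiv.symm_apply_apply]⟩

variable {k : Type u} [Field k]

theorem eq_zero_or_of_not_isSplitEpi {u : Q.segmentRep k γ ⟶ Q.segmentRep k δ}
    (hu : ¬ IsSplitEpi u) : u = 0 ∨ InHammock γ δ ∧ γ ≠ δ := by
  refine or_iff_not_imp_left.2 fun h0 => ⟨inHammock_of_ne_zero h0, ?_⟩
  rintro rfl
  obtain ⟨r, hr⟩ := exists_smul_eq_id h0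
  exact hu (.mk' ⟨r • 𝟙 _, by rw [Linear.smul_comp, Category.id_comp, hr]⟩)

theorem eq_zero_or_of_not_isSplitMono {u : Q.segmentRep k γ ⟶ Q.segmentRep k δ}
    (hu : ¬ IsSplitMono u) : u = 0 ∨ InHammock γ δ ∧ γ ≠ δ := by
  refine or_iff_not_imp_left.2 fun h0 => ⟨inHammock_of_ne_zero h0, ?_⟩
  rintro rfl
  obtain ⟨r, hr⟩ := exists_smul_eq_id h0
  exact hu (.mk' ⟨r • 𝟙 _, by rw [Linear.comp_smul, Category.comp_id, hr]⟩)

theorem comp_intervalRep_eq_zero {i j : Fin (n + 3)} (hne : ¬ (γ.i = i ∧ γ.j = j))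
    (f : Q.segmentRep k γ ⟶ Q.intervalRep k (i + 1) j)
    (g : Q.intervalRep k (i + 1) j ⟶ Q.segmentRep k γ) : f ≫ g = 0 := by
  by_cases h : i < j
  · exact comp_eq_zero_of_ne (δ := ⟨(i, j), h⟩) (fun e => hne (by rw [e]; exact ⟨rfl, rfl⟩)) f g
  · suffices hf : f = 0 by rw [hf, zero_comp]
    by_contra hf
    obtain ⟨l, -, hl⟩ := exists_between_of_ne_zero (Q := Q) hf
    exact h (Fin.lt_def.2 (Nat.lt_of_succ_le (hl.1.trans hl.2)))

variable (k) (h : Q.rotation γ = some δ)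

/-- The short complex of a mesh, `M_δ ⟶ M(γ.i + 1, δ.j) ⊞ M(δ.i + 1, γ.j) ⟶ M_γ` with `δ = R γ`.
One of the two middle terms may be zero. -/
def meshSequence : ShortComplex (Q.Rep k) :=
  (commSq_arcMap (k := k) (leftPos_lt_of_rotation h).le (rightPos_lt_of_rotation h).le).shortComplex

theorem meshSequence_shortExact : (meshSequence k h).ShortExact :=
  have hv := lt_iff_or_le_iff_of_rotation h
  shortExact_of_isPushout_of_isPullback (isPushout_arcMap _ _ hv) (isPullback_arcMap _ _ hv)

theorem meshSequence_not_isSplitMono : ¬ IsSplitMono (meshSequence k h).f := by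
  rintro ⟨⟨r, hr⟩⟩
  refine segmentRep_id_ne_zero (k := k) (γ := δ) (hr.symm.trans ?_)
  refine biprod_lift_comp_eq_zero (comp_intervalRep_eq_zero (γ := δ) ?_ _)
    (comp_intervalRep_eq_zero (γ := δ) ?_ _) r
  · exact fun e => (leftPos_lt_of_rotation h).ne (congrArg _ e.1)
  · exact fun e => (rightPos_lt_of_rotation h).ne (congrArg _ e.2)

theorem meshSequence_not_isSplitEpi : ¬ IsSplitEpi (meshSequence k h).g := by
  rintro ⟨⟨s, hs⟩⟩
  refine segmentRep_id_ne_zero (k := k) (γ := γ) (hs.symm.trans ?_)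
  refine comp_biprod_desc_eq_zero (fun u => comp_intervalRep_eq_zero (γ := γ) ?_ u _)
    (fun u => comp_intervalRep_eq_zero (γ := γ) ?_ u _) s
  · exact fun e => (rightPos_lt_of_rotation h).ne' (congrArg _ e.2)
  · exact fun e => (leftPos_lt_of_rotation h).ne' (congrArg _ e.1)

theorem exists_comp_meshSequence_g (u : Q.segmentRep k ε ⟶ Q.segmentRep k γ)
    (hu : ¬ IsSplitEpi u) :
    ∃ v : Q.segmentRep k ε ⟶ (meshSequence k h).X₂, v ≫ (meshSequence k h).g = u := by
  obtain rfl | ⟨hε, hne⟩ := eq_zero_or_of_not_isSplitEpi hu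
  · exact ⟨0, zero_comp⟩
  obtain ⟨r, rfl⟩ := eq_smul_segmentMap hε u
  obtain ⟨ζ, ⟨p⟩, hζ⟩ := hε.exists_pivot_to hne
  have hL := hζ.leftPos_le
  have hR := hζ.rightPos_le
  rcases ((isPivot_iff_of_rotation h).1 p.down).middle_of_rotation h with ⟨hi, hj⟩ | ⟨hi, hj⟩ <;>
    rw [hi] at hL <;> rw [hj] at hR
  · refine ⟨r • (arcMap k hL hR ≫ biprod.inl), (Linear.smul_comp ..).trans (congrArg (r • ·) ?_)⟩
    exact (Category.assoc ..).trans (((arcMap k hL hR) ≫= biprod.inl_desc _ _).trans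
      (arcMap_comp k _ _ _ _))
  · refine ⟨r • (arcMap k hL hR ≫ biprod.inr), (Linear.smul_comp ..).trans (congrArg (r • ·) ?_)⟩
    exact (Category.assoc ..).trans (((arcMap k hL hR) ≫= biprod.inr_desc _ _).trans
      (arcMap_comp k _ _ _ _))

theorem exists_meshSequence_f_comp (u : Q.segmentRep k δ ⟶ Q.segmentRep k ε)
    (hu : ¬ IsSplitMono u) :
    ∃ v : (meshSequence k h).X₂ ⟶ Q.segmentRep k ε, (meshSequence k h).f ≫ v = u := by
  obtain rfl | ⟨hε, hne⟩ := eq_zero_or_of_not_isSplitMono hu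
  · exact ⟨0, comp_zero⟩
  obtain ⟨r, rfl⟩ := eq_smul_segmentMap hε u
  obtain ⟨ζ, ⟨p⟩, hζ⟩ := hε.exists_pivot_from hne
  have hL := hζ.leftPos_le
  have hR := hζ.rightPos_le
  rcases p.down.middle_of_rotation h with ⟨hi, hj⟩ | ⟨hi, hj⟩ <;>
    rw [hi] at hL <;> rw [hj] at hR
  · refine ⟨r • (biprod.fst ≫ arcMap k hL hR), (Linear.comp_smul ..).trans (congrArg (r • ·) ?_)⟩
    exact (Category.assoc ..).symm.trans ((biprod.lift_fst _ _ =≫ arcMap k hL hR).trans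
      (arcMap_comp k _ _ _ _))
  · refine ⟨r • (biprod.snd ≫ (-arcMap k hL hR)), (Linear.comp_smul ..).trans (congrArg (r • ·) ?_)⟩
    exact (Category.assoc ..).symm.trans ((biprod.lift_snd _ _ =≫ (-arcMap k hL hR)).trans
      ((Preadditive.neg_comp_neg ..).trans (arcMap_comp k _ _ _ _)))

theorem meshSequence_isAlmostSplit : IsAlmostSplit (meshSequence k h) where
  shortExact := meshSequence_shortExact k h
  indecomposable_left := Q.segmentRep_indecomposable k δ
  indecomposable_right := Q.segmentRep_indecomposable k γ
  not_section := meshSequence_not_isSplitMono k h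
  left _ _ hu := exists_comp_eq_of_not_isSplitMono (fun u => exists_meshSequence_f_comp k h u) hu
  not_retraction := meshSequence_not_isSplitEpi k h
  right _ _ hu := exists_comp_eq_of_not_isSplitEpi (fun u => exists_comp_meshSequence_g k h u) hu

variable {k}

theorem fiberMap_eq_zero_of_not_isSplitEpi {v : ℕ} {l : Q.Vertex} (hl : label l = v)
    (hv : ∀ ε : Q.Segment, Q.IsPivot ε γ → ¬ (ε.i < v ∧ v ≤ ε.j))
    (u : Q.segmentRep k ε ⟶ Q.segmentRep k γ) (hu : ¬ IsSplitEpi u) : fiberMap u l = 0 := by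
  obtain rfl | ⟨hε, hne⟩ := eq_zero_or_of_not_isSplitEpi hu
  · rfl
  obtain ⟨r, rfl⟩ := eq_smul_segmentMap hε u
  obtain ⟨ζ, ⟨p⟩, hζ⟩ := hε.exists_pivot_to hne
  have hlζ : ¬ Between (ζ.i + 1) ζ.j l := by
    have := hv ζ p.down
    unfold Between
    omega
  rw [← segmentMap_comp k hζ p.down.inHammock hε]
  refine LinearMap.ext fun x => ?_
  have hx : fiberMap (segmentMap k hζ) l x = 0 := line_eq_zero k hlζ _
  change r • fiberMap (segmentMap k p.down.inHammock) l (fiberMap (segmentMap k hζ) l x) = 0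
  rw [hx, map_zero, smul_zero]

theorem projective_of_rotation_eq_none (h : Q.rotation γ = none) :
    Projective (Q.segmentRep k γ) := by
  refine projective_of_isSplitEpi fun U u hu => ?_
  by_contra hns
  obtain ⟨v, hv, hvε⟩ := exists_mem_support_of_rotation_eq_none h
  obtain ⟨l, hl⟩ := exists_label_eq (Q := Q) (m := v) (by omega) (by have := γ.j.isLt; omega)
  have hlγ : Between (γ.i + 1) γ.j l := by unfold Between; omega
  have hzero : fiberMap u l = 0 := by
    rw [← Category.id_comp u]
    induction 𝟙 U using hom_induction with
    | zero => rw [zero_comp]; rfl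
    | add s t hs ht =>
      rw [Preadditive.add_comp]
      exact (congrArg₂ (· + ·) hs ht).trans (add_zero _)
    | comp ε p q =>
      refine LinearMap.ext fun x => ?_
      rw [Category.assoc, fiberMap_comp_apply, fiberMap_eq_zero_of_not_isSplitEpi hl hvε (q ≫ u)
        fun _ => hns (isSplitEpi_of_comp q u)]
      rfl
  have hepi : Epi (u.app l) := (NatTrans.epi_iff_epi_app u).1 hu l
  have hu0 : u.app l = 0 := FGModuleCat.hom_ext hzero
  have hid : 𝟙 ((Q.segmentRep k γ).obj l) = 0 :=
    hepi.left_cancellation _ _ (by rw [hu0, zero_comp, zero_comp])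
  have hone : lineOne k hlγ = 0 := congrArg (fun φ => φ.hom.hom (lineOne k hlγ)) hid
  exact one_ne_zero (congrArg Subtype.val hone)

theorem rotation_eq_none_iff : Q.rotation γ = none ↔ Projective (Q.segmentRep k γ) := by
  refine ⟨projective_of_rotation_eq_none, fun hp => ?_⟩
  by_contra hne
  obtain ⟨δ, hδ⟩ := Option.ne_none_iff_exists'.1 hne
  exact (meshSequence_isAlmostSplit k hδ).not_projective hp

theorem rotation_eq_some_iff :
    Q.rotation γ = some δ ↔ IsTranslate (Q.segmentRep k γ) (Q.segmentRep k δ) := by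
  refine ⟨fun h => ⟨_, meshSequence_isAlmostSplit k h, ⟨Iso.refl _⟩, ⟨Iso.refl _⟩⟩, ?_⟩
  rintro ⟨S, hS, ⟨e⟩, ⟨e'⟩⟩
  obtain ⟨δ', hδ'⟩ : ∃ δ', Q.rotation γ = some δ' :=
    Option.ne_none_iff_exists'.1 fun h =>
      hS.not_projective (.of_iso e.symm (projective_of_rotation_eq_none h))
  obtain ⟨α, β, hne⟩ := hS.exists_comp_ne_zero (meshSequence_isAlmostSplit k hδ') e
  have hne' : (β ≫ e'.hom) ≫ e'.inv ≫ α ≠ 0 := by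
    rwa [Category.assoc, e'.hom_inv_id_assoc]
  rw [hδ', eq_of_comp_ne_zero hne']

end MeshSequence

end TypeA

/-! ### The additive extension of a functor -/

section AdditiveExtension

variable {C : Type w} [Category.{v} C] [Preadditive C] {D : Type w'} [Category.{v'} D]
  [Preadditive D] [HasFiniteBiproducts D] (F : C ⥤ D) [F.Additive]

/-- The matrix entry of a morphism between values of the additive extension. -/
def additiveExtensionEntry {X Y : Mat_ C}
    (f : (additiveExtension F).obj X ⟶ (additiveExtension F).obj Y) (i : X.ι) (j : Y.ι) :
    F.obj (X.X i) ⟶ F.obj (Y.X j) :=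
  biproduct.ι (fun i => F.obj (X.X i)) i ≫ f ≫ biproduct.π (fun j => F.obj (Y.X j)) j

theorem additiveExtensionEntry_map {X Y : Mat_ C} (f : X ⟶ Y) (i : X.ι) (j : Y.ι) :
    additiveExtensionEntry F ((additiveExtension F).map f) i j = F.map (f i j) := by
  simp [additiveExtensionEntry, additiveExtension]

theorem additiveExtensionEntry_add {X Y : Mat_ C}
    (f g : (additiveExtension F).obj X ⟶ (additiveExtension F).obj Y) (i : X.ι) (j : Y.ι) :
    additiveExtensionEntry F (f + g) i j =
      additiveExtensionEntry F f i j + additiveExtensionEntry F g i j :=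
  (congrArg (biproduct.ι (fun i => F.obj (X.X i)) i ≫ ·) (Preadditive.add_comp ..)).trans
    (Preadditive.comp_add ..)

theorem additiveExtensionEntry_injective {X Y : Mat_ C}
    {f g : (additiveExtension F).obj X ⟶ (additiveExtension F).obj Y}
    (h : ∀ i j, additiveExtensionEntry F f i j = additiveExtensionEntry F g i j) : f = g :=
  biproduct.hom_ext' _ _ fun i => biproduct.hom_ext _ _ fun j =>
    (Category.assoc ..).trans ((h i j).trans (Category.assoc ..).symm)

instance additiveExtension_additive : (additiveExtension F).Additive where
  map_add {X Y f g} := additiveExtensionEntry_injective F fun i j => by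
    simp only [additiveExtensionEntry_add, additiveExtensionEntry_map]
    exact F.map_add

instance additiveExtension_faithful [F.Faithful] : (additiveExtension F).Faithful where
  map_injective {X Y f g} h := by
    funext i j
    apply F.map_injective
    rw [← additiveExtensionEntry_map, ← additiveExtensionEntry_map, h]

instance additiveExtension_full [F.Full] : (additiveExtension F).Full where
  map_surjective f := ⟨fun i j => F.preimage (additiveExtensionEntry F f i j),
    additiveExtensionEntry_injective F fun _ _ =>
      (additiveExtensionEntry_map F _ _ _).trans (F.map_preimage _)⟩

/-- The additive extension of `F` restricts to `F` along the embedding of `C`. -/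
def additiveExtensionObjEmbedding (X : C) :
    (additiveExtension F).obj ((Mat_.embedding C).obj X) ≅ F.obj X :=
  biproductUniqueIso fun _ : PUnit => F.obj X

end AdditiveExtension

/-! ### The isomorphism of translation quivers -/

theorem TransQuiver.Iso.isTranslationQuiver {V : Type u} [Quiver.{v} V] {W : Type w}
    [Quiver.{v'} W] {τ : V → Option V} {σ : W → Option W} (Φ : TransQuiver.Iso τ σ)
    (h : TransQuiver.IsTranslationQuiver τ) : TransQuiver.IsTranslationQuiver σ where
  no_loops x := by
    obtain ⟨x, rfl⟩ := Φ.vertex.surjective x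
    exact ⟨fun a => (h.no_loops x).false ((Φ.arrow x x).symm a)⟩
  injective x y z hx hy := by
    obtain ⟨x, rfl⟩ := Φ.vertex.surjective x
    obtain ⟨y, rfl⟩ := Φ.vertex.surjective y
    rw [← Φ.translation, Option.map_eq_some_iff] at hx hy
    obtain ⟨a, ha, rfl⟩ := hx
    obtain ⟨b, hb, e⟩ := hy
    rw [Φ.vertex.injective e] at hb
    rw [h.injective _ _ _ ha hb]
  card_arrows x z hx y := by
    obtain ⟨x, rfl⟩ := Φ.vertex.surjective x
    obtain ⟨y, rfl⟩ := Φ.vertex.surjective y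
    rw [← Φ.translation, Option.map_eq_some_iff] at hx
    obtain ⟨a, ha, rfl⟩ := hx
    rw [← Nat.card_congr (Φ.arrow y x), ← Nat.card_congr (Φ.arrow a y), h.card_arrows x a ha y]

namespace TypeA

open AuslanderReiten TransQuiver

variable {n : ℕ} {Q : TypeA n} {k : Type u} [Field k]

theorem indClass_eq_iff {M N : Q.Ind k} : indClass M = indClass N ↔ Nonempty (M ≅ N) :=
  _root_.Quotient.eq

theorem nonempty_rep_indClass_iso (M : Q.Ind k) : Nonempty ((indClass M).rep ≅ M.obj) := by
  obtain ⟨e⟩ := indClass_eq_iff.1 (_root_.Quotient.out_eq (indClass M))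
  exact ⟨(ObjectProperty.ι _).mapIso e⟩

theorem arTranslation_eq_none {x : Q.IndClass k} (h : Projective x.rep) :
    Q.arTranslation k x = none :=
  dif_neg fun h' => h'.1 h

theorem arTranslation_eq_some {x y : Q.IndClass k} (h : IsTranslate x.rep y.rep)
    (huniq : ∀ z : Q.IndClass k, IsTranslate x.rep z.rep → z = y) :
    Q.arTranslation k x = some y :=
  have hx : ¬ Projective x.rep ∧ ∃ z : Q.IndClass k, IsTranslate x.rep z.rep :=
    ⟨h.not_projective, y, h⟩
  (dif_pos hx).trans (congrArg some (huniq _ hx.2.choose_spec))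

variable (c : Q.PivotScalars k)

theorem bijective_indClass_segmentFunctor :
    Function.Bijective fun γ => indClass ((segmentFunctor c).obj (Q.seg k γ)) := by
  refine ⟨fun γ δ h => ?_, fun x => ?_⟩
  · obtain ⟨e⟩ := indClass_eq_iff.1 h
    exact eq_of_iso (k := k) ((ObjectProperty.ι _).mapIso e)
  · obtain ⟨M, rfl⟩ := _root_.Quotient.exists_rep x
    obtain ⟨γ, ⟨e⟩⟩ := exists_iso_segmentRep M.property
    exact ⟨γ, indClass_eq_iff.2 ⟨ObjectProperty.isoMk _ e.symm⟩⟩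

theorem map_rotation_eq_arTranslation (γ : Q.Segment) :
    (Q.rotation γ).map (fun δ => indClass ((segmentFunctor c).obj (Q.seg k δ))) =
      Q.arTranslation k (indClass ((segmentFunctor c).obj (Q.seg k γ))) := by
  obtain ⟨e⟩ := nonempty_rep_indClass_iso ((segmentFunctor c).obj (Q.seg k γ))
  cases h : Q.rotation γ with
  | none => exact (arTranslation_eq_none (.of_iso e.symm (rotation_eq_none_iff.1 h))).symm
  | some δ =>
    obtain ⟨e'⟩ := nonempty_rep_indClass_iso ((segmentFunctor c).obj (Q.seg k δ))
    refine (arTranslation_eq_some ((rotation_eq_some_iff.1 h).of_iso e.symm e'.symm)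
      fun z hz => ?_).symm
    obtain ⟨ε, rfl⟩ := (bijective_indClass_segmentFunctor c).2 z
    obtain ⟨e''⟩ := nonempty_rep_indClass_iso ((segmentFunctor c).obj (Q.seg k ε))
    have hε : Q.rotation γ = some ε := rotation_eq_some_iff.2 (hz.of_iso e e'')
    rw [Option.some.inj (hε.symm.trans h)]

/-- The isomorphism from the quiver of line segments to the Auslander–Reiten quiver that sends
`γ` to the class of `F γ`. The arrows of the target are only counted by its definition, so the
bijections on arrows are arbitrary. -/
def translationQuiverIso : TransQuiver.Iso Q.rotation (Q.arTranslation k) where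
  vertex := Equiv.ofBijective _ (bijective_indClass_segmentFunctor c)
  arrow γ δ := (Fintype.equivFin (γ ⟶ δ)).trans (finCongr
    (finrank_irr (nonempty_rep_indClass_iso ((segmentFunctor c).obj (Q.seg k γ))).some
      (nonempty_rep_indClass_iso ((segmentFunctor c).obj (Q.seg k δ))).some).symm)
  translation γ := map_rotation_eq_arTranslation c γ

/-! ### The additive closure of the category of line segments -/

instance segmentFunctorAdd_full : (segmentFunctorAdd c).Full := by
  unfold segmentFunctorAdd; infer_instance

instance segmentFunctorAdd_faithful : (segmentFunctorAdd c).Faithful := by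
  unfold segmentFunctorAdd; infer_instance

instance segmentFunctorAdd_additive : (segmentFunctorAdd c).Additive := by
  unfold segmentFunctorAdd; infer_instance

instance segmentFunctorAdd_essSurj : (segmentFunctorAdd c).EssSurj where
  mem_essImage M := by
    induction M using rep_induction with
    | iso e h => exact h.ofIso e
    | zero M hM =>
      have := hasZeroObject_of_hasFiniteBiproducts (Mat_ (Q.SegmentCategory k))
      exact ⟨_, ⟨((segmentFunctorAdd c).map_isZero (isZero_zero _)).iso hM⟩⟩
    | summand γ M h =>
      obtain ⟨X, ⟨e⟩⟩ := h
      have := hasBinaryBiproducts_of_finite_biproducts (Mat_ (Q.SegmentCategory k))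
      have := preservesBinaryBiproducts_of_preservesBiproducts (segmentFunctorAdd c)
      exact ⟨(Mat_.embedding _).obj (Q.seg k γ) ⊞ X, ⟨(segmentFunctorAdd c).mapBiprod _ _ ≪≫
        biprod.mapIso (additiveExtensionObjEmbedding (segmentFunctor c ⋙ ObjectProperty.ι _)
          (Q.seg k γ)) e⟩⟩

instance segmentFunctorAdd_isEquivalence : (segmentFunctorAdd c).IsEquivalence where

theorem isAbelianCategory_mat_segmentCategory :
    IsAbelianCategory (Mat_ (Q.SegmentCategory k)) :=
  ⟨abelianOfEquivalence (segmentFunctorAdd (Q.signScalars k)), rfl⟩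

end TypeA

end

open CategoryTheory CategoryTheory.Limits TypeA AuslanderReiten in
theorem theorem1_general (n : ℕ) (Q : TypeA n) (k : Type u) [Field k] :
    (∃ c : Q.PivotScalars k, ∀ {γ δ : Q.Segment} (p : γ ⟶ δ),
      (c.coeff p : k) = 1 ∨ (c.coeff p : k) = -1) ∧
    ∀ c : Q.PivotScalars k,
      (segmentFunctor c).IsEquivalence ∧
      TransQuiver.IsTranslationQuiver Q.rotation ∧
      TransQuiver.IsTranslationQuiver (Q.arTranslation k) ∧
      (∃ Φ : TransQuiver.Iso Q.rotation (Q.arTranslation k),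
        ∀ γ, Φ.vertex γ = indClass ((segmentFunctor c).obj (Q.seg k γ))) ∧
      (∀ γ δ : Q.Segment, ∃ b : Module.Basis (γ ⟶ δ) k
          (Irr k ((segmentFunctor c).obj (Q.seg k γ)).obj ((segmentFunctor c).obj (Q.seg k δ)).obj),
        ∀ p : γ ⟶ δ, ∃ hp : ((segmentFunctor c).map (Q.pivot k p)).hom ∈ radical k _ _,
          b p = Submodule.Quotient.mk ⟨((segmentFunctor c).map (Q.pivot k p)).hom, hp⟩) ∧
      Function.Bijective (fun γ => indClass ((segmentFunctor c).obj (Q.seg k γ))) ∧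
      (∀ {γ δ : Q.Segment} (p : γ ⟶ δ),
        IsIrreducible ((segmentFunctor c).map (Q.pivot k p)).hom) ∧
      (∀ {M N : Q.Rep k} (f : M ⟶ N), Indecomposable M → Indecomposable N → IsIrreducible f →
        ∃! p : (γ : Q.Segment) × (δ : Q.Segment) × (γ ⟶ δ),
          Nonempty (Arrow.mk f ≅ Arrow.mk ((segmentFunctor c).map (Q.pivot k p.2.2)).hom)) ∧
      (∀ γ : Q.Segment,
        (Q.rotation γ).map (fun δ => indClass ((segmentFunctor c).obj (Q.seg k δ))) =
          Q.arTranslation k (indClass ((segmentFunctor c).obj (Q.seg k γ)))) ∧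
      (∀ γ : Q.Segment,
        Q.rotation γ = none ↔ Projective ((segmentFunctor c).obj (Q.seg k γ)).obj) ∧
      (∀ γ δ : Q.Segment, Q.rotation γ = some δ ↔
        IsTranslate ((segmentFunctor c).obj (Q.seg k γ)).obj
          ((segmentFunctor c).obj (Q.seg k δ)).obj) ∧
      IsAbelianCategory (Mat_ (Q.SegmentCategory k)) ∧
      (segmentFunctorAdd c).IsEquivalence ∧
      PreservesFiniteLimits (segmentFunctorAdd c) ∧
      PreservesFiniteColimits (segmentFunctorAdd c) :=
  ⟨⟨Q.signScalars k, signScalars_coeff_eq k⟩, fun c =>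
    ⟨inferInstance, isTranslationQuiver_rotation,
      (translationQuiverIso c).isTranslationQuiver isTranslationQuiver_rotation,
      ⟨translationQuiverIso c, fun _ => rfl⟩,
      fun γ δ => ⟨pivotBasis c γ δ, fun p => ⟨_, pivotBasis_apply c p⟩⟩,
      bijective_indClass_segmentFunctor c, isIrreducible_segmentHom_pivot c,
      existsUnique_pivot c, map_rotation_eq_arTranslation c,
      fun _ => rotation_eq_none_iff, fun _ _ => rotation_eq_some_iff,
      isAbelianCategory_mat_segmentCategory, inferInstance, inferInstance, inferInstance⟩⟩

open CategoryTheory CategoryTheory.Limits TypeA AuslanderReiten in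
theorem theorem1 (n : ℕ) (Q : TypeA n) (k : Type u) [Field k] [IsAlgClosed k] :
    -- scalars for the pivots exist, and signs will do
    (∃ c : Q.PivotScalars k, ∀ {γ δ : Q.Segment} (p : γ ⟶ δ),
      (c.coeff p : k) = 1 ∨ (c.coeff p : k) = -1) ∧
    ∀ c : Q.PivotScalars k,
      (segmentFunctor c).IsEquivalence ∧
      -- the isomorphism of translation quivers
      TransQuiver.IsTranslationQuiver Q.rotation ∧
      TransQuiver.IsTranslationQuiver (Q.arTranslation k) ∧
      (∃ Φ : TransQuiver.Iso Q.rotation (Q.arTranslation k),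
        ∀ γ, Φ.vertex γ = indClass ((segmentFunctor c).obj (Q.seg k γ))) ∧
      (∀ γ δ : Q.Segment, ∃ b : Module.Basis (γ ⟶ δ) k
          (Irr k ((segmentFunctor c).obj (Q.seg k γ)).obj ((segmentFunctor c).obj (Q.seg k δ)).obj),
        ∀ p : γ ⟶ δ, ∃ hp : ((segmentFunctor c).map (Q.pivot k p)).hom ∈ radical k _ _,
          b p = Submodule.Quotient.mk ⟨((segmentFunctor c).map (Q.pivot k p)).hom, hp⟩) ∧
      -- the bijections
      Function.Bijective (fun γ => indClass ((segmentFunctor c).obj (Q.seg k γ))) ∧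
      (∀ {γ δ : Q.Segment} (p : γ ⟶ δ),
        IsIrreducible ((segmentFunctor c).map (Q.pivot k p)).hom) ∧
      (∀ {M N : Q.Rep k} (f : M ⟶ N), Indecomposable M → Indecomposable N → IsIrreducible f →
        ∃! p : (γ : Q.Segment) × (δ : Q.Segment) × (γ ⟶ δ),
          Nonempty (Arrow.mk f ≅ Arrow.mk ((segmentFunctor c).map (Q.pivot k p.2.2)).hom)) ∧
      -- the rotation and the Auslander–Reiten translation
      (∀ γ : Q.Segment,
        (Q.rotation γ).map (fun δ => indClass ((segmentFunctor c).obj (Q.seg k δ))) =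
          Q.arTranslation k (indClass ((segmentFunctor c).obj (Q.seg k γ)))) ∧
      (∀ γ : Q.Segment,
        Q.rotation γ = none ↔ Projective ((segmentFunctor c).obj (Q.seg k γ)).obj) ∧
      (∀ γ δ : Q.Segment, Q.rotation γ = some δ ↔
        IsTranslate ((segmentFunctor c).obj (Q.seg k γ)).obj
          ((segmentFunctor c).obj (Q.seg k δ)).obj) ∧
      -- exactness for the induced abelian structure
      IsAbelianCategory (Mat_ (Q.SegmentCategory k)) ∧
      (segmentFunctorAdd c).IsEquivalence ∧
      PreservesFiniteLimits (segmentFunctorAdd c) ∧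
      PreservesFiniteColimits (segmentFunctorAdd c) :=
  theorem1_general n Q k
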